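/- Let $\mathfrak A$ be a unital C$^*$-algebra, $\alpha=(\alpha_t)_{t\in\mathbb R}$ a one-parameter group of $*$-automorphisms of $\mathfrak A$, and $\omega$ an $\alpha$-invariant state of $\mathfrak A$ such that $t\mapsto\omega(\alpha_t(X)Y)$ is continuous for all $X,Y\in\mathfrak A$. Let $(\mathcal H,\pi,\Omega)$ be the GNS triple of $\omega$, let $U$ be the (strongly continuous) one-parameter unitary group on $\mathcal H$ with $U(t)\pi(X)\Omega=\pi(\alpha_t(X))\Omega$ for $X\in\mathfrak A$, and let $K$ be its self-adjoint generator, with the sign convention $U(t)=e^{-itK}$. Let $\beta>0$, let $\mathfrak B$ be a (not necessarily unital) $*$-subalgebra of $\mathfrak A$, and put $F_{X,Y}(t)=\omega(\alpha_t(X)Y)$. A linear subspace $\mathfrak S\subset B(\mathcal H)$ is called $b$-bounded with respect to $K$ and $\Omega$ if $\mathfrak S\Omega\subset D(e^{-bK})$ and the linear map $\mathfrak S\ni T\mapsto e^{-bK}T\Omega\in\mathcal H$ is bounded for the operator norm on $\mathfrak S$. The state $\omega$ is called $\beta$-holomorphic on $\mathfrak B$ if it is $\alpha$-invariant and, for all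 $X,Y\in\mathfrak B$, $F_{X,Y}$ is the boundary value on $\mathbb R$ of a function continuous on $\{0\le\Im z\le\beta\}$ and holomorphic in $\{0<\Im z<\beta\}$; this (unique) extension is again denoted by $F_{X,Y}$. Then $\pi(\mathfrak B)$ is $\frac\beta2$-bounded with respect to $K$ and $\Omega$ if and only if $\omega$ is $\beta$-holomorphic on $\mathfrak B$ and there is a constant $C>0$ such that $$|F_{X,Y}(t+i\beta)|\le C\,\|X\|\,\|Y\|\qquad\text{for all }X,Y\in\mathfrak B,\ t\in\mathbb R .$$ If moreover $\mathfrak B$ is norm closed, then $\pi(\mathfrak B)$ is $\frac\beta2$-bounded with respect to $K$ and $\Omega$ if and only if $\omega$ is $\beta$-holomorphic on $\mathfrak B$. -/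

import Mathlib

open MeasureTheory Filter Topology Set
open scoped ComplexOrder InnerProductSpace ENNReal

noncomputable section

/-! ### Spectral measures and the functional calculus of unbounded operators -/

/-- A (projection-valued, Borel) spectral measure on `ℝ` acting on the Hilbert space `H`.
Only the values on Borel sets are meaningful. -/
structure SpectralMeasure (H : Type*) [NormedAddCommGroup H] [InnerProductSpace ℂ H]
    [CompleteSpace H] where
  /-- the projection attached to a set -/
  proj : Set ℝ → H →L[ℂ] H
  isStarProjection : ∀ B, MeasurableSet B → IsStarProjection (proj B)
  proj_univ : proj univ = 1
  proj_inter : ∀ B C, MeasurableSet B → MeasurableSet C → proj (B ∩ C) = proj B * proj C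
  hasSum_iUnion : ∀ B : ℕ → Set ℝ, (∀ n, MeasurableSet (B n)) →
    Pairwise (Function.onFun Disjoint B) →
    ∀ ξ : H, HasSum (fun n => proj (B n) ξ) (proj (⋃ n, B n) ξ)

namespace SpectralMeasure

variable {H : Type*} [NormedAddCommGroup H] [InnerProductSpace ℂ H] [CompleteSpace H]
variable (E : SpectralMeasure H)

theorem proj_empty : E.proj ∅ = 0 := by
  ext ξ
  have h := E.hasSum_iUnion (fun _ => ∅) (fun _ => MeasurableSet.empty)
    (fun _ _ _ => disjoint_empty _) ξ
  simpa [summable_const_iff] using h.summable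

theorem inner_proj {B C : Set ℝ} (hB : MeasurableSet B) (hC : MeasurableSet C) (ξ η : H) :
    ⟪E.proj B ξ, E.proj C η⟫_ℂ = ⟪ξ, E.proj (B ∩ C) η⟫_ℂ := by
  have h := (E.isStarProjection B hB).isSelfAdjoint
  rw [E.proj_inter B C hB hC, mul_apply_eq_comp,
    ← ContinuousLinearMap.adjoint_inner_left (E.proj B) (E.proj C η) ξ,
    ← ContinuousLinearMap.star_eq_adjoint, h.star_eq]

theorem norm_sq_proj {B : Set ℝ} (hB : MeasurableSet B) (ξ : H) :
    ‖E.proj B ξ‖ ^ 2 = (⟪ξ, E.proj B ξ⟫_ℂ).re := by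
  have h := E.inner_proj hB hB ξ ξ
  rw [inter_self, inner_self_eq_norm_sq_to_K] at h
  rw [← h]
  norm_cast

/-- The scalar spectral measure `μ_ξ(B) = (E(B)ξ, ξ) = ‖E(B)ξ‖²` of a vector `ξ`. -/
def scalarMeasure (ξ : H) : Measure ℝ :=
  Measure.ofMeasurable (fun B _ => ENNReal.ofReal (‖E.proj B ξ‖ ^ 2))
    (by simp [E.proj_empty])
    (by
      intro B hB hd
      have h := E.hasSum_iUnion B hB hd ξ
      have h2 : HasSum (fun n => ‖E.proj (B n) ξ‖ ^ 2) (‖E.proj (⋃ n, B n) ξ‖ ^ 2) := by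
        have h3 := Complex.hasSum_re (h.mapL (innerSL ℂ ξ))
        simpa only [innerSL_apply_apply, ← E.norm_sq_proj (hB _),
          ← E.norm_sq_proj (MeasurableSet.iUnion hB)] using h3
      rw [← h2.tsum_eq, ENNReal.ofReal_tsum_of_nonneg (fun _ => by positivity) h2.summable])

theorem scalarMeasure_apply (ξ : H) {B : Set ℝ} (hB : MeasurableSet B) :
    E.scalarMeasure ξ B = ENNReal.ofReal (‖E.proj B ξ‖ ^ 2) :=
  Measure.ofMeasurable_apply B hB

instance (ξ : H) : IsFiniteMeasure (E.scalarMeasure ξ) :=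
  ⟨by rw [E.scalarMeasure_apply ξ MeasurableSet.univ]; exact ENNReal.ofReal_lt_top⟩

/-- The integral `∑ c • E(s = c)` of a simple function `s` against `E`. -/
def simpleIntegral (s : SimpleFunc ℝ ℝ) : H →L[ℂ] H :=
  ∑ c ∈ s.range, (c : ℂ) • E.proj (s ⁻¹' {c})

theorem simpleIntegral_eq (s : SimpleFunc ℝ ℝ) :
    E.simpleIntegral s =
      s.setToSimpleFunc (fun B => ContinuousLinearMap.toSpanSingleton ℝ (E.proj B)) := by
  ext ξ
  simp [simpleIntegral, SimpleFunc.setToSimpleFunc, Complex.coe_smul]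

theorem simpleIntegral_sub (s t : SimpleFunc ℝ ℝ) :
    E.simpleIntegral (s - t) = E.simpleIntegral s - E.simpleIntegral t := by
  simp only [simpleIntegral_eq]
  refine SimpleFunc.setToSimpleFunc_sub (μ := (0 : Measure ℝ)) _ ?_ (by simp) (by simp)
  intro B C hB hC _ _ hd
  have h : E.proj (B ∪ C) = E.proj B + E.proj C := by
    ext ξ
    have h1 := E.hasSum_iUnion (fun n => if n = 0 then B else if n = 1 then C else ∅)
      (fun n => by split_ifs <;> simp [hB, hC])
      (fun m n hmn => by
        dsimp only [Function.onFun]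
        split_ifs <;> first | omega | simp [hd.symm]) ξ
    have h2 : HasSum (fun n => E.proj (if n = 0 then B else if n = 1 then C else ∅) ξ)
        (∑ n ∈ Finset.range 2, E.proj (if n = 0 then B else if n = 1 then C else ∅) ξ) := by
      refine hasSum_sum_of_ne_finset_zero fun n hn => ?_
      simp only [Finset.mem_range, not_lt] at hn
      rw [if_neg (by omega), if_neg (by omega), E.proj_empty]
      rfl
    have h3 : (⋃ n : ℕ, if n = 0 then B else if n = 1 then C else ∅) = B ∪ C := by
      ext x
      simp only [mem_iUnion, mem_union]
      constructor
      · rintro ⟨n, hn⟩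
        split_ifs at hn <;> simp_all
      · rintro (h | h)
        · exact ⟨0, by simpa using h⟩
        · exact ⟨1, by simpa using h⟩
    rw [h3] at h1
    simpa [Finset.sum_range_succ] using h1.unique h2
  ext1
  simp [h]

/-- `‖s(E)ξ‖² = ∫ s² dμ_ξ` for simple functions `s`. -/
theorem enorm_simpleIntegral_sq (s : SimpleFunc ℝ ℝ) (ξ : H) :
    ‖E.simpleIntegral s ξ‖ₑ ^ 2 = ∫⁻ x, ‖s x‖ₑ ^ 2 ∂E.scalarMeasure ξ := by
  have h1 : ‖E.simpleIntegral s ξ‖ ^ 2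
      = ∑ c ∈ s.range, c ^ 2 * ‖E.proj (s ⁻¹' {c}) ξ‖ ^ 2 := by
    have h2 : ⟪E.simpleIntegral s ξ, E.simpleIntegral s ξ⟫_ℂ
        = ∑ c ∈ s.range, ((c ^ 2 * ‖E.proj (s ⁻¹' {c}) ξ‖ ^ 2 : ℝ) : ℂ) := by
      simp only [simpleIntegral, sum_apply, sum_inner, smul_apply]
      refine Finset.sum_congr rfl fun c hc => ?_
      rw [inner_sum, Finset.sum_eq_single c]
      · rw [inner_smul_left, inner_smul_right, inner_self_eq_norm_sq_to_K]
        simp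
        ring
      · intro d _ hdc
        rw [inner_smul_left, inner_smul_right,
          E.inner_proj (s.measurableSet_fiber c) (s.measurableSet_fiber d)]
        have : s ⁻¹' {c} ∩ s ⁻¹' {d} = ∅ := by
          ext x
          simp only [mem_inter_iff, mem_preimage, mem_singleton_iff, mem_empty_iff_false,
            iff_false, not_and]
          intro h h'
          exact hdc (h'.symm.trans h)
        simp [this, E.proj_empty]
      · intro h
        exact absurd hc h
    rw [inner_self_eq_norm_sq_to_K, ← Complex.ofReal_sum] at h2
    exact Complex.ofReal_injective (by rw [← h2]; simp)
  have h3 : ∫⁻ x, ‖s x‖ₑ ^ 2 ∂E.scalarMeasure ξ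
      = (s.map (fun c : ℝ => ‖c‖ₑ ^ 2)).lintegral (E.scalarMeasure ξ) := by
    rw [← SimpleFunc.lintegral_eq_lintegral]
    rfl
  rw [h3, SimpleFunc.map_lintegral, ← ofReal_norm, ← ENNReal.ofReal_pow (norm_nonneg _), h1,
    ENNReal.ofReal_sum_of_nonneg (fun _ _ => by positivity)]
  refine Finset.sum_congr rfl fun c _ => ?_
  rw [E.scalarMeasure_apply ξ (s.measurableSet_fiber c), ENNReal.ofReal_mul (by positivity),
    ← ofReal_norm, ← ENNReal.ofReal_pow (norm_nonneg _)]
  simp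

/-- The domain `{ξ : ∫ |f|² dμ_ξ < ∞}` of the unbounded operator `f(E) = ∫ f dE`. -/
def integralDomain (f : ℝ → ℝ) : Submodule ℂ H where
  carrier := {ξ | ∫⁻ x, ‖f x‖ₑ ^ 2 ∂E.scalarMeasure ξ < ∞}
  zero_mem' := by
    have : E.scalarMeasure 0 = 0 := by
      ext B hB
      simp [E.scalarMeasure_apply _ hB]
    simp [this]
  add_mem' := by
    intro ξ η hξ hη
    have h : E.scalarMeasure (ξ + η) ≤
        (2 : ℝ≥0∞) • (E.scalarMeasure ξ + E.scalarMeasure η) := by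
      refine Measure.le_iff.2 fun B hB => ?_
      simp only [Measure.smul_apply, Measure.add_apply, E.scalarMeasure_apply _ hB, smul_eq_mul]
      rw [← ENNReal.ofReal_add (by positivity) (by positivity),
        ← ENNReal.ofReal_ofNat 2, ← ENNReal.ofReal_mul (by norm_num)]
      refine ENNReal.ofReal_le_ofReal ?_
      rw [map_add]
      have := norm_add_le (E.proj B ξ) (E.proj B η)
      nlinarith [sq_nonneg (‖E.proj B ξ‖ - ‖E.proj B η‖), norm_nonneg (E.proj B ξ + E.proj B η)]
    refine (lintegral_mono' h le_rfl).trans_lt ?_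
    rw [lintegral_smul_measure, lintegral_add_measure]
    exact ENNReal.mul_lt_top (by simp) (ENNReal.add_lt_top.2 ⟨hξ, hη⟩)
  smul_mem' := by
    intro c ξ hξ
    have h : E.scalarMeasure (c • ξ) = ENNReal.ofReal (‖c‖ ^ 2) • E.scalarMeasure ξ := by
      ext B hB
      rw [Measure.smul_apply, E.scalarMeasure_apply _ hB, E.scalarMeasure_apply _ hB, map_smul,
        norm_smul, mul_pow, ENNReal.ofReal_mul (by positivity), smul_eq_mul]
    change ∫⁻ x, ‖f x‖ₑ ^ 2 ∂E.scalarMeasure (c • ξ) < ∞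
    rw [h, lintegral_smul_measure]
    exact ENNReal.mul_lt_top ENNReal.ofReal_lt_top hξ

/-- Simple functions `s_n → f` with `|s_n - f| ≤ |f|`. -/
def approx {f : ℝ → ℝ} (hf : Measurable f) (n : ℕ) : SimpleFunc ℝ ℝ :=
  SimpleFunc.approxOn f hf univ 0 (mem_univ 0) n

theorem exists_tendsto_approx {f : ℝ → ℝ} (hf : Measurable f) {ξ : H}
    (hξ : ξ ∈ E.integralDomain f) :
    ∃ η, Tendsto (fun n => E.simpleIntegral (approx hf n) ξ) atTop (𝓝 η) := by
  have h0 : Tendsto (fun n => ∫⁻ x, ‖approx hf n x - f x‖ₑ ^ 2 ∂E.scalarMeasure ξ) atTop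
      (𝓝 0) := by
    have h := tendsto_lintegral_of_dominated_convergence (μ := E.scalarMeasure ξ)
      (F := fun n x => ‖approx hf n x - f x‖ₑ ^ 2) (f := fun _ => 0)
      (fun x => ‖f x‖ₑ ^ 2)
      (fun n => (((approx hf n).measurable.sub hf).enorm).pow_const 2)
      (fun n => Eventually.of_forall fun x => by
        have := SimpleFunc.edist_approxOn_le hf (mem_univ (0 : ℝ)) x n
        rw [edist_eq_enorm_sub, edist_comm, edist_zero_right] at this
        exact pow_le_pow_left' this 2)
      (ne_of_lt hξ)
      (Eventually.of_forall fun x => by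
        have h1 : Tendsto (fun n => approx hf n x) atTop (𝓝 (f x)) :=
          SimpleFunc.tendsto_approxOn hf (mem_univ (0 : ℝ)) (by simp)
        have h2 := ENNReal.Tendsto.pow (n := 2) (h1.sub_const (f x)).enorm
        simpa using h2)
    simpa using h
  refine cauchySeq_tendsto_of_complete ?_
  rw [EMetric.cauchySeq_iff]
  intro ε hε
  have hε4 : (0 : ℝ≥0∞) < ε ^ 2 / 4 := by
    refine ENNReal.div_pos (pow_ne_zero 2 hε.ne') (by simp)
  obtain ⟨N, hN⟩ := (h0.eventually (gt_mem_nhds hε4)).exists_forall_of_atTop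
  refine ⟨N, fun m hm n hn => ?_⟩
  have key : edist (E.simpleIntegral (approx hf m) ξ) (E.simpleIntegral (approx hf n) ξ) ^ 2
      < ε ^ 2 := by
    rw [edist_eq_enorm_sub, ← sub_apply, ← E.simpleIntegral_sub,
      E.enorm_simpleIntegral_sq]
    calc ∫⁻ x, ‖(approx hf m - approx hf n) x‖ₑ ^ 2 ∂E.scalarMeasure ξ
        ≤ ∫⁻ x, (2 * ‖approx hf m x - f x‖ₑ ^ 2 + 2 * ‖approx hf n x - f x‖ₑ ^ 2)
            ∂E.scalarMeasure ξ := by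
          refine lintegral_mono fun x => ?_
          simp only [← ofReal_norm, SimpleFunc.coe_sub, Pi.sub_apply]
          rw [← ENNReal.ofReal_pow (norm_nonneg _), ← ENNReal.ofReal_pow (norm_nonneg _),
            ← ENNReal.ofReal_pow (norm_nonneg _), ← ENNReal.ofReal_ofNat 2,
            ← ENNReal.ofReal_mul (by norm_num), ← ENNReal.ofReal_mul (by norm_num),
            ← ENNReal.ofReal_add (by positivity) (by positivity)]
          refine ENNReal.ofReal_le_ofReal ?_
          simp only [Real.norm_eq_abs, sq_abs]
          nlinarith [sq_nonneg ((approx hf m x - f x) + (approx hf n x - f x))]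
      _ = 2 * ∫⁻ x, ‖approx hf m x - f x‖ₑ ^ 2 ∂E.scalarMeasure ξ
          + 2 * ∫⁻ x, ‖approx hf n x - f x‖ₑ ^ 2 ∂E.scalarMeasure ξ := by
          have hm : ∀ k, Measurable fun x => ‖approx hf k x - f x‖ₑ ^ 2 := fun k =>
            (((approx hf k).measurable.sub hf).enorm).pow_const 2
          rw [lintegral_add_left ((hm m).const_mul 2), lintegral_const_mul _ (hm m),
            lintegral_const_mul _ (hm n)]
      _ < 2 * (ε ^ 2 / 4) + 2 * (ε ^ 2 / 4) :=
          ENNReal.add_lt_add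
            ((ENNReal.mul_lt_mul_iff_right (by simp) (by simp)).2 (hN m hm))
            ((ENNReal.mul_lt_mul_iff_right (by simp) (by simp)).2 (hN n hn))
      _ = ε ^ 2 := by
          rw [← add_mul, ← mul_div_assoc, show (2 : ℝ≥0∞) + 2 = 4 by norm_num, mul_comm,
            ENNReal.mul_div_cancel_right (by simp) (by simp)]
  exact lt_of_pow_lt_pow_left' 2 key

/-- The unbounded operator `f(E) = ∫ f(λ) dE(λ)`: its domain is `{ξ : ∫ |f|² dμ_ξ < ∞}`, and
`f(E)ξ = lim_n s_n(E)ξ` for simple functions `s_n` converging to `f` in `L²(μ_ξ)`. -/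
def integral {f : ℝ → ℝ} (hf : Measurable f) : H →ₗ.[ℂ] H where
  domain := E.integralDomain f
  toFun :=
    { toFun := fun ξ => (E.exists_tendsto_approx hf ξ.2).choose
      map_add' := fun ξ η => by
        have h := (E.exists_tendsto_approx hf ξ.2).choose_spec.add
          (E.exists_tendsto_approx hf η.2).choose_spec
        refine tendsto_nhds_unique (E.exists_tendsto_approx hf (ξ + η).2).choose_spec ?_
        simpa using h
      map_smul' := fun c ξ => by
        have h := (E.exists_tendsto_approx hf ξ.2).choose_spec.const_smul c
        refine tendsto_nhds_unique (E.exists_tendsto_approx hf (c • ξ).2).choose_spec ?_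
        simpa using h }

end SpectralMeasure

section Operators

variable {H : Type*} [NormedAddCommGroup H] [InnerProductSpace ℂ H] [CompleteSpace H]

open scoped Classical in
/-- Functional calculus: `f(K) = ∫ f(λ) dE(λ)`, where `E` is the spectral resolution of the
self-adjoint operator `K`, that is, the spectral measure with `K = ∫ λ dE(λ)`. (An operator that is
not self-adjoint has no spectral resolution, and is sent to the zero operator on `{0}`.) -/
def functionOf (K : H →ₗ.[ℂ] H) {f : ℝ → ℝ} (hf : Measurable f) : H →ₗ.[ℂ] H :=
  if h : ∃ E : SpectralMeasure H, K = E.integral measurable_id then h.choose.integral hf else ⊥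

/-- The operator `e^{-bK}`. -/
def expNeg (K : H →ₗ.[ℂ] H) (b : ℝ) : H →ₗ.[ℂ] H :=
  functionOf K (f := fun x => Real.exp (-b * x)) (by fun_prop)

/-- A linear space `S` of bounded operators is `b`-bounded with respect to `K` and `Ω` if
`SΩ ⊆ D(e^{-bK})` and `X ↦ e^{-bK}XΩ` is bounded on `S`. -/
def IsBetaBounded (b : ℝ) (K : H →ₗ.[ℂ] H) (Ω : H) (S : Submodule ℂ (H →L[ℂ] H)) : Prop :=
  ∃ hdom : ∀ X ∈ S, X Ω ∈ (expNeg K b).domain,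
    ∃ C : ℝ, ∀ X (hX : X ∈ S), ‖expNeg K b ⟨X Ω, hdom X hX⟩‖ ≤ C * ‖X‖

/-- The generator `K` of a one-parameter group `U(t) = e^{-itK}`: `Kξ = i (d/dt) U(t)ξ` at `t = 0`,
on the vectors `ξ` for which the derivative exists. -/
def generator (U : ℝ → H →L[ℂ] H) : H →ₗ.[ℂ] H where
  domain :=
    { carrier := {ξ | DifferentiableAt ℝ (fun t => U t ξ) 0}
      zero_mem' := by simp
      add_mem' := fun {ξ η} hξ hη => by
        simpa using DifferentiableAt.fun_add (f := fun t => U t ξ) (g := fun t => U t η) hξ hη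
      smul_mem' := fun c ξ hξ => by
        simpa using DifferentiableAt.fun_const_smul (f := fun t => U t ξ) hξ c }
  toFun :=
    { toFun := fun ξ => Complex.I • deriv (fun t => U t (ξ : H)) 0
      map_add' := fun ξ η => by
        have h := deriv_fun_add ξ.2 η.2
        simp [h]
      map_smul' := fun c ξ => by
        have h := deriv_fun_const_smul c ξ.2
        simp [h, smul_comm Complex.I c] }

end Operators

/-! ### The GNS representation and the implementing unitary group -/

section GNS

variable {A : Type*} [CStarAlgebra A] [PartialOrder A] [StarOrderedRing A]

/-- The cyclic vector `Ω` of the GNS representation of `ω`: the class of `1`. -/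
def gnsVector (ω : A →ₚ[ℂ] ℂ) : ω.GNS := (ω.toPreGNS 1 : ω.PreGNS)

/-- The linear map `X ↦ π(X)Ω`. -/
def gnsOrbit (ω : A →ₚ[ℂ] ℂ) : A →ₗ[ℂ] ω.GNS where
  toFun X := ω.gnsStarAlgHom X (gnsVector ω)
  map_add' X Y := by simp
  map_smul' c X := by simp

/-- The operator `U(t)` on the GNS space of an `α`-invariant state: the bounded operator with
`U(t)π(X)Ω = π(α_t(X))Ω`, extended from the dense subspace `π(A)Ω` by continuity. -/
def gnsUnitary (α : ℝ → A ≃⋆ₐ[ℂ] A) (ω : A →ₚ[ℂ] ℂ) (t : ℝ) : ω.GNS →L[ℂ] ω.GNS :=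
  (gnsOrbit ω ∘ₗ ((α t : A →⋆ₐ[ℂ] A) : A →ₐ[ℂ] A).toLinearMap).extendOfNorm (gnsOrbit ω)

/-- `π(B)`, as a linear space of bounded operators on the GNS space. -/
def gnsImage (ω : A →ₚ[ℂ] ℂ) (B : NonUnitalStarSubalgebra ℂ A) :
    Submodule ℂ (ω.GNS →L[ℂ] ω.GNS) :=
  B.toSubmodule.map (ω.gnsStarAlgHom : A →ₐ[ℂ] (ω.GNS →L[ℂ] ω.GNS)).toLinearMap

end GNS

/-! ### Holomorphic states -/

/-- `G` is continuous on the closed strip `0 ≤ Im z ≤ β`, holomorphic in the open strip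
`0 < Im z < β`, and has `F` as its boundary value on the real line. -/
structure IsStripExtension (β : ℝ) (F : ℝ → ℂ) (G : ℂ → ℂ) : Prop where
  continuousOn : ContinuousOn G {z | 0 ≤ z.im ∧ z.im ≤ β}
  differentiableOn : DifferentiableOn ℂ G {z | 0 < z.im ∧ z.im < β}
  boundary : ∀ t : ℝ, G t = F t

section Holomorphic

variable {A : Type*} [CStarAlgebra A] [PartialOrder A]

/-- The correlation function `F_{X,Y}(t) = ω(α_t(X)Y)`. -/
def correlation (α : ℝ → A ≃⋆ₐ[ℂ] A) (ω : A →ₚ[ℂ] ℂ) (X Y : A) (t : ℝ) : ℂ :=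
  ω (α t X * Y)

/-- `ω` is `β`-holomorphic on `B`: it is `α`-invariant, and for `X, Y ∈ B` the function `F_{X,Y}`
is the boundary value of a function continuous on the closed strip and holomorphic inside. -/
def IsBetaHolomorphic (β : ℝ) (α : ℝ → A ≃⋆ₐ[ℂ] A) (ω : A →ₚ[ℂ] ℂ)
    (B : NonUnitalStarSubalgebra ℂ A) : Prop :=
  (∀ t X, ω (α t X) = ω X) ∧
    ∀ X ∈ B, ∀ Y ∈ B, ∃ G : ℂ → ℂ, IsStripExtension β (correlation α ω X Y) G

end Holomorphic

end

/-! Write $U(t)=\int e^{-itx}\,dE(x)$ and let $\mu_\xi$ be the measure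
$\langle\xi,E(\cdot)\xi\rangle$. By invariance
$F_{X,Y}(t)=\langle\pi(X^*)\Omega,U(-t)\pi(Y)\Omega\rangle$, so the diagonal function $F_{X^*,X}$ is
the characteristic function of the positive measure $\mu_\xi$ with $\xi=\pi(X)\Omega$. The quantity
to control is the energy $\int e^{-\beta x}\,d\mu_\xi=\|e^{-\beta K/2}\xi\|^2$, which is finite
exactly when $\xi$ lies in $D(e^{-\beta K/2})$.

If the energies are finite, $\int e^{izx}\,d\mu_\xi$ converges on the closed strip and extends the
diagonal functions. Polarization gives all $F_{X,Y}$, with the sum of two energies as a bound on the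
upper edge; rescaling the two vectors turns the sum into twice a product
(`norm_le_of_isStripExtension_inner`).

Conversely, let $G$ extend $F_{X^*,X}$. Positivity of $\mu_\xi$ brings in Landau's theorem: the
Laplace transform of a positive measure cannot continue holomorphically past its abscissa of
convergence. Hence $\int e^{-sx}\,d\mu_\xi<\infty$ for $s<\beta$. Uniqueness of the extension
identifies this integral with $G(is)$, and Fatou's lemma as $s\uparrow\beta$ bounds the energy by
$|G(i\beta)|$ (`IsStripExtension.lintegral_exp_le`). When $\mathfrak B$ is closed, finiteness of all
energies is enough: the square root of the energy is a lower semicontinuous seminorm on a Banach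
space, hence bounded (`exists_expEnergy_le`).

Two gaps remain. Boundedness is measured by $\|\pi(X)\|$, whereas the correlations see $\|X\|$;
truncating singular values in the closure of $\mathfrak B$ gives a preimage of $\pi(X)$ of norm at
most $\|\pi(X)\|$ (`exists_mem_norm_le_norm_map`). And $e^{-bK}$ is defined through a spectral
resolution of the generator, whose existence is Stone's theorem. It is proved here from Bochner's
theorem (`exists_functionOf_generator_eq`). -/

/-! ### Square integrals as L² seminorms. -/

theorem eLpNorm_two_sq {X F : Type*} [MeasurableSpace X] [NormedAddCommGroup F] (f : X → F)
    (μ : Measure X) : eLpNorm f 2 μ ^ 2 = ∫⁻ x, ‖f x‖ₑ ^ 2 ∂μ := by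
  have h := eLpNorm_nnreal_pow_eq_lintegral (f := f) (μ := μ) (p := 2) (by norm_num)
  simpa using h

theorem eLpNorm_two_lt_top {X F : Type*} [MeasurableSpace X] [NormedAddCommGroup F] {f : X → F}
    {μ : Measure X} (h : ∫⁻ x, ‖f x‖ₑ ^ 2 ∂μ < ∞) : eLpNorm f 2 μ < ∞ := by
  rw [← eLpNorm_two_sq] at h
  by_contra! h'
  rw [top_le_iff] at h'
  simp [h'] at h

theorem tendsto_eLpNorm_two_zero {X F ι : Type*} [MeasurableSpace X] [NormedAddCommGroup F]
    {l : Filter ι} {f : ι → X → F} {μ : Measure X}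
    (h : Tendsto (fun i => ∫⁻ x, ‖f i x‖ₑ ^ 2 ∂μ) l (𝓝 0)) :
    Tendsto (fun i => eLpNorm (f i) 2 μ) l (𝓝 0) := by
  simp_rw [← eLpNorm_two_sq] at h
  have h2 := (ENNReal.continuous_rpow_const (y := (1 / 2 : ℝ))).continuousAt.tendsto.comp h
  simp only [Function.comp_def, ← ENNReal.rpow_natCast, ← ENNReal.rpow_mul] at h2
  simpa using h2

/-! ### Complex functional calculus of a spectral measure, vector by vector. -/

namespace SpectralMeasure

variable {H : Type*} [NormedAddCommGroup H] [InnerProductSpace ℂ H] [CompleteSpace H]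
variable (E : SpectralMeasure H)

theorem proj_union {B C : Set ℝ} (hB : MeasurableSet B) (hC : MeasurableSet C)
    (hd : Disjoint B C) : E.proj (B ∪ C) = E.proj B + E.proj C := by
  ext ξ
  have h1 := E.hasSum_iUnion (fun n => if n = 0 then B else if n = 1 then C else ∅)
    (fun n => by split_ifs <;> simp [hB, hC])
    (fun m n hmn => by
      dsimp only [Function.onFun]
      split_ifs <;> first | omega | simp [hd.symm]) ξ
  have h2 : HasSum (fun n => E.proj (if n = 0 then B else if n = 1 then C else ∅) ξ)
      (∑ n ∈ Finset.range 2, E.proj (if n = 0 then B else if n = 1 then C else ∅) ξ) := by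
    refine hasSum_sum_of_ne_finset_zero fun n hn => ?_
    simp only [Finset.mem_range, not_lt] at hn
    rw [if_neg (by omega), if_neg (by omega), E.proj_empty]
    rfl
  have h3 : (⋃ n : ℕ, if n = 0 then B else if n = 1 then C else ∅) = B ∪ C := by
    ext x
    simp only [mem_iUnion, mem_union]
    constructor
    · rintro ⟨n, hn⟩
      split_ifs at hn <;> simp_all
    · rintro (h | h)
      · exact ⟨0, by simpa using h⟩
      · exact ⟨1, by simpa using h⟩
  rw [h3] at h1
  simpa [Finset.sum_range_succ] using h1.unique h2

/-- The integral `∑ c • E(s = c)` of a complex simple function `s` against `E`. -/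
noncomputable def complexSimple (s : SimpleFunc ℝ ℂ) : H →L[ℂ] H :=
  ∑ c ∈ s.range, c • E.proj (s ⁻¹' {c})

/-- The projections of `E`, as real-linear maps on scalars. -/
noncomputable def scalarProj (B : Set ℝ) : ℂ →L[ℝ] (H →L[ℂ] H) :=
  (ContinuousLinearMap.toSpanSingleton ℂ (E.proj B)).restrictScalars ℝ

theorem scalarProj_apply (B : Set ℝ) (c : ℂ) : E.scalarProj B c = c • E.proj B := rfl

theorem complexSimple_eq (s : SimpleFunc ℝ ℂ) :
    E.complexSimple s = s.setToSimpleFunc E.scalarProj := rfl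

/-- The general theory of set functions on simple functions is relative to a measure. With the zero
measure every finiteness condition is empty and only additivity on disjoint Borel sets is left. -/
theorem finMeasAdditive_scalarProj :
    FinMeasAdditive (0 : Measure ℝ) E.scalarProj := by
  intro B C hB hC _ _ hd
  ext1
  simp [scalarProj_apply, E.proj_union hB hC hd]

theorem complexSimple_add (s t : SimpleFunc ℝ ℂ) :
    E.complexSimple (s + t) = E.complexSimple s + E.complexSimple t := by
  simp only [complexSimple_eq]
  exact SimpleFunc.setToSimpleFunc_add (μ := (0 : Measure ℝ)) _ E.finMeasAdditive_scalarProj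
    (by simp) (by simp)

theorem complexSimple_smul (c : ℂ) (s : SimpleFunc ℝ ℂ) :
    E.complexSimple (c • s) = c • E.complexSimple s := by
  simp only [complexSimple_eq]
  exact SimpleFunc.setToSimpleFunc_smul (μ := (0 : Measure ℝ)) _ E.finMeasAdditive_scalarProj
    (fun c B x => by simp [scalarProj_apply, mul_smul]) c (by simp)

theorem complexSimple_piecewise {B : Set ℝ} (hB : MeasurableSet B) (c : ℂ) :
    E.complexSimple (SimpleFunc.piecewise B hB (SimpleFunc.const ℝ c) (SimpleFunc.const ℝ 0)) =
      c • E.proj B := by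
  rw [complexSimple_eq, SimpleFunc.setToSimpleFunc_indicator, scalarProj_apply]
  ext1
  simp [scalarProj_apply, E.proj_empty]

theorem complexSimple_map_ofReal (s : SimpleFunc ℝ ℝ) :
    E.complexSimple (s.map Complex.ofReal) = E.simpleIntegral s := by
  rw [complexSimple_eq, SimpleFunc.map_setToSimpleFunc (μ := (0 : Measure ℝ)) _
    E.finMeasAdditive_scalarProj (by simp) (by simp)]
  rfl

theorem complexSimple_restrict {B : Set ℝ} (hB : MeasurableSet B) (s : SimpleFunc ℝ ℂ) :
    E.complexSimple (s.restrict B) = E.proj B * E.complexSimple s := by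
  induction s using SimpleFunc.induction with
  | @const c C hC =>
    have : (SimpleFunc.piecewise C hC (SimpleFunc.const ℝ c) (SimpleFunc.const ℝ 0)).restrict B =
        SimpleFunc.piecewise (B ∩ C) (hB.inter hC) (SimpleFunc.const ℝ c)
          (SimpleFunc.const ℝ 0) := by
      ext x
      rw [SimpleFunc.restrict_apply _ hB]
      by_cases h1 : x ∈ B <;> by_cases h2 : x ∈ C <;> simp [h1, h2]
    rw [this, complexSimple_piecewise, complexSimple_piecewise, E.proj_inter B C hB hC,
      mul_smul_comm]
  | @add f g _ hf hg =>
    have : (f + g).restrict B = f.restrict B + g.restrict B := by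
      ext x
      simp only [SimpleFunc.restrict_apply _ hB, SimpleFunc.coe_add, Pi.add_apply]
      by_cases h1 : x ∈ B <;> simp [h1]
    rw [this, complexSimple_add, complexSimple_add, hf, hg, mul_add]

/-- Projections attached to distinct fibres have orthogonal ranges, so only the diagonal terms of
the squared norm survive. -/
theorem enorm_complexSimple (s : SimpleFunc ℝ ℂ) (ξ : H) :
    ‖E.complexSimple s ξ‖ₑ = eLpNorm s 2 (E.scalarMeasure ξ) := by
  refine (ENNReal.pow_right_strictMono two_ne_zero).injective ?_
  rw [eLpNorm_two_sq]
  have h1 : ‖E.complexSimple s ξ‖ ^ 2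
      = ∑ c ∈ s.range, ‖c‖ ^ 2 * ‖E.proj (s ⁻¹' {c}) ξ‖ ^ 2 := by
    have h2 : ⟪E.complexSimple s ξ, E.complexSimple s ξ⟫_ℂ
        = ∑ c ∈ s.range, ((‖c‖ ^ 2 * ‖E.proj (s ⁻¹' {c}) ξ‖ ^ 2 : ℝ) : ℂ) := by
      simp only [complexSimple, sum_apply, sum_inner, smul_apply]
      refine Finset.sum_congr rfl fun c hc => ?_
      rw [inner_sum, Finset.sum_eq_single c]
      · rw [inner_smul_left, inner_smul_right, inner_self_eq_norm_sq_to_K, ← mul_assoc,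
          Complex.conj_mul']
        push_cast
        rfl
      · intro d _ hdc
        rw [inner_smul_left, inner_smul_right,
          E.inner_proj (s.measurableSet_fiber c) (s.measurableSet_fiber d)]
        have : s ⁻¹' {c} ∩ s ⁻¹' {d} = ∅ := by
          ext x
          simp only [mem_inter_iff, mem_preimage, mem_singleton_iff, mem_empty_iff_false,
            iff_false, not_and]
          intro h h'
          exact hdc (h'.symm.trans h)
        simp [this, E.proj_empty]
      · intro h
        exact absurd hc h
    rw [inner_self_eq_norm_sq_to_K, ← Complex.ofReal_sum] at h2
    exact Complex.ofReal_injective (by rw [← h2]; simp)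
  have h3 : ∫⁻ x, ‖s x‖ₑ ^ 2 ∂E.scalarMeasure ξ
      = (s.map (fun c : ℂ => ‖c‖ₑ ^ 2)).lintegral (E.scalarMeasure ξ) := by
    rw [← SimpleFunc.lintegral_eq_lintegral]
    rfl
  rw [h3, SimpleFunc.map_lintegral, ← ofReal_norm, ← ENNReal.ofReal_pow (norm_nonneg _), h1,
    ENNReal.ofReal_sum_of_nonneg (fun _ _ => by positivity)]
  refine Finset.sum_congr rfl fun c _ => ?_
  rw [E.scalarMeasure_apply ξ (s.measurableSet_fiber c), ENNReal.ofReal_mul (by positivity),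
    ← ofReal_norm, ← ENNReal.ofReal_pow (norm_nonneg _)]

/-- `η = ∫ f dE ξ`, for a complex measurable function `f ∈ L²(μ_ξ)`. -/
structure HasIntegral (f : ℝ → ℂ) (ξ η : H) : Prop where
  measurable : Measurable f
  approx : ∀ ε : ℝ≥0∞, ε ≠ 0 → ∃ s : SimpleFunc ℝ ℂ,
    eLpNorm (⇑s - f) 2 (E.scalarMeasure ξ) ≤ ε ∧ ‖E.complexSimple s ξ - η‖ₑ ≤ ε

variable {E}

theorem hasIntegral_simple (s : SimpleFunc ℝ ℂ) (ξ : H) :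
    E.HasIntegral s ξ (E.complexSimple s ξ) :=
  ⟨s.measurable, fun _ _ => ⟨s, by simp, by simp⟩⟩

/-- A diagonal argument: limits may be taken along integrals already known, not only along simple
functions. -/
theorem HasIntegral.of_approx {f : ℝ → ℂ} {ξ η : H} (hf : Measurable f)
    (h : ∀ ε : ℝ≥0∞, ε ≠ 0 → ∃ g ζ, E.HasIntegral g ξ ζ ∧
      eLpNorm (g - f) 2 (E.scalarMeasure ξ) ≤ ε ∧ ‖ζ - η‖ₑ ≤ ε) : E.HasIntegral f ξ η := by
  refine ⟨hf, fun ε hε => ?_⟩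
  obtain ⟨g, ζ, hg, h1, h2⟩ := h (ε / 2) (by simp [hε])
  obtain ⟨s, h3, h4⟩ := hg.approx (ε / 2) (by simp [hε])
  refine ⟨s, ?_, ?_⟩
  · calc eLpNorm (⇑s - f) 2 (E.scalarMeasure ξ)
        = eLpNorm ((⇑s - g) + (g - f)) 2 (E.scalarMeasure ξ) := by congr 1; abel
      _ ≤ _ + _ := eLpNorm_add_le (s.measurable.sub hg.measurable).aestronglyMeasurable
          (hg.measurable.sub hf).aestronglyMeasurable (by norm_num)
      _ ≤ ε / 2 + ε / 2 := add_le_add h3 h1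
      _ = ε := ENNReal.add_halves ε
  · calc ‖E.complexSimple s ξ - η‖ₑ = ‖(E.complexSimple s ξ - ζ) + (ζ - η)‖ₑ := by congr 1; abel
      _ ≤ _ + _ := enorm_add_le _ _
      _ ≤ ε / 2 + ε / 2 := add_le_add h4 h2
      _ = ε := ENNReal.add_halves ε

theorem HasIntegral.add {f g : ℝ → ℂ} {ξ η ζ : H} (hf : E.HasIntegral f ξ η)
    (hg : E.HasIntegral g ξ ζ) : E.HasIntegral (f + g) ξ (η + ζ) := by
  refine ⟨hf.measurable.add hg.measurable, fun ε hε => ?_⟩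
  obtain ⟨s, h1, h2⟩ := hf.approx (ε / 2) (by simp [hε])
  obtain ⟨t, h3, h4⟩ := hg.approx (ε / 2) (by simp [hε])
  refine ⟨s + t, ?_, ?_⟩
  · calc eLpNorm (⇑(s + t) - (f + g)) 2 (E.scalarMeasure ξ)
        = eLpNorm ((⇑s - f) + (⇑t - g)) 2 (E.scalarMeasure ξ) := by
          rw [SimpleFunc.coe_add]; congr 1; abel
      _ ≤ _ + _ := eLpNorm_add_le (s.measurable.sub hf.measurable).aestronglyMeasurable
          (t.measurable.sub hg.measurable).aestronglyMeasurable (by norm_num)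
      _ ≤ ε / 2 + ε / 2 := add_le_add h1 h3
      _ = ε := ENNReal.add_halves ε
  · calc ‖E.complexSimple (s + t) ξ - (η + ζ)‖ₑ
        = ‖(E.complexSimple s ξ - η) + (E.complexSimple t ξ - ζ)‖ₑ := by
          rw [complexSimple_add, add_apply]; congr 1; abel
      _ ≤ _ + _ := enorm_add_le _ _
      _ ≤ ε / 2 + ε / 2 := add_le_add h2 h4
      _ = ε := ENNReal.add_halves ε

theorem HasIntegral.const_smul {f : ℝ → ℂ} {ξ η : H} (hf : E.HasIntegral f ξ η) (c : ℂ) :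
    E.HasIntegral (c • f) ξ (c • η) := by
  refine ⟨hf.measurable.const_smul c, fun ε hε => ?_⟩
  by_cases hc : c = 0
  · refine ⟨0, ?_, ?_⟩
    · simp [hc]
    · have : E.complexSimple 0 = 0 := by
        simpa using E.complexSimple_smul 0 0
      simp [hc, this]
  have hc1 : ‖c‖ₑ ≠ 0 := by simpa using hc
  have hc' : ‖c‖ₑ * (ε / ‖c‖ₑ) = ε := ENNReal.mul_div_cancel hc1 enorm_ne_top
  obtain ⟨s, h1, h2⟩ := hf.approx (ε / ‖c‖ₑ) (by simp [hε])
  refine ⟨c • s, ?_, ?_⟩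
  · rw [SimpleFunc.coe_smul, ← smul_sub, eLpNorm_const_smul]
    exact (mul_le_mul_right h1 _).trans_eq hc'
  · rw [complexSimple_smul, smul_apply, ← smul_sub, enorm_smul]
    exact (mul_le_mul_right h2 _).trans_eq hc'

theorem HasIntegral.neg {f : ℝ → ℂ} {ξ η : H} (hf : E.HasIntegral f ξ η) :
    E.HasIntegral (-f) ξ (-η) := by
  simpa using hf.const_smul (-1)

theorem HasIntegral.sub {f g : ℝ → ℂ} {ξ η ζ : H} (hf : E.HasIntegral f ξ η)
    (hg : E.HasIntegral g ξ ζ) : E.HasIntegral (f - g) ξ (η - ζ) := by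
  simpa [sub_eq_add_neg] using hf.add hg.neg

/-- The isometry on simple functions survives L² limits, at the cost of one error on the function
side and one on the vector side. Norm estimates for vectors thereby become L² computations in the
scalar measure. -/
theorem HasIntegral.enorm_eq {f : ℝ → ℂ} {ξ η : H} (hf : E.HasIntegral f ξ η) :
    ‖η‖ₑ = eLpNorm f 2 (E.scalarMeasure ξ) := by
  have key : ∀ ε : ℝ≥0∞, ε ≠ 0 → ‖η‖ₑ ≤ eLpNorm f 2 (E.scalarMeasure ξ) + (ε + ε) ∧
      eLpNorm f 2 (E.scalarMeasure ξ) ≤ ‖η‖ₑ + (ε + ε) := by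
    intro ε hε
    obtain ⟨s, h1, h2⟩ := hf.approx ε hε
    have h3 := E.enorm_complexSimple s ξ
    have hm := (s.measurable.sub hf.measurable).aestronglyMeasurable (μ := E.scalarMeasure ξ)
    constructor
    · calc ‖η‖ₑ = ‖E.complexSimple s ξ - (E.complexSimple s ξ - η)‖ₑ := by congr 1; abel
        _ ≤ ‖E.complexSimple s ξ‖ₑ + ‖E.complexSimple s ξ - η‖ₑ := enorm_sub_le
        _ ≤ eLpNorm (f + (⇑s - f)) 2 (E.scalarMeasure ξ) + ε := by
          rw [h3]
          refine add_le_add (le_of_eq ?_) h2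
          congr 1; abel
        _ ≤ (eLpNorm f 2 (E.scalarMeasure ξ) + ε) + ε := by
          refine add_le_add ((eLpNorm_add_le hf.measurable.aestronglyMeasurable hm
            (by norm_num)).trans (add_le_add le_rfl h1)) le_rfl
        _ = _ := by rw [add_assoc]
    · calc eLpNorm f 2 (E.scalarMeasure ξ) = eLpNorm (⇑s - (⇑s - f)) 2 (E.scalarMeasure ξ) := by
            congr 1; abel
        _ ≤ eLpNorm s 2 (E.scalarMeasure ξ) + ε :=
          (eLpNorm_sub_le s.measurable.aestronglyMeasurable hm
            (by norm_num)).trans (add_le_add le_rfl h1)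
        _ = ‖η + (E.complexSimple s ξ - η)‖ₑ + ε := by
          rw [← h3]; congr 2; abel
        _ ≤ (‖η‖ₑ + ε) + ε := by
          refine add_le_add ((enorm_add_le _ _).trans (add_le_add le_rfl h2)) le_rfl
        _ = _ := by rw [add_assoc]
  have h : ∀ {a b : ℝ≥0∞}, (∀ ε : ℝ≥0∞, ε ≠ 0 → a ≤ b + (ε + ε)) → a ≤ b := by
    intro a b h
    refine ENNReal.le_of_forall_pos_le_add fun ε hε _ => ?_
    have := h (ε / 2) (by simp [hε.ne'])
    rwa [ENNReal.add_halves] at this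
  exact le_antisymm (h fun ε hε => (key ε hε).1) (h fun ε hε => (key ε hε).2)

theorem HasIntegral.unique {f : ℝ → ℂ} {ξ η ζ : H} (hf : E.HasIntegral f ξ η)
    (hg : E.HasIntegral f ξ ζ) : η = ζ := by
  have h := (hf.sub hg).enorm_eq
  rw [sub_self, eLpNorm_zero, enorm_eq_zero, sub_eq_zero] at h
  exact h

theorem HasIntegral.lintegral_lt_top {f : ℝ → ℂ} {ξ η : H} (hf : E.HasIntegral f ξ η) :
    ∫⁻ x, ‖f x‖ₑ ^ 2 ∂E.scalarMeasure ξ < ∞ := by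
  rw [← eLpNorm_two_sq, ← hf.enorm_eq]
  exact ENNReal.pow_lt_top enorm_lt_top

theorem hasIntegral_one (ξ : H) : E.HasIntegral (fun _ => 1) ξ ξ := by
  have h := hasIntegral_simple (E := E) (SimpleFunc.piecewise univ MeasurableSet.univ
    (SimpleFunc.const ℝ (1 : ℂ)) (SimpleFunc.const ℝ 0)) ξ
  rw [complexSimple_piecewise, E.proj_univ] at h
  convert h using 1
  · ext; simp
  · simp

/-- Links the given unbounded operator, whose value is a chosen limit along `approx`, to the
relation `HasIntegral`, which does not depend on the approximating sequence. -/
theorem hasIntegral_integral {f : ℝ → ℝ} (hf : Measurable f) (ξ : (E.integral hf).domain) :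
    E.HasIntegral (fun x => (f x : ℂ)) ξ (E.integral hf ξ) := by
  refine HasIntegral.of_approx (Complex.measurable_ofReal.comp hf) fun ε hε => ?_
  have h0 : Tendsto (fun n => ∫⁻ x, ‖approx hf n x - f x‖ₑ ^ 2 ∂E.scalarMeasure ξ) atTop
      (𝓝 0) := by
    have h := tendsto_lintegral_of_dominated_convergence (μ := E.scalarMeasure ξ)
      (F := fun n x => ‖approx hf n x - f x‖ₑ ^ 2) (f := fun _ => 0)
      (fun x => ‖f x‖ₑ ^ 2)
      (fun n => (((approx hf n).measurable.sub hf).enorm).pow_const 2)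
      (fun n => Eventually.of_forall fun x => by
        have := SimpleFunc.edist_approxOn_le hf (mem_univ (0 : ℝ)) x n
        rw [edist_eq_enorm_sub, edist_comm, edist_zero_right] at this
        exact pow_le_pow_left' this 2)
      (ne_of_lt ξ.2)
      (Eventually.of_forall fun x => by
        have h1 : Tendsto (fun n => approx hf n x) atTop (𝓝 (f x)) :=
          SimpleFunc.tendsto_approxOn hf (mem_univ (0 : ℝ)) (by simp)
        have h2 := ENNReal.Tendsto.pow (n := 2) (h1.sub_const (f x)).enorm
        simpa using h2)
    simpa using h
  have h1 := tendsto_eLpNorm_two_zero h0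
  have h2 : Tendsto (fun n => E.simpleIntegral (approx hf n) ξ) atTop (𝓝 (E.integral hf ξ)) :=
    (E.exists_tendsto_approx hf ξ.2).choose_spec
  have h3 : Tendsto (fun n => ‖E.simpleIntegral (approx hf n) ξ - E.integral hf ξ‖ₑ) atTop
      (𝓝 0) := by
    simpa using (h2.sub_const (E.integral hf ξ)).enorm
  obtain ⟨n, h4, h5⟩ := ((h1.eventually_le_const (pos_iff_ne_zero.2 hε)).and
    (h3.eventually_le_const (pos_iff_ne_zero.2 hε))).exists
  refine ⟨_, _, hasIntegral_simple ((approx hf n).map Complex.ofReal) (ξ : H), ?_, ?_⟩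
  · refine le_trans (le_of_eq ?_) h4
    refine eLpNorm_congr_norm_ae (Eventually.of_forall fun x => ?_)
    simp only [SimpleFunc.coe_map, Pi.sub_apply, Function.comp_apply]
    rw [← Complex.ofReal_sub, Complex.norm_real]
  · rw [complexSimple_map_ofReal]
    exact h5

theorem HasIntegral.proj {f : ℝ → ℂ} {ξ η : H} (hf : E.HasIntegral f ξ η) {B : Set ℝ}
    (hB : MeasurableSet B) : E.HasIntegral (B.indicator f) ξ (E.proj B η) := by
  have hle : ∀ ζ, ‖E.proj B ζ‖ₑ ≤ ‖ζ‖ₑ := by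
    intro ζ
    have h := (hasIntegral_simple (E := E) (SimpleFunc.piecewise B hB
      (SimpleFunc.const ℝ (1 : ℂ)) (SimpleFunc.const ℝ 0)) ζ).enorm_eq
    rw [complexSimple_piecewise, one_smul] at h
    rw [h, (hasIntegral_one (E := E) ζ).enorm_eq]
    refine eLpNorm_mono fun x => ?_
    by_cases hx : x ∈ B <;> simp [hx]
  refine ⟨hf.measurable.indicator hB, fun ε hε => ?_⟩
  obtain ⟨s, h1, h2⟩ := hf.approx ε hε
  refine ⟨s.restrict B, ?_, ?_⟩
  · refine (eLpNorm_mono fun x => ?_).trans h1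
    by_cases hx : x ∈ B <;> simp [SimpleFunc.restrict_apply _ hB, hx]
  · rw [E.complexSimple_restrict hB, mul_apply_eq_comp, ← map_sub]
    exact (hle _).trans h2

/-- `E.proj B η` is the integral of `f` cut off to `B`; the isometry evaluates its norm. -/
theorem HasIntegral.scalarMeasure_eq {f : ℝ → ℂ} {ξ η : H} (hf : E.HasIntegral f ξ η) :
    E.scalarMeasure η = (E.scalarMeasure ξ).withDensity (fun x => ‖f x‖ₑ ^ 2) := by
  ext B hB
  rw [scalarMeasure_apply _ _ hB, withDensity_apply _ hB, ENNReal.ofReal_pow (norm_nonneg _),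
    ofReal_norm, (hf.proj hB).enorm_eq, eLpNorm_two_sq, ← lintegral_indicator hB]
  refine lintegral_congr fun x => ?_
  by_cases hx : x ∈ B <;> simp [hx]

theorem HasIntegral.eLpNorm_eq {f : ℝ → ℂ} {ξ η : H} (hf : E.HasIntegral f ξ η) {g : ℝ → ℂ}
    (hg : Measurable g) :
    eLpNorm g 2 (E.scalarMeasure η) = eLpNorm (g * f) 2 (E.scalarMeasure ξ) := by
  refine (ENNReal.pow_right_strictMono two_ne_zero).injective ?_
  rw [eLpNorm_two_sq, eLpNorm_two_sq, hf.scalarMeasure_eq,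
    lintegral_withDensity_eq_lintegral_mul _ (hf.measurable.enorm.pow_const 2)
      (hg.enorm.pow_const 2)]
  refine lintegral_congr fun x => ?_
  simp [enorm_mul, mul_pow, mul_comm]

theorem HasIntegral.complexSimple {f : ℝ → ℂ} {ξ η : H} (hf : E.HasIntegral f ξ η)
    (s : SimpleFunc ℝ ℂ) : E.HasIntegral (⇑s * f) ξ (E.complexSimple s η) := by
  induction s using SimpleFunc.induction with
  | @const c C hC =>
    rw [complexSimple_piecewise, smul_apply]
    convert (hf.proj hC).const_smul c using 1
    ext x
    by_cases hx : x ∈ C <;> simp [hx]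
  | @add s t _ hs ht =>
    rw [complexSimple_add, SimpleFunc.coe_add, add_mul]
    exact hs.add ht

/-- Since the scalar measure of `η` has density `|f|²`, approximating `g` by `s` in its L² space is
the same as approximating `g * f` by `s * f` in that of `ξ`. -/
theorem HasIntegral.mul {f g : ℝ → ℂ} {ξ η ζ : H} (hf : E.HasIntegral f ξ η)
    (hg : E.HasIntegral g η ζ) : E.HasIntegral (g * f) ξ ζ := by
  refine HasIntegral.of_approx (hg.measurable.mul hf.measurable) fun ε hε => ?_
  obtain ⟨s, h1, h2⟩ := hg.approx ε hε
  refine ⟨_, _, hf.complexSimple s, ?_, h2⟩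
  rw [← sub_mul, ← hf.eLpNorm_eq (s.measurable.sub hg.measurable)]
  exact h1

/-- Polarization: `⟨ξ, η⟩ = ∫ f dμ_ξ` for `η = ∫ f dE ξ`. -/
theorem HasIntegral.inner_eq {f : ℝ → ℂ} {ξ η : H} (hf : E.HasIntegral f ξ η) :
    ⟪ξ, η⟫_ℂ = ∫ x, f x ∂E.scalarMeasure ξ := by
  have hmem : MemLp f 2 (E.scalarMeasure ξ) :=
    ⟨hf.measurable.aestronglyMeasurable, eLpNorm_two_lt_top hf.lintegral_lt_top⟩
  have hint : Integrable f (E.scalarMeasure ξ) := hmem.integrable (by norm_num)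
  have hsq : Integrable (fun x => ‖f x‖ ^ 2) (E.scalarMeasure ξ) := hmem.norm.integrable_sq
  -- The isometry evaluates the squared norm of `η + c • ξ` as an integral. Expanding both sides and
  -- taking `c = 1`, then `c = I`, isolates the real and imaginary parts of the inner product.
  have hn : ∀ c : ℂ, ‖η + c • ξ‖ ^ 2 = ∫ x, ‖f x + c‖ ^ 2 ∂E.scalarMeasure ξ := by
    intro c
    have h := (hf.add ((hasIntegral_one ξ).const_smul c))
    have h2 : ‖η + c • ξ‖ₑ ^ 2 = ∫⁻ x, ‖f x + c‖ₑ ^ 2 ∂E.scalarMeasure ξ := by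
      rw [h.enorm_eq, eLpNorm_two_sq]
      simp
    rw [integral_eq_lintegral_of_nonneg_ae (Eventually.of_forall fun x => by positivity)
      (((hf.measurable.add_const c).norm.pow_const 2).aestronglyMeasurable)]
    simp_rw [ENNReal.ofReal_pow (norm_nonneg _), ofReal_norm, ← h2]
    simp
  have hexp : ∀ c : ℂ, ∫ x, ‖f x + c‖ ^ 2 ∂E.scalarMeasure ξ =
      ∫ x, ‖f x‖ ^ 2 ∂E.scalarMeasure ξ +
        2 * (∫ x, (f x * (starRingEnd ℂ) c) ∂E.scalarMeasure ξ).re +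
        ‖c‖ ^ 2 * ∫ x, 1 ∂E.scalarMeasure ξ := by
    intro c
    have hre : (∫ x, (f x * (starRingEnd ℂ) c) ∂E.scalarMeasure ξ).re =
        ∫ x, (f x * (starRingEnd ℂ) c).re ∂E.scalarMeasure ξ :=
      (integral_re (hint.mul_const _)).symm
    rw [hre, ← integral_const_mul, ← integral_const_mul, ← integral_add, ← integral_add]
    · refine integral_congr_ae (Eventually.of_forall fun x => ?_)
      simp only [← Complex.normSq_eq_norm_sq, Complex.normSq_add]
      ring
    · exact hsq.add ((hint.mul_const _).re.const_mul 2)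
    · exact integrable_const _
    · exact hsq
    · exact (hint.mul_const _).re.const_mul 2
  have hexp2 : ∀ c : ℂ, ‖η + c • ξ‖ ^ 2 = ‖η‖ ^ 2 + 2 * (c * ⟪η, ξ⟫_ℂ).re +
      ‖c‖ ^ 2 * ‖ξ‖ ^ 2 := by
    intro c
    rw [@norm_add_sq ℂ, inner_smul_right, norm_smul, mul_pow]
    rfl
  have h0 : ‖η‖ ^ 2 = ∫ x, ‖f x‖ ^ 2 ∂E.scalarMeasure ξ := by simpa using hn 0
  have hone : ‖ξ‖ ^ 2 = ∫ x, 1 ∂E.scalarMeasure ξ := by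
    simp [Measure.real, E.scalarMeasure_apply _ MeasurableSet.univ, E.proj_univ]
  have hc : ∀ c : ℂ, (c * ⟪η, ξ⟫_ℂ).re =
      ((∫ x, f x ∂E.scalarMeasure ξ) * (starRingEnd ℂ) c).re := by
    intro c
    have h1 := (hexp2 c).symm.trans ((hn c).trans (hexp c))
    rw [h0, hone, integral_mul_const] at h1
    linarith
  have hsymm : ⟪ξ, η⟫_ℂ = (starRingEnd ℂ) ⟪η, ξ⟫_ℂ := (inner_conj_symm ξ η).symm
  rw [hsymm]
  apply Complex.ext
  · rw [Complex.conj_re]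
    simpa using hc 1
  · rw [Complex.conj_im]
    simpa using hc Complex.I

end SpectralMeasure

/-! ### One-parameter unitary groups and their generators. -/

theorem enorm_ofReal_mul_I (x : ℝ) : ‖(x : ℂ) * Complex.I‖ₑ = ‖x‖ₑ := by
  rw [← ofReal_norm, ← ofReal_norm]
  simp

section UnitaryGroups

variable {H : Type*} [NormedAddCommGroup H] [InnerProductSpace ℂ H]

/-- A strongly continuous one-parameter group of isometries (hence of unitaries). -/
structure IsUnitaryGroup (U : ℝ → H →L[ℂ] H) : Prop where
  map_zero : U 0 = 1
  map_add : ∀ s t ξ, U (s + t) ξ = U s (U t ξ)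
  norm_map : ∀ t ξ, ‖U t ξ‖ = ‖ξ‖
  continuous : ∀ ξ, Continuous fun t => U t ξ

namespace IsUnitaryGroup

variable {U V : ℝ → H →L[ℂ] H}

theorem apply_zero (hU : IsUnitaryGroup U) (ξ : H) : U 0 ξ = ξ := by
  rw [hU.map_zero]; rfl

theorem neg_apply_apply (hU : IsUnitaryGroup U) (t : ℝ) (ξ : H) : U (-t) (U t ξ) = ξ := by
  rw [← hU.map_add, neg_add_cancel, hU.apply_zero]

theorem apply_neg_apply (hU : IsUnitaryGroup U) (t : ℝ) (ξ : H) : U t (U (-t) ξ) = ξ := by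
  rw [← hU.map_add, add_neg_cancel, hU.apply_zero]

theorem inner_map_map (hU : IsUnitaryGroup U) (t : ℝ) (ξ η : H) :
    ⟪U t ξ, U t η⟫_ℂ = ⟪ξ, η⟫_ℂ :=
  LinearIsometry.inner_map_map ⟨(U t : H →ₗ[ℂ] H), hU.norm_map t⟩ ξ η

theorem inner_left (hU : IsUnitaryGroup U) (t : ℝ) (ξ η : H) :
    ⟪U t ξ, η⟫_ℂ = ⟪ξ, U (-t) η⟫_ℂ := by
  rw [← hU.inner_map_map (-t), hU.neg_apply_apply]

/-- A one-parameter unitary group is determined by its (densely defined) generator. -/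
theorem eq_of_generator_eq (hU : IsUnitaryGroup U) (hV : IsUnitaryGroup V)
    (h : generator U = generator V) (hd : Dense ((generator U).domain : Set H)) : U = V := by
  have hderiv : ∀ ζ ∈ (generator V).domain, HasDerivAt (fun t => V t ζ - U t ζ) 0 0 := by
    intro ζ hζ
    have hζ' : ζ ∈ (generator U).domain := by rw [h]; exact hζ
    have h1 : DifferentiableAt ℝ (fun t => V t ζ) 0 := hζ
    have h2 : DifferentiableAt ℝ (fun t => U t ζ) 0 := hζ'
    have h3 : generator U ⟨ζ, hζ'⟩ = generator V ⟨ζ, hζ⟩ := h.le.2 rfl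
    have h4 : deriv (fun t => U t ζ) 0 = deriv (fun t => V t ζ) 0 :=
      smul_right_injective _ Complex.I_ne_zero h3
    have h5 := h1.hasDerivAt.sub h2.hasDerivAt
    rwa [h4, sub_self] at h5
  -- Here `U (-t) (V t ζ) - ζ = U (-t) (V t ζ - U t ζ)`, and `U (-t)` preserves norms, so the `o(t)`
  -- bound is inherited.
  have hstep : ∀ ζ ∈ (generator V).domain, HasDerivAt (fun t => U (-t) (V t ζ)) 0 0 := by
    intro ζ hζ
    have h1 := hderiv ζ hζ
    rw [hasDerivAt_iff_isLittleO_nhds_zero] at h1 ⊢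
    refine h1.norm_left.congr' (Eventually.of_forall fun t => ?_) EventuallyEq.rfl |>.of_norm_left
    simp only [zero_add, smul_zero, sub_zero, neg_zero, hU.apply_zero, hV.apply_zero, sub_self]
    rw [← hU.norm_map (-t), map_sub, hU.neg_apply_apply]
  have hinv : ∀ t, ∀ ζ ∈ (generator V).domain, V t ζ ∈ (generator V).domain := by
    intro t ζ hζ
    have h1 : DifferentiableAt ℝ (fun s => V s ζ) 0 := hζ
    have h2 : DifferentiableAt ℝ (fun s => V t (V s ζ)) 0 :=
      (V t).differentiableAt.restrictScalars ℝ |>.comp (0 : ℝ) h1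
    change DifferentiableAt ℝ (fun s => V s (V t ζ)) 0
    refine h2.congr_of_eventuallyEq (Eventually.of_forall fun s => ?_)
    change V s (V t ζ) = V t (V s ζ)
    rw [← hV.map_add, ← hV.map_add, add_comm]
  -- Derivative at an arbitrary `t`: factor out `U (-t)` and apply `hstep` to `V t ζ`, which is
  -- still in the domain.
  have hconst : ∀ ζ ∈ (generator V).domain, ∀ t, HasDerivAt (fun t => U (-t) (V t ζ)) 0 t := by
    intro ζ hζ t
    have h1 := hstep _ (hinv t ζ hζ)
    have h2 : HasDerivAt (fun s => U (-t) (U (-s) (V s (V t ζ)))) 0 0 := by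
      have := ((U (-t)).restrictScalars ℝ).hasFDerivAt.comp_hasDerivAt (0 : ℝ) h1
      simpa using! this
    have h3 : HasDerivAt (fun s => U (-t) (U (-(s - t)) (V (s - t) (V t ζ)))) 0 t := by
      have := HasDerivAt.scomp_of_eq t h2 ((hasDerivAt_id t).sub_const t) (by simp)
      simpa [Function.comp_def] using! this
    convert h3 using 2 with s
    rw [← hU.map_add, ← hV.map_add]
    congr 2 <;> ring_nf
  have heq : ∀ ζ ∈ (generator V).domain, ∀ t, U t ζ = V t ζ := by
    intro ζ hζ t
    have h1 := is_const_of_deriv_eq_zero (fun s => (hconst ζ hζ s).differentiableAt)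
      (fun s => (hconst ζ hζ s).deriv) t 0
    simp only [neg_zero, hU.apply_zero, hV.apply_zero] at h1
    rw [← hU.apply_neg_apply t (V t ζ), h1]
  funext t
  refine ContinuousLinearMap.ext fun ξ => ?_
  refine congrFun (Continuous.ext_on hd (U t).continuous (V t).continuous ?_) ξ
  intro ζ hζ
  exact heq ζ (by rw [← h]; exact hζ) t

end IsUnitaryGroup

/-! ### The unitary group of a spectral measure and its generator. -/

namespace SpectralMeasure

variable [CompleteSpace H] (E : SpectralMeasure H)

theorem mem_integralDomain_of_bounded {f : ℝ → ℝ} {C : ℝ} (h : ∀ x, |f x| ≤ C) (ξ : H) :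
    ξ ∈ E.integralDomain f := by
  change ∫⁻ x, ‖f x‖ₑ ^ 2 ∂E.scalarMeasure ξ < ∞
  calc ∫⁻ x, ‖f x‖ₑ ^ 2 ∂E.scalarMeasure ξ
      ≤ ∫⁻ _, ENNReal.ofReal C ^ 2 ∂E.scalarMeasure ξ := by
        refine lintegral_mono fun x => pow_le_pow_left' ?_ 2
        rw [← ofReal_norm]
        exact ENNReal.ofReal_le_ofReal (h x)
    _ < ∞ := by
        rw [lintegral_const]
        exact ENNReal.mul_lt_top (ENNReal.pow_lt_top ENNReal.ofReal_lt_top) (measure_lt_top _ _)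

theorem mem_domain_of_bounded {f : ℝ → ℝ} (hf : Measurable f) {C : ℝ} (h : ∀ x, |f x| ≤ C)
    (ξ : H) : ξ ∈ (E.integral hf).domain :=
  E.mem_integralDomain_of_bounded h ξ

theorem measurable_cos_mul (t : ℝ) : Measurable fun x : ℝ => Real.cos (t * x) := by fun_prop

theorem measurable_sin_mul (t : ℝ) : Measurable fun x : ℝ => Real.sin (t * x) := by fun_prop

theorem mem_domain_cos (t : ℝ) (ξ : H) : ξ ∈ (E.integral (measurable_cos_mul t)).domain :=
  E.mem_domain_of_bounded _ (fun _ => Real.abs_cos_le_one _) ξ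

theorem mem_domain_sin (t : ℝ) (ξ : H) : ξ ∈ (E.integral (measurable_sin_mul t)).domain :=
  E.mem_domain_of_bounded _ (fun _ => Real.abs_sin_le_one _) ξ

/-- The operator `∫ e^{-itx} dE(x)`, as a linear map. -/
noncomputable def expMap (t : ℝ) : H →ₗ[ℂ] H where
  toFun ξ :=
    E.integral (measurable_cos_mul t) ⟨ξ, E.mem_domain_cos t ξ⟩ -
      Complex.I • E.integral (measurable_sin_mul t) ⟨ξ, E.mem_domain_sin t ξ⟩
  map_add' ξ η := by
    have h1 := (E.integral (measurable_cos_mul t)).map_add ⟨ξ, E.mem_domain_cos t ξ⟩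
      ⟨η, E.mem_domain_cos t η⟩
    have h2 := (E.integral (measurable_sin_mul t)).map_add ⟨ξ, E.mem_domain_sin t ξ⟩
      ⟨η, E.mem_domain_sin t η⟩
    rw [AddMemClass.mk_add_mk] at h1 h2
    rw [h1, h2, smul_add]
    abel
  map_smul' c ξ := by
    have h1 := (E.integral (measurable_cos_mul t)).map_smul c ⟨ξ, E.mem_domain_cos t ξ⟩
    have h2 := (E.integral (measurable_sin_mul t)).map_smul c ⟨ξ, E.mem_domain_sin t ξ⟩
    rw [SetLike.mk_smul_mk] at h1 h2
    rw [h1, h2, RingHom.id_apply, smul_sub, smul_comm c Complex.I]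

theorem hasIntegral_expMap (t : ℝ) (ξ : H) :
    E.HasIntegral (fun x => Complex.exp (-(t * x * Complex.I))) ξ (E.expMap t ξ) := by
  have h := (hasIntegral_integral (E := E) (measurable_cos_mul t) ⟨ξ, E.mem_domain_cos t ξ⟩).sub
    ((hasIntegral_integral (E := E) (measurable_sin_mul t)
      ⟨ξ, E.mem_domain_sin t ξ⟩).const_smul Complex.I)
  refine (congrArg (fun f => E.HasIntegral f ξ (E.expMap t ξ)) ?_).mp h
  ext x
  rw [← neg_mul, Complex.exp_mul_I]
  simp [mul_comm Complex.I, sub_eq_add_neg]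

theorem norm_expMap (t : ℝ) (ξ : H) : ‖E.expMap t ξ‖ = ‖ξ‖ := by
  have h1 := (E.hasIntegral_expMap t ξ).enorm_eq
  have h2 := (hasIntegral_one (E := E) ξ).enorm_eq
  have h3 : ‖E.expMap t ξ‖ₑ = ‖ξ‖ₑ := by
    rw [h1, h2]
    refine eLpNorm_congr_norm_ae (Eventually.of_forall fun x => ?_)
    rw [norm_one, ← neg_mul, ← Complex.ofReal_mul, ← Complex.ofReal_neg,
      Complex.norm_exp_ofReal_mul_I]
  simpa [enorm_eq_nnnorm, ← coe_nnnorm] using h3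

/-- The unitary group `∫ e^{-itx} dE(x)`. -/
noncomputable def unitaryGroup (t : ℝ) : H →L[ℂ] H :=
  (⟨E.expMap t, E.norm_expMap t⟩ : H →ₗᵢ[ℂ] H).toContinuousLinearMap

theorem hasIntegral_unitaryGroup (t : ℝ) (ξ : H) :
    E.HasIntegral (fun x => Complex.exp (-(t * x * Complex.I))) ξ (E.unitaryGroup t ξ) :=
  E.hasIntegral_expMap t ξ

theorem inner_unitaryGroup (t : ℝ) (ξ : H) :
    ⟪ξ, E.unitaryGroup t ξ⟫_ℂ = charFun (E.scalarMeasure ξ) (-t) := by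
  rw [(E.hasIntegral_unitaryGroup t ξ).inner_eq, charFun_apply_real]
  simp

/-- The difference quotient of `t ↦ e^{-itx}` at `0`. -/
noncomputable def expSlope (t x : ℝ) : ℂ :=
  (t : ℂ)⁻¹ * (Complex.exp (-(t * x * Complex.I)) - 1)

theorem hasIntegral_expSlope (t : ℝ) (ξ : H) :
    E.HasIntegral (expSlope t) ξ (t⁻¹ • (E.unitaryGroup t ξ - ξ)) := by
  have h := ((E.hasIntegral_unitaryGroup t ξ).sub (hasIntegral_one ξ)).const_smul (t : ℂ)⁻¹
  rw [← Complex.ofReal_inv, Complex.coe_smul (E := H)] at h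
  convert h using 1
  ext x
  simp [expSlope]

theorem norm_expSlope_le (t x : ℝ) : ‖expSlope t x‖ ≤ |x| := by
  by_cases ht : t = 0
  · simp [expSlope, ht]
  have h := Real.norm_exp_I_mul_ofReal_sub_one_le (x := -(t * x))
  have h2 : Complex.I * ((-(t * x) : ℝ) : ℂ) = -(t * x * Complex.I) := by push_cast; ring
  rw [h2, Real.norm_eq_abs, abs_neg, abs_mul] at h
  rw [expSlope, norm_mul, norm_inv, Complex.norm_real, Real.norm_eq_abs,
    inv_mul_le_iff₀ (abs_pos.2 ht)]
  exact h

theorem tendsto_expSlope (x : ℝ) :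
    Tendsto (fun t => expSlope t x) (𝓝[≠] 0) (𝓝 (-(x * Complex.I))) := by
  have h : HasDerivAt (fun t : ℝ => Complex.exp (-(t * x * Complex.I))) (-(x * Complex.I)) 0 := by
    have h1 : HasDerivAt (fun t : ℝ => -((t : ℂ) * x * Complex.I)) (-(1 * x * Complex.I)) 0 :=
      ((((hasDerivAt_id (0 : ℝ)).ofReal_comp).mul_const _).mul_const _).neg
    simpa using h1.cexp
  have h2 := hasDerivAt_iff_tendsto_slope_zero.1 h
  refine h2.congr fun t => ?_
  simp [expSlope]

/-- Dominated convergence in L²: the difference quotient of the exponential and its limit are each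
at most `|x|` in modulus, so `4 x²` dominates the squared error, and it is integrable because `ξ` is
in the domain. -/
theorem hasDerivAt_unitaryGroup (ξ : (E.integral measurable_id).domain) :
    HasDerivAt (fun t => E.unitaryGroup t (ξ : H))
      (-Complex.I • E.integral measurable_id ξ) 0 := by
  rw [hasDerivAt_iff_tendsto_slope_zero]
  have h0 : E.unitaryGroup 0 (ξ : H) = ξ := by
    refine (E.hasIntegral_unitaryGroup 0 (ξ : H)).unique ?_
    simpa using hasIntegral_one (E := E) (ξ : H)
  have h1 := (hasIntegral_integral (E := E) measurable_id ξ).const_smul (-Complex.I)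
  rw [tendsto_iff_edist_tendsto_0]
  have h2 : ∀ t : ℝ, edist (t⁻¹ • (E.unitaryGroup (0 + t) (ξ : H) - E.unitaryGroup 0 (ξ : H)))
      (-Complex.I • E.integral measurable_id ξ) =
      eLpNorm (fun x => expSlope t x + x * Complex.I) 2 (E.scalarMeasure (ξ : H)) := by
    intro t
    rw [edist_eq_enorm_sub, h0, zero_add, ((E.hasIntegral_expSlope t (ξ : H)).sub h1).enorm_eq]
    congr 1
    ext x
    simp [mul_comm]
  simp_rw [h2]
  apply tendsto_eLpNorm_two_zero
  have h3 := tendsto_lintegral_filter_of_dominated_convergence (μ := E.scalarMeasure (ξ : H))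
    (l := 𝓝[≠] (0 : ℝ)) (F := fun t x => ‖expSlope t x + x * Complex.I‖ₑ ^ 2) (f := fun _ => 0)
    (fun x => 4 * ‖(id x : ℝ)‖ₑ ^ 2) ?_ ?_ ?_ ?_
  · simpa using h3
  · refine Eventually.of_forall fun t => ?_
    have := (E.hasIntegral_expSlope t (ξ : H)).measurable
    fun_prop
  · refine Eventually.of_forall fun t => Eventually.of_forall fun x => ?_
    have h4 : ‖expSlope t x + x * Complex.I‖ₑ ≤ 2 * ‖x‖ₑ := by
      refine (enorm_add_le _ _).trans ?_
      rw [two_mul]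
      refine add_le_add ?_ (enorm_ofReal_mul_I x).le
      rw [← ofReal_norm, ← ofReal_norm]
      exact ENNReal.ofReal_le_ofReal (norm_expSlope_le t x)
    calc _ ≤ (2 * ‖x‖ₑ) ^ 2 := pow_le_pow_left' h4 2
      _ = _ := by rw [mul_pow]; norm_num
  · rw [lintegral_const_mul _ (by fun_prop)]
    exact (ENNReal.mul_lt_top (by simp) ξ.2).ne
  · refine Eventually.of_forall fun x => ?_
    have h4 := ((tendsto_expSlope x).add_const (x * Complex.I)).enorm
    have h5 := ENNReal.Tendsto.pow (n := 2) h4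
    simpa using h5

/-- Fatou's lemma along `t = 1 / (n + 1)`: the difference quotients converge in norm, so their L²
norms have a finite limit, which bounds the integral of `x²`. -/
theorem mem_domain_of_differentiableAt {ξ : H}
    (h : DifferentiableAt ℝ (fun t => E.unitaryGroup t ξ) 0) :
    ξ ∈ E.integralDomain id := by
  have h0 : E.unitaryGroup 0 ξ = ξ := by
    refine (E.hasIntegral_unitaryGroup 0 ξ).unique ?_
    simpa using hasIntegral_one (E := E) ξ
  have h1 := hasDerivAt_iff_tendsto_slope_zero.1 h.hasDerivAt
  set d := deriv (fun t => E.unitaryGroup t ξ) 0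
  have hu : Tendsto (fun n : ℕ => 1 / ((n : ℝ) + 1)) atTop (𝓝[≠] 0) :=
    tendsto_nhdsWithin_iff.2 ⟨tendsto_one_div_add_atTop_nhds_zero_nat,
      Eventually.of_forall fun n => by
        simp only [mem_compl_iff, mem_singleton_iff]; positivity⟩
  have h2 := ENNReal.Tendsto.pow (n := 2) (h1.comp hu).enorm
  have h3 : ∀ t : ℝ, ‖t⁻¹ • (E.unitaryGroup (0 + t) ξ - E.unitaryGroup 0 ξ)‖ₑ ^ 2 =
      ∫⁻ x, ‖expSlope t x‖ₑ ^ 2 ∂E.scalarMeasure ξ := by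
    intro t
    rw [h0, zero_add, (E.hasIntegral_expSlope t ξ).enorm_eq, eLpNorm_two_sq]
  simp only [Function.comp_def, h3] at h2
  have h4 : ∀ x : ℝ, liminf (fun n : ℕ => ‖expSlope (1 / ((n : ℝ) + 1)) x‖ₑ ^ 2) atTop =
      ‖id x‖ₑ ^ 2 := by
    intro x
    have := ENNReal.Tendsto.pow (n := 2) ((tendsto_expSlope x).comp hu).enorm
    simp only [Function.comp_def] at this
    rw [this.liminf_eq, enorm_neg, enorm_ofReal_mul_I, id]
  change ∫⁻ x, ‖id x‖ₑ ^ 2 ∂E.scalarMeasure ξ < ∞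
  simp_rw [← h4]
  refine (lintegral_liminf_le fun n => ?_).trans_lt ?_
  · have := (E.hasIntegral_expSlope (1 / ((n : ℝ) + 1)) ξ).measurable
    fun_prop
  · rw [h2.liminf_eq]
    exact ENNReal.pow_lt_top enorm_lt_top

theorem generator_unitaryGroup : generator E.unitaryGroup = E.integral measurable_id := by
  refine LinearPMap.ext (Submodule.ext fun ξ => ⟨E.mem_domain_of_differentiableAt, fun h =>
    (E.hasDerivAt_unitaryGroup ⟨ξ, h⟩).differentiableAt⟩) ?_
  intro ξ h1 h2
  change Complex.I • deriv (fun t => E.unitaryGroup t ξ) 0 = _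
  rw [(E.hasDerivAt_unitaryGroup ⟨ξ, h2⟩).deriv, smul_smul]
  simp

theorem isUnitaryGroup : IsUnitaryGroup E.unitaryGroup where
  map_zero := by
    ext ξ
    refine (E.hasIntegral_unitaryGroup 0 ξ).unique ?_
    simpa using hasIntegral_one (E := E) ξ
  map_add s t ξ := by
    refine (E.hasIntegral_unitaryGroup (s + t) ξ).unique ?_
    convert (E.hasIntegral_unitaryGroup t ξ).mul
      (E.hasIntegral_unitaryGroup s (E.unitaryGroup t ξ)) using 1
    ext x
    simp only [Pi.mul_apply]
    rw [← Complex.exp_add]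
    congr 1
    push_cast
    ring
  norm_map t ξ := E.norm_expMap t ξ
  continuous ξ := by
    rw [continuous_iff_continuousAt]
    intro s
    rw [ContinuousAt, tendsto_iff_edist_tendsto_0]
    have h2 : ∀ t : ℝ, edist (E.unitaryGroup t ξ) (E.unitaryGroup s ξ) =
        eLpNorm (fun x : ℝ => Complex.exp (-(t * x * Complex.I)) -
          Complex.exp (-(s * x * Complex.I))) 2 (E.scalarMeasure ξ) := fun t => by
      rw [edist_eq_enorm_sub,
        ((E.hasIntegral_unitaryGroup t ξ).sub (E.hasIntegral_unitaryGroup s ξ)).enorm_eq]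
      rfl
    simp_rw [h2]
    apply tendsto_eLpNorm_two_zero
    have h3 := tendsto_lintegral_filter_of_dominated_convergence (μ := E.scalarMeasure ξ)
      (l := 𝓝 s) (F := fun t x => ‖Complex.exp (-(t * x * Complex.I)) -
          Complex.exp (-(s * x * Complex.I))‖ₑ ^ 2) (f := fun _ => 0)
      (fun x => 4) ?_ ?_ ?_ ?_
    · simpa using h3
    · refine Eventually.of_forall fun t => ?_
      fun_prop
    · refine Eventually.of_forall fun t => Eventually.of_forall fun x => ?_
      have h5 : ∀ r : ℝ, ‖Complex.exp (-(r * x * Complex.I))‖ₑ = 1 := fun r => by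
        rw [← ofReal_norm, ← neg_mul, ← Complex.ofReal_mul, ← Complex.ofReal_neg,
          Complex.norm_exp_ofReal_mul_I, ENNReal.ofReal_one]
      have h4 : ‖Complex.exp (-(t * x * Complex.I)) -
          Complex.exp (-(s * x * Complex.I))‖ₑ ≤ 2 := by
        refine enorm_sub_le.trans ?_
        rw [h5, h5]
        norm_num
      calc _ ≤ (2 : ℝ≥0∞) ^ 2 := pow_le_pow_left' h4 2
        _ = _ := by norm_num
    · rw [lintegral_const]
      exact (ENNReal.mul_lt_top (by simp) (measure_lt_top _ _)).ne
    · refine Eventually.of_forall fun x => ?_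
      have h4 : Tendsto (fun t : ℝ => Complex.exp (-(t * x * Complex.I)) -
          Complex.exp (-(s * x * Complex.I))) (𝓝 s) (𝓝 0) := by
        have : Continuous fun t : ℝ => Complex.exp (-(t * x * Complex.I)) -
          Complex.exp (-(s * x * Complex.I)) := by fun_prop
        simpa using this.tendsto s
      simpa using ENNReal.Tendsto.pow (n := 2) h4.enorm

/-- The vectors `E.proj {|f| ≤ n} ξ` lie in the domain, since `f` is bounded where they live, and
they converge to `ξ`. -/
theorem dense_integralDomain {f : ℝ → ℝ} (hf : Measurable f) :
    Dense (E.integralDomain f : Set H) := by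
  intro ξ
  have hB : ∀ n : ℕ, MeasurableSet {x | |f x| ≤ n} := fun n =>
    measurableSet_le (by fun_prop) measurable_const
  refine mem_closure_of_tendsto (f := fun n : ℕ => E.proj {x | |f x| ≤ n} ξ) (b := atTop) ?_
    (Eventually.of_forall fun n => ?_)
  · rw [tendsto_iff_edist_tendsto_0]
    have h2 : ∀ n : ℕ, edist (E.proj {x | |f x| ≤ n} ξ) ξ =
        eLpNorm (fun x => {x | |f x| ≤ n}.indicator (fun _ => (1 : ℂ)) x - 1) 2
          (E.scalarMeasure ξ) := fun n => by
      rw [edist_eq_enorm_sub,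
        (((hasIntegral_one (E := E) ξ).proj (hB n)).sub (hasIntegral_one ξ)).enorm_eq]
      rfl
    simp_rw [h2]
    apply tendsto_eLpNorm_two_zero
    have h3 := tendsto_lintegral_of_dominated_convergence (μ := E.scalarMeasure ξ)
      (F := fun n : ℕ => fun x =>
        ‖{x | |f x| ≤ n}.indicator (fun _ => (1 : ℂ)) x - 1‖ₑ ^ 2) (f := fun _ => 0)
      (fun x => 1) ?_ ?_ ?_ ?_
    · simpa using h3
    · intro n
      have : Measurable ({x | |f x| ≤ n}.indicator (fun _ => (1 : ℂ))) :=
        measurable_const.indicator (hB n)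
      fun_prop
    · intro n
      refine Eventually.of_forall fun x => ?_
      by_cases hx : x ∈ {x | |f x| ≤ n} <;> simp [hx]
    · simp
    · refine Eventually.of_forall fun x => tendsto_const_nhds.congr' ?_
      filter_upwards [eventually_ge_atTop ⌈|f x|⌉₊] with n hn
      have : x ∈ {x | |f x| ≤ n} := Nat.ceil_le.1 hn
      simp [this]
  · change ∫⁻ x, ‖f x‖ₑ ^ 2 ∂E.scalarMeasure (E.proj {x | |f x| ≤ n} ξ) < ∞
    rw [((hasIntegral_one (E := E) ξ).proj (hB n)).scalarMeasure_eq,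
      lintegral_withDensity_eq_lintegral_mul _
        (((measurable_const.indicator (hB n)).enorm).pow_const 2) (by fun_prop)]
    calc _ ≤ ∫⁻ x, (n : ℝ≥0∞) ^ 2 ∂E.scalarMeasure ξ := by
          refine lintegral_mono fun x => ?_
          by_cases hx : x ∈ {x | |f x| ≤ n}
          · have h1 : ‖f x‖ₑ ≤ n := by
              rw [← ofReal_norm, ← ENNReal.ofReal_natCast]
              exact ENNReal.ofReal_le_ofReal hx
            simpa [hx] using pow_le_pow_left' h1 2
          · simp [hx]
      _ < ∞ := by
          rw [lintegral_const]
          exact ENNReal.mul_lt_top (ENNReal.pow_lt_top (by simp)) (measure_lt_top _ _)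

/-- The unitary group with generator `∫ x dE(x)` is `∫ e^{-itx} dE(x)`. -/
theorem unitaryGroup_eq_of_generator {U : ℝ → H →L[ℂ] H} (hU : IsUnitaryGroup U)
    (h : generator U = E.integral measurable_id) : E.unitaryGroup = U := by
  refine E.isUnitaryGroup.eq_of_generator_eq hU (E.generator_unitaryGroup.trans h.symm) ?_
  rw [E.generator_unitaryGroup]
  exact E.dense_integralDomain measurable_id

end SpectralMeasure

end UnitaryGroups

/-! ### Bochner's theorem for stationary curves. -/

section Bochner

open scoped FourierTransform

/-- Moving the Fourier transform from `h` onto the Gaussian turns the integral into an average of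
`h` against an approximate identity at `0`. Integrability of `𝓕 h` is not presupposed, which makes
this usable to prove it. -/
theorem tendsto_integral_gaussian_mul_fourier {h : ℝ → ℂ} (hc : Continuous h)
    (hi : Integrable h) :
    Tendsto (fun c : ℝ => ∫ x : ℝ, Complex.exp (-(c : ℂ)⁻¹ * (‖x‖ : ℂ) ^ 2) * 𝓕 h x) atTop
      (𝓝 (h 0)) := by
  refine (Real.tendsto_integral_gaussian_smul' hi (v := (0 : ℝ)) hc.continuousAt).congr' ?_
  filter_upwards [Ioi_mem_atTop 0] with c (hc : 0 < c)
  have J : Integrable (fun w : ℝ ↦ Complex.exp (-(c : ℂ)⁻¹ * (‖w‖ : ℂ) ^ 2 +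
      2 * Real.pi * Complex.I * (⟪(0 : ℝ), w⟫_ℝ : ℂ))) :=
    GaussianFourier.integrable_cexp_neg_mul_sq_norm_add (by simpa) _ _
  have h1 := (VectorFourier.integral_fourierIntegral_smul_eq_flip (L := innerₗ ℝ)
      Real.continuous_fourierChar continuous_inner J hi)
  have h2 : ∀ w : ℝ, VectorFourier.fourierIntegral Real.fourierChar volume (innerₗ ℝ)
      (fun w : ℝ ↦ Complex.exp (-(c : ℂ)⁻¹ * (‖w‖ : ℂ) ^ 2 +
      2 * Real.pi * Complex.I * (⟪(0 : ℝ), w⟫_ℝ : ℂ))) w =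
      (Real.pi / (c : ℂ)⁻¹) ^ (Module.finrank ℝ ℝ / 2 : ℂ) *
        Complex.exp (-Real.pi ^ 2 * (‖(0 : ℝ) - w‖ : ℂ) ^ 2 / (c : ℂ)⁻¹) :=
    fun w => fourier_gaussian_innerProductSpace' (by simpa) (0 : ℝ) w
  have h3 : ∀ w : ℝ, VectorFourier.fourierIntegral Real.fourierChar volume (innerₗ ℝ).flip h w =
      𝓕 h w := fun w => by
    rw [flip_innerₗ]; rfl
  simp only [h2, h3] at h1
  convert h1 using 1
  · congr 1
    ext w
    congr 2
    · simp
    · congr 1; simp; ring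
  · congr 1
    ext w
    simp

/-- By positivity the Gaussian-damped integrals of `𝓕 h` are L¹ norms. They converge to `h 0`, so
Fatou's lemma bounds the undamped integral. -/
theorem integrable_fourier_of_nonneg {h : ℝ → ℂ} (hc : Continuous h) (hi : Integrable h)
    (hpos : ∀ x, 0 ≤ 𝓕 h x) : Integrable (𝓕 h) := by
  have hcont : Continuous (𝓕 h) :=
    VectorFourier.fourierIntegral_continuous Real.continuous_fourierChar continuous_inner hi
  have hbd : ∀ x, ‖𝓕 h x‖ ≤ ∫ y, ‖h y‖ := fun x =>
    VectorFourier.norm_fourierIntegral_le_integral_norm _ _ _ _ _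
  refine ⟨hcont.aestronglyMeasurable, ?_⟩
  have ht := (tendsto_integral_gaussian_mul_fourier hc hi).comp
    (tendsto_natCast_atTop_atTop.comp (tendsto_add_atTop_nat 1))
  simp only [Function.comp_def] at ht
  have h1 : ∀ n : ℕ, ∫⁻ x : ℝ, ‖Complex.exp (-((n + 1 : ℕ) : ℂ)⁻¹ * (‖x‖ : ℂ) ^ 2) * 𝓕 h x‖ₑ =
      ‖∫ x : ℝ, Complex.exp (-((n + 1 : ℕ) : ℂ)⁻¹ * (‖x‖ : ℂ) ^ 2) * 𝓕 h x‖ₑ := by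
    intro n
    have hexp : ∀ x : ℝ, Complex.exp (-((n + 1 : ℕ) : ℂ)⁻¹ * (‖x‖ : ℂ) ^ 2) =
        ((Real.exp (-((n + 1 : ℕ) : ℝ)⁻¹ * x ^ 2) : ℝ) : ℂ) := fun x => by
      push_cast
      rw [← Complex.ofReal_pow, Real.norm_eq_abs, sq_abs, Complex.ofReal_pow]
    have hre : ∀ x, 𝓕 h x = ((‖𝓕 h x‖ : ℝ) : ℂ) := fun x =>
      (Complex.eq_coe_norm_of_nonneg (hpos x))
    have hint : Integrable
        (fun x : ℝ => Real.exp (-((n + 1 : ℕ) : ℝ)⁻¹ * x ^ 2) * ‖𝓕 h x‖) := by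
      refine (integrable_exp_neg_mul_sq (b := ((n + 1 : ℕ) : ℝ)⁻¹) (by positivity)).mul_bdd
        (c := ∫ y, ‖h y‖) hcont.norm.aestronglyMeasurable (Eventually.of_forall fun x => ?_)
      rw [norm_norm]
      exact hbd x
    have h2 : ∀ x : ℝ, Complex.exp (-((n + 1 : ℕ) : ℂ)⁻¹ * (‖x‖ : ℂ) ^ 2) * 𝓕 h x =
        ((Real.exp (-((n + 1 : ℕ) : ℝ)⁻¹ * x ^ 2) * ‖𝓕 h x‖ : ℝ) : ℂ) := fun x => by
      rw [hexp, hre x, Complex.ofReal_mul, Complex.norm_real, norm_norm]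
    simp_rw [h2]
    rw [integral_complex_ofReal, ← ofReal_norm, Complex.norm_real, Real.norm_of_nonneg
      (integral_nonneg fun x => by positivity),
      ofReal_integral_eq_lintegral_ofReal hint (Eventually.of_forall fun x => by positivity)]
    refine lintegral_congr fun x => ?_
    rw [← ofReal_norm, Complex.norm_real, Real.norm_of_nonneg (by positivity)]
  have h3 : ∀ x : ℝ, liminf (fun n : ℕ =>
      ‖Complex.exp (-((n + 1 : ℕ) : ℂ)⁻¹ * (‖x‖ : ℂ) ^ 2) * 𝓕 h x‖ₑ) atTop = ‖𝓕 h x‖ₑ := by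
    intro x
    refine Tendsto.liminf_eq ?_
    have h4 : Tendsto (fun n : ℕ => ((n + 1 : ℕ) : ℂ)⁻¹) atTop (𝓝 0) :=
      (tendsto_inv_atTop_nhds_zero_nat (𝕜 := ℂ)).comp (tendsto_add_atTop_nat 1)
    have h5 : Tendsto (fun n : ℕ =>
        Complex.exp (-((n + 1 : ℕ) : ℂ)⁻¹ * (‖x‖ : ℂ) ^ 2) * 𝓕 h x) atTop
        (𝓝 (Complex.exp (-0 * (‖x‖ : ℂ) ^ 2) * 𝓕 h x)) :=
      ((h4.neg.mul_const _).cexp).mul_const _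
    simpa using h5.enorm
  change ∫⁻ x, ‖𝓕 h x‖ₑ < ∞
  simp_rw [← h3]
  refine (lintegral_liminf_le fun n => ?_).trans_lt ?_
  · have := hcont.measurable
    fun_prop
  · simp_rw [h1]
    have h6 := ht.enorm
    simp only [Complex.ofReal_natCast] at h6
    rw [h6.liminf_eq]
    exact enorm_lt_top

theorem exists_charFun_eq_of_fourier_nonneg {h : ℝ → ℂ} (hc : Continuous h) (hi : Integrable h)
    (hpos : ∀ x, 0 ≤ 𝓕 h x) : ∃ μ : Measure ℝ, IsFiniteMeasure μ ∧ ∀ t, charFun μ t = h t := by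
  have hint := integrable_fourier_of_nonneg hc hi hpos
  have hcont : Continuous (𝓕 h) :=
    VectorFourier.fourierIntegral_continuous Real.continuous_fourierChar continuous_inner hi
  let ν : Measure ℝ := volume.withDensity fun x => ‖𝓕 h x‖ₑ
  have hν : IsFiniteMeasure ν := isFiniteMeasure_withDensity hint.2.ne
  -- Dilation by `2π` converts the kernel of Fourier inversion into that of `charFun`.
  refine ⟨ν.map (fun x => 2 * Real.pi * x), inferInstance, fun t => ?_⟩
  rw [charFun_map_mul, charFun_apply_real, integral_withDensity_eq_integral_toReal_smul
    hcont.measurable.enorm (Eventually.of_forall fun x => enorm_lt_top),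
    ← congrFun (hc.fourierInv_fourier_eq hi hint) t, Real.fourierInv_eq']
  refine integral_congr_ae (Eventually.of_forall fun x => ?_)
  have hre : 𝓕 h x = ((‖𝓕 h x‖ : ℝ) : ℂ) := Complex.eq_coe_norm_of_nonneg (hpos x)
  simp only [toReal_enorm, smul_eq_mul]
  rw [Complex.real_smul, ← hre, mul_comm]
  congr 2
  simp
  ring

/-- Lévy's continuity theorem: continuity of the limit at `0` gives tightness, Prokhorov's theorem
gives a convergent subsequence, and its limit has the right characteristic function. -/
theorem exists_charFun_eq_of_tendsto {μ : ℕ → Measure ℝ} [∀ n, IsProbabilityMeasure (μ n)]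
    {φ : ℝ → ℂ} (hφ : ContinuousAt φ 0)
    (h : ∀ t, Tendsto (fun n => charFun (μ n) t) atTop (𝓝 (φ t))) :
    ∃ ν : Measure ℝ, IsProbabilityMeasure ν ∧ ∀ t, charFun ν t = φ t := by
  let P : ℕ → ProbabilityMeasure ℝ := fun n => ⟨μ n, inferInstance⟩
  have htight := isTightMeasureSet_of_tendsto_charFun hφ h
  have hcomp : IsCompact (closure (range P)) := by
    apply isCompact_closure_of_isTightMeasureSet
    convert htight using 1
    ext m
    constructor
    · rintro ⟨_, ⟨n, rfl⟩, rfl⟩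
      exact ⟨n, rfl⟩
    · rintro ⟨n, rfl⟩
      exact ⟨P n, ⟨n, rfl⟩, rfl⟩
  obtain ⟨ν, -, ψ, hψ, hlim⟩ := hcomp.tendsto_subseq (fun n => subset_closure (mem_range_self n))
  refine ⟨ν, inferInstance, fun t => ?_⟩
  exact tendsto_nhds_unique (ProbabilityMeasure.tendsto_iff_tendsto_charFun.1 hlim t)
    ((h t).comp hψ.tendsto_atTop)

variable {H : Type*} [NormedAddCommGroup H] [InnerProductSpace ℂ H] [CompleteSpace H]

/-- Up to a positive constant the transform is the squared norm of the vector `w = ∫ g t • v t`,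
where `g` is a character times a Gaussian. -/
theorem fourier_covariance_nonneg {v : ℝ → H} (hv : Continuous v) {φ : ℝ → ℂ}
    (h : ∀ s t, ⟪v s, v t⟫_ℂ = φ (t - s)) {ε : ℝ} (hε : 0 < ε) (x : ℝ) :
    0 ≤ 𝓕 (fun u : ℝ => φ u * Real.exp (-ε * u ^ 2)) x := by
  have hφc : Continuous φ := by
    have : φ = fun t => ⟪v 0, v t⟫_ℂ := by ext t; rw [h, sub_zero]
    rw [this]
    fun_prop
  have hnorm : ∀ t, ‖v t‖ ^ 2 = ‖v 0‖ ^ 2 := fun t => by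
    have h1 := (h t t).trans ((congrArg φ (by ring)).trans (h 0 0).symm)
    rw [inner_self_eq_norm_sq_to_K, inner_self_eq_norm_sq_to_K] at h1
    exact_mod_cast h1
  have hnorm' : ∀ t, ‖v t‖ = ‖v 0‖ := fun t =>
    (pow_left_inj₀ (norm_nonneg _) (norm_nonneg _) two_ne_zero).1 (hnorm t)
  have hφ : ∀ t, ‖φ t‖ ≤ ‖v 0‖ ^ 2 := fun t => by
    have h1 := norm_inner_le_norm (𝕜 := ℂ) (v 0) (v t)
    rwa [h, sub_zero, hnorm' t, ← sq] at h1
  -- The exponent `2ε` is chosen so that `2εs² + 2ε(s+u)² = εu² + 4ε(s+u/2)²`: the first term is the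
  -- required damping of `φ`, and the second integrates over `s` to a constant.
  let g : ℝ → ℂ := fun t =>
    Complex.exp ((-2 * Real.pi * t * x : ℝ) * Complex.I) * Real.exp (-(2 * ε) * t ^ 2)
  have hgn : ∀ t, ‖g t‖ = Real.exp (-(2 * ε) * t ^ 2) := fun t => by
    simp only [g]
    rw [norm_mul, Complex.norm_exp_ofReal_mul_I, one_mul, Complex.norm_real,
      Real.norm_of_nonneg (Real.exp_nonneg _)]
  have hgc : Continuous g := by fun_prop
  have hint : Integrable fun t => g t • v t := by
    refine ((integrable_exp_neg_mul_sq (b := 2 * ε) (by positivity)).mul_const ‖v 0‖).mono'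
      (hgc.smul hv).aestronglyMeasurable (Eventually.of_forall fun t => ?_)
    rw [norm_smul, hgn, hnorm']
  set w := ∫ t, g t • v t with hw
  have h1 : ∀ s, ⟪v s, w⟫_ℂ = ∫ u, g (s + u) * φ u := fun s => by
    rw [hw, ← integral_inner hint, ← integral_add_left_eq_self _ s]
    refine integral_congr_ae (Eventually.of_forall fun u => ?_)
    simp only [inner_smul_right, h, add_sub_cancel_left]
  have h2 : ⟪w, w⟫_ℂ = ∫ s, (starRingEnd ℂ) (g s) * ∫ u, g (s + u) * φ u := by
    rw [← inner_conj_symm, ← integral_inner hint, ← integral_conj]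
    refine integral_congr_ae (Eventually.of_forall fun s => ?_)
    simp only [inner_smul_right, map_mul, inner_conj_symm, h1]
  let k : ℝ → ℝ → ℂ := fun s u => (starRingEnd ℂ) (g s) * (g (s + u) * φ u)
  have hk : ∀ s u, k s u =
      (Complex.exp ((-2 * Real.pi * u * x : ℝ) * Complex.I) * (φ u * Real.exp (-ε * u ^ 2))) *
        Real.exp (-(4 * ε) * (s + u / 2) ^ 2) := fun s u => by
    simp only [k, g]
    rw [map_mul, ← Complex.exp_conj, map_mul, Complex.conj_ofReal, Complex.conj_I,
      Complex.conj_ofReal]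
    have e1 : Complex.exp ((-2 * Real.pi * (s + u) * x : ℝ) * Complex.I) =
        Complex.exp ((-2 * Real.pi * s * x : ℝ) * Complex.I) *
          Complex.exp ((-2 * Real.pi * u * x : ℝ) * Complex.I) := by
      rw [← Complex.exp_add]; congr 1; push_cast; ring
    have e2 : Complex.exp ((-2 * Real.pi * s * x : ℝ) * -Complex.I) *
        Complex.exp ((-2 * Real.pi * s * x : ℝ) * Complex.I) = 1 := by
      rw [← Complex.exp_add, mul_neg, neg_add_cancel, Complex.exp_zero]
    have e3 : Real.exp (-(2 * ε) * s ^ 2) * Real.exp (-(2 * ε) * (s + u) ^ 2) =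
        Real.exp (-ε * u ^ 2) * Real.exp (-(4 * ε) * (s + u / 2) ^ 2) := by
      rw [← Real.exp_add, ← Real.exp_add]; congr 1; ring
    have e3' : (Real.exp (-(2 * ε) * s ^ 2) : ℂ) * Real.exp (-(2 * ε) * (s + u) ^ 2) =
        Real.exp (-ε * u ^ 2) * Real.exp (-(4 * ε) * (s + u / 2) ^ 2) := by
      exact_mod_cast e3
    rw [e1]
    linear_combination (Complex.exp ((-2 * Real.pi * u * x : ℝ) * Complex.I) * φ u *
      (Real.exp (-(2 * ε) * s ^ 2) : ℂ) * Real.exp (-(2 * ε) * (s + u) ^ 2)) * e2 +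
      Complex.exp ((-2 * Real.pi * u * x : ℝ) * Complex.I) * φ u * e3'
  have hkint : Integrable (Function.uncurry k) (volume.prod volume) := by
    -- For Fubini: `s² + (s+u)²` is at least `(s² + u²)/3`, and `2ε` times the difference is `2/15`
    -- of the nonnegative expression supplied to `nlinarith`.
    have hb := integrable_exp_neg_mul_sq (b := 2 * ε / 3) (by positivity)
    refine ((hb.mul_prod hb).mul_const (‖v 0‖ ^ 2)).mono' ?_
      (Eventually.of_forall fun z => ?_)
    · refine Continuous.aestronglyMeasurable ?_
      simp only [Function.uncurry_def, k]
      exact (Complex.continuous_conj.comp (hgc.comp continuous_fst)).mul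
        ((hgc.comp (continuous_fst.add continuous_snd)).mul (hφc.comp continuous_snd))
    · simp only [Function.uncurry, k, norm_mul, RCLike.norm_conj, hgn]
      rw [← mul_assoc]
      refine mul_le_mul ?_ (hφ _) (norm_nonneg _) (by positivity)
      rw [← Real.exp_add, ← Real.exp_add]
      refine Real.exp_le_exp.2 ?_
      have : 0 ≤ ε * ((5 * z.1 + 3 * z.2) ^ 2 + z.2 ^ 2) := by positivity
      nlinarith
  have h3 : ⟪w, w⟫_ℂ = 𝓕 (fun u : ℝ => φ u * Real.exp (-ε * u ^ 2)) x *
      (√(Real.pi / (4 * ε)) : ℝ) := by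
    rw [h2]
    simp_rw [← integral_const_mul]
    change ∫ s, ∫ u, k s u = _
    rw [integral_integral_swap hkint, Real.fourier_real_eq_integral_exp_smul,
      ← integral_mul_const]
    refine integral_congr_ae (Eventually.of_forall fun u => ?_)
    simp only [hk, smul_eq_mul]
    rw [integral_const_mul]
    congr 1
    rw [integral_complex_ofReal, integral_add_right_eq_self
      (fun s => Real.exp (-(4 * ε) * s ^ 2)), integral_gaussian]
  have hpos : 0 < √(Real.pi / (4 * ε)) := Real.sqrt_pos.2 (by positivity)
  have h4 : 𝓕 (fun u : ℝ => φ u * Real.exp (-ε * u ^ 2)) x =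
      ((‖w‖ ^ 2 / √(Real.pi / (4 * ε)) : ℝ) : ℂ) := by
    rw [inner_self_eq_norm_sq_to_K] at h3
    rw [Complex.ofReal_div, eq_div_iff (by exact_mod_cast hpos.ne'), ← h3]
    simp
  rw [h4]
  exact Complex.zero_le_real.2 (by positivity)

/-- **Bochner's theorem** for the covariance function `φ(t - s) = ⟨v(s), v(t)⟩` of a continuous
stationary curve in a Hilbert space. -/
theorem exists_charFun_eq_covariance {v : ℝ → H} (hv : Continuous v) {φ : ℝ → ℂ}
    (h : ∀ s t, ⟪v s, v t⟫_ℂ = φ (t - s)) (h0 : φ 0 = 1) :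
    ∃ ν : Measure ℝ, IsProbabilityMeasure ν ∧ ∀ t, charFun ν t = φ t := by
  have hφc : Continuous φ := by
    have : φ = fun t => ⟪v 0, v t⟫_ℂ := by ext t; rw [h, sub_zero]
    rw [this]
    fun_prop
  have hv1 : ∀ t, ‖v t‖ = 1 := fun t => by
    have h1 := h t t
    rw [inner_self_eq_norm_sq_to_K, sub_self, h0] at h1
    have h2 : ‖v t‖ ^ 2 = 1 := Complex.ofReal_injective (by simpa using h1)
    exact (pow_eq_one_iff_of_nonneg (norm_nonneg _) two_ne_zero).1 h2
  have hφ : ∀ t, ‖φ t‖ ≤ 1 := fun t => by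
    have h1 := norm_inner_le_norm (𝕜 := ℂ) (v 0) (v t)
    rwa [h, sub_zero, hv1, hv1, one_mul] at h1
  -- Gaussian damping makes `φ` integrable; it disappears in the limit.
  have key : ∀ n : ℕ, ∃ μ : Measure ℝ, IsFiniteMeasure μ ∧
      ∀ t, charFun μ t = φ t * Real.exp (-(1 / ((n : ℝ) + 1)) * t ^ 2) := by
    intro n
    have hn : (0 : ℝ) < 1 / ((n : ℝ) + 1) := by positivity
    have hc : Continuous fun t : ℝ => φ t * (Real.exp (-(1 / ((n : ℝ) + 1)) * t ^ 2) : ℂ) := by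
      fun_prop
    refine exists_charFun_eq_of_fourier_nonneg hc ?_ (fourier_covariance_nonneg hv h hn)
    refine (integrable_exp_neg_mul_sq hn).mono' hc.aestronglyMeasurable
      (Eventually.of_forall fun t => ?_)
    rw [norm_mul, Complex.norm_real, Real.norm_of_nonneg (Real.exp_nonneg _)]
    exact mul_le_of_le_one_left (Real.exp_nonneg _) (hφ t)
  choose μ hμ hchar using key
  have hprob : ∀ n, IsProbabilityMeasure (μ n) := fun n => by
    have h1 := hchar n 0
    rw [charFun_zero, h0] at h1
    have h2 : (μ n).real univ = 1 := by simpa using h1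
    refine ⟨?_⟩
    rwa [measureReal_def, ENNReal.toReal_eq_one_iff] at h2
  refine exists_charFun_eq_of_tendsto (μ := μ) hφc.continuousAt fun t => ?_
  simp_rw [hchar]
  have h1 : Tendsto (fun n : ℕ => Real.exp (-(1 / ((n : ℝ) + 1)) * t ^ 2)) atTop
      (𝓝 (Real.exp (-0 * t ^ 2))) :=
    Real.continuous_exp.continuousAt.tendsto.comp
      ((tendsto_one_div_add_atTop_nhds_zero_nat.neg).mul_const _)
  have h2 := h1.ofReal.const_mul (φ t)
  simpa using h2

end Bochner

/-! ### Stone's theorem: the spectral measure of a unitary group. -/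

section Stone

/-- The span of the pairs `(charFun μ, μ(B))`, for finite measures `μ` on `ℝ`. -/
def charFunSpan (B : Set ℝ) : Submodule ℂ ((ℝ → ℂ) × ℂ) :=
  Submodule.span ℂ {p | ∃ μ : Measure ℝ, IsFiniteMeasure μ ∧ p = (charFun μ, (μ.real B : ℂ))}

theorem charFun_mem_charFunSpan (μ : Measure ℝ) [hμ : IsFiniteMeasure μ] (B : Set ℝ) :
    (charFun μ, (μ.real B : ℂ)) ∈ charFunSpan B :=
  Submodule.subset_span ⟨μ, hμ, rfl⟩

theorem charFun_sum_smul {ι : Type*} (s : Finset ι) (c : ι → NNReal) (μ : ι → Measure ℝ)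
    [∀ i, IsFiniteMeasure (μ i)] (t : ℝ) :
    charFun (∑ i ∈ s, c i • μ i) t = ∑ i ∈ s, (c i : ℂ) * charFun (μ i) t := by
  simp only [charFun_apply_real]
  rw [integral_finsetSum_measure]
  · refine Finset.sum_congr rfl fun i _ => ?_
    rw [integral_smul_nnreal_measure]
    rfl
  · intro i _
    refine Integrable.of_bound (by fun_prop) 1 (Eventually.of_forall fun x => ?_)
    rw [← Complex.ofReal_mul, Complex.norm_exp_ofReal_mul_I]

/-- A real linear relation between characteristic functions is one between measures. -/
theorem sum_mul_measureReal_eq_zero {ι : Type*} (s : Finset ι) (c : ι → ℝ) (μ : ι → Measure ℝ)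
    [∀ i, IsFiniteMeasure (μ i)] (h : ∀ t, ∑ i ∈ s, (c i : ℂ) * charFun (μ i) t = 0)
    (B : Set ℝ) : ∑ i ∈ s, c i * (μ i).real B = 0 := by
  have hc : ∀ i, (c i : ℝ) = ((c i).toNNReal : ℝ) - ((-c i).toNNReal : ℝ) := fun i => by
    rw [Real.coe_toNNReal', Real.coe_toNNReal', max_zero_sub_max_neg_zero_eq_self]
  -- Separating positive and negative coefficients gives two finite positive measures with the same
  -- characteristic function.
  have heq : ∑ i ∈ s, (c i).toNNReal • μ i = ∑ i ∈ s, (-c i).toNNReal • μ i := by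
    refine Measure.ext_of_charFun ?_
    ext t
    rw [charFun_sum_smul, charFun_sum_smul, ← sub_eq_zero, ← Finset.sum_sub_distrib, ← h t]
    refine Finset.sum_congr rfl fun i _ => ?_
    rw [← sub_mul]
    congr 1
    exact_mod_cast (hc i).symm
  have hreal : ∀ d : ι → NNReal, (∑ i ∈ s, d i • μ i).real B = ∑ i ∈ s, d i * (μ i).real B := by
    intro d
    rw [measureReal_def, Measure.finsetSum_apply, ENNReal.toReal_sum]
    · refine Finset.sum_congr rfl fun i _ => ?_
      simp [measureReal_def]
    · intro i _
      exact measure_ne_top _ _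
  calc ∑ i ∈ s, c i * (μ i).real B
      = ∑ i ∈ s, ((c i).toNNReal : ℝ) * (μ i).real B
        - ∑ i ∈ s, ((-c i).toNNReal : ℝ) * (μ i).real B := by
        rw [← Finset.sum_sub_distrib]
        refine Finset.sum_congr rfl fun i _ => ?_
        rw [← sub_mul, ← hc]
    _ = 0 := by rw [← hreal, ← hreal, heq, sub_self]

/-- Conjugating a relation and replacing `t` by `-t` gives the relation with conjugate coefficients,
so the real and imaginary parts of the coefficients satisfy separate real relations. Thus
`charFunSpan B` is the graph of a linear functional: identities between masses of `B` can be checked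
on characteristic functions. -/
theorem eq_zero_of_mem_charFunSpan {B : Set ℝ} {c : ℂ} (h : ((0 : ℝ → ℂ), c) ∈ charFunSpan B) :
    c = 0 := by
  obtain ⟨n, f, g, hfg⟩ := Submodule.mem_span_set'.1 h
  choose μ hμ hg using fun i => (g i).2
  have h1 : ∀ t, ∑ i, f i * charFun (μ i) t = 0 := fun t => by
    have := congrFun (congrArg Prod.fst hfg) t
    simpa [hg, Prod.fst_sum] using this
  have h2 : ∑ i, f i * ((μ i).real B : ℂ) = c := by
    have := congrArg Prod.snd hfg
    simpa [hg, Prod.snd_sum] using this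
  have h3 : ∀ t, ∑ i, (starRingEnd ℂ) (f i) * charFun (μ i) t = 0 := fun t => by
    have := congrArg (starRingEnd ℂ) (h1 (-t))
    simpa [charFun_neg] using this
  have hre := sum_mul_measureReal_eq_zero Finset.univ (fun i => (f i).re) μ (fun t => by
    have h4 : ∑ i, ((f i).re : ℂ) * charFun (μ i) t =
        (∑ i, f i * charFun (μ i) t + ∑ i, (starRingEnd ℂ) (f i) * charFun (μ i) t) / 2 := by
      rw [← Finset.sum_add_distrib, Finset.sum_div]
      refine Finset.sum_congr rfl fun i _ => ?_
      rw [Complex.re_eq_add_conj]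
      ring
    rw [h4, h1, h3]
    simp) B
  have him := sum_mul_measureReal_eq_zero Finset.univ (fun i => (f i).im) μ (fun t => by
    have h4 : ∑ i, ((f i).im : ℂ) * charFun (μ i) t =
        (∑ i, f i * charFun (μ i) t - ∑ i, (starRingEnd ℂ) (f i) * charFun (μ i) t) /
          (2 * Complex.I) := by
      rw [← Finset.sum_sub_distrib, Finset.sum_div]
      refine Finset.sum_congr rfl fun i _ => ?_
      rw [Complex.im_eq_sub_conj]
      ring
    rw [h4, h1, h3]
    simp) B
  rw [← h2]
  apply Complex.ext
  · simpa using hre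
  · simpa using him

theorem eq_of_mem_charFunSpan {B : Set ℝ} {F : ℝ → ℂ} {c d : ℂ} (hc : (F, c) ∈ charFunSpan B)
    (hd : (F, d) ∈ charFunSpan B) : c = d := by
  have h := Submodule.sub_mem _ hc hd
  rw [Prod.mk_sub_mk, sub_self] at h
  exact sub_eq_zero.1 (eq_zero_of_mem_charFunSpan h)

variable {H : Type*} [NormedAddCommGroup H] [InnerProductSpace ℂ H] [CompleteSpace H]

namespace IsUnitaryGroup

variable {U : ℝ → H →L[ℂ] H} (hU : IsUnitaryGroup U)

include hU in
-- Bochner's theorem applied to the orbit `s ↦ U (-s) ξ`, with `ξ` normalized so that the covariance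
-- is `1` at `0` and the factor `‖ξ‖²` restored afterwards.
theorem exists_charFun_eq (ξ : H) :
    ∃ μ : Measure ℝ, IsFiniteMeasure μ ∧ ∀ t, charFun μ t = ⟪ξ, U (-t) ξ⟫_ℂ := by
  by_cases hξ : ξ = 0
  · exact ⟨0, inferInstance, fun t => by simp [hξ]⟩
  have hn : (‖ξ‖ : ℂ) ≠ 0 := by simpa using hξ
  obtain ⟨ν, hν, h⟩ := exists_charFun_eq_covariance
    (v := fun s => U (-s) ((‖ξ‖ : ℂ)⁻¹ • ξ))
    ((hU.continuous _).comp continuous_neg)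
    (φ := fun t => ⟪(‖ξ‖ : ℂ)⁻¹ • ξ, U (-t) ((‖ξ‖ : ℂ)⁻¹ • ξ)⟫_ℂ)
    (fun s t => by
      rw [hU.inner_left, ← hU.map_add]
      congr 3
      ring)
    (by
      rw [neg_zero, hU.apply_zero, inner_smul_left, inner_smul_right,
        inner_self_eq_norm_sq_to_K, ← Complex.ofReal_inv, Complex.conj_ofReal,
        Complex.ofReal_inv]
      simp only [Complex.coe_algebraMap]
      field_simp)
  refine ⟨(‖ξ‖₊ ^ 2) • ν, inferInstance, fun t => ?_⟩
  have h1 := charFun_sum_smul {()} (fun _ => ‖ξ‖₊ ^ 2) (fun _ => ν) t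
  simp only [Finset.sum_singleton] at h1
  rw [h1, h, map_smul, inner_smul_left, inner_smul_right, ← Complex.ofReal_inv,
    Complex.conj_ofReal, Complex.ofReal_inv]
  push_cast
  rw [← mul_assoc, ← mul_assoc]
  field_simp

/-- The finite measure on `ℝ` with characteristic function `t ↦ ⟨ξ, U(-t)ξ⟩`. -/
noncomputable def measure (ξ : H) : Measure ℝ := (hU.exists_charFun_eq ξ).choose

instance (ξ : H) : IsFiniteMeasure (hU.measure ξ) := (hU.exists_charFun_eq ξ).choose_spec.1

theorem charFun_measure (ξ : H) (t : ℝ) : charFun (hU.measure ξ) t = ⟪ξ, U (-t) ξ⟫_ℂ :=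
  (hU.exists_charFun_eq ξ).choose_spec.2 t

theorem measure_univ (ξ : H) : (hU.measure ξ).real univ = ‖ξ‖ ^ 2 := by
  have h := hU.charFun_measure ξ 0
  rw [charFun_zero, neg_zero, hU.apply_zero, inner_self_eq_norm_sq_to_K] at h
  exact Complex.ofReal_injective (by rw [h]; simp)

theorem measure_le (ξ : H) (B : Set ℝ) : (hU.measure ξ).real B ≤ ‖ξ‖ ^ 2 :=
  (measureReal_mono (subset_univ B)).trans (hU.measure_univ ξ).le

/-- The sesquilinear form `(ξ, η) ↦ ⟨ξ, E(B)η⟩` given by polarization. -/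
noncomputable def form (B : Set ℝ) (ξ η : H) : ℂ :=
  (((hU.measure (ξ + η)).real B : ℂ) - (hU.measure (ξ - η)).real B
    - Complex.I * (hU.measure (ξ + Complex.I • η)).real B
    + Complex.I * (hU.measure (ξ - Complex.I • η)).real B) / 4

/-- Polarization of the function coordinate recovers the matrix element. With `form_eq_of_mem`, the
algebraic laws of the form then come from those of the inner product, although each measure was
obtained by choice. -/
theorem form_mem (B : Set ℝ) (ξ η : H) :
    ((fun t => ⟪ξ, U (-t) η⟫_ℂ), hU.form B ξ η) ∈ charFunSpan B := by
  have h := fun ζ => charFun_mem_charFunSpan (hU.measure ζ) B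
  have h2 := Submodule.smul_mem _ (4 : ℂ)⁻¹ (Submodule.add_mem _ (Submodule.sub_mem _
    (Submodule.sub_mem _ (h (ξ + η)) (h (ξ - η)))
    (Submodule.smul_mem _ Complex.I (h (ξ + Complex.I • η))))
    (Submodule.smul_mem _ Complex.I (h (ξ - Complex.I • η))))
  convert h2 using 1
  refine Prod.ext ?_ ?_
  · ext t
    simp only [Prod.smul_fst, Prod.fst_add, Prod.fst_sub, Pi.smul_apply, Pi.add_apply,
      Pi.sub_apply, charFun_measure, smul_eq_mul]
    simp only [_root_.map_add, map_sub, map_smul, inner_add_left, inner_add_right, inner_sub_left,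
      inner_sub_right, inner_smul_left, inner_smul_right, Complex.conj_I]
    ring_nf
    simp only [Complex.I_sq]
    ring
  · simp only [form, Prod.smul_snd, Prod.snd_add, Prod.snd_sub, smul_eq_mul]
    ring

theorem form_eq_of_mem {B : Set ℝ} {ξ η : H} {c : ℂ}
    (h : ((fun t => ⟪ξ, U (-t) η⟫_ℂ), c) ∈ charFunSpan B) : hU.form B ξ η = c :=
  eq_of_mem_charFunSpan (hU.form_mem B ξ η) h

theorem form_add_right (B : Set ℝ) (ξ η ζ : H) :
    hU.form B ξ (η + ζ) = hU.form B ξ η + hU.form B ξ ζ := by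
  refine hU.form_eq_of_mem ?_
  convert Submodule.add_mem _ (hU.form_mem B ξ η) (hU.form_mem B ξ ζ) using 1
  simp [funext_iff]

theorem form_add_left (B : Set ℝ) (ξ η ζ : H) :
    hU.form B (ξ + η) ζ = hU.form B ξ ζ + hU.form B η ζ := by
  refine hU.form_eq_of_mem ?_
  convert Submodule.add_mem _ (hU.form_mem B ξ ζ) (hU.form_mem B η ζ) using 1
  simp [funext_iff]

theorem form_smul_right (B : Set ℝ) (c : ℂ) (ξ η : H) :
    hU.form B ξ (c • η) = c * hU.form B ξ η := by
  refine hU.form_eq_of_mem ?_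
  convert Submodule.smul_mem _ c (hU.form_mem B ξ η) using 1
  simp [funext_iff]

theorem form_smul_left (B : Set ℝ) (c : ℂ) (ξ η : H) :
    hU.form B (c • ξ) η = (starRingEnd ℂ) c * hU.form B ξ η := by
  refine hU.form_eq_of_mem ?_
  convert Submodule.smul_mem _ ((starRingEnd ℂ) c) (hU.form_mem B ξ η) using 1
  simp [funext_iff, mul_comm]

theorem form_self (B : Set ℝ) (ξ : H) : hU.form B ξ ξ = (hU.measure ξ).real B := by
  refine hU.form_eq_of_mem ?_
  convert charFun_mem_charFunSpan (hU.measure ξ) B using 2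
  ext t
  rw [charFun_measure]

theorem norm_form_le_add (B : Set ℝ) (ξ η : H) : ‖hU.form B ξ η‖ ≤ ‖ξ‖ ^ 2 + ‖η‖ ^ 2 := by
  have h : ∀ ζ, ‖((hU.measure ζ).real B : ℂ)‖ ≤ ‖ζ‖ ^ 2 := fun ζ => by
    rw [Complex.norm_real, Real.norm_of_nonneg measureReal_nonneg]
    exact hU.measure_le ζ B
  have hI : ∀ ζ, ‖Complex.I * ((hU.measure ζ).real B : ℂ)‖ ≤ ‖ζ‖ ^ 2 := fun ζ => by
    rw [norm_mul, Complex.norm_I, one_mul]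
    exact h ζ
  have p1 := parallelogram_law_with_norm ℂ ξ η
  have p2 := parallelogram_law_with_norm ℂ ξ (Complex.I • η)
  rw [norm_smul, Complex.norm_I, one_mul] at p2
  rw [form, norm_div, Complex.norm_ofNat, div_le_iff₀ (by norm_num)]
  refine (norm_add_le _ _).trans ((add_le_add ((norm_sub_le _ _).trans (add_le_add
    ((norm_sub_le _ _).trans (add_le_add (h _) (h _))) (hI _))) (hI _)).trans ?_)
  linarith

/-- The additive bound applied to unit vectors. Any finite constant would do, as the form only has
to define a bounded operator. -/
theorem norm_form_le (B : Set ℝ) (ξ η : H) : ‖hU.form B ξ η‖ ≤ 2 * ‖ξ‖ * ‖η‖ := by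
  by_cases hξ : ξ = 0
  · have := hU.form_smul_left B 0 0 η
    simp_all
  by_cases hη : η = 0
  · have := hU.form_smul_right B 0 ξ 0
    simp_all
  have h := hU.norm_form_le_add B ((‖ξ‖ : ℂ)⁻¹ • ξ) ((‖η‖ : ℂ)⁻¹ • η)
  have h1 : 0 < ‖ξ‖ := norm_pos_iff.2 hξ
  have h2 : 0 < ‖η‖ := norm_pos_iff.2 hη
  rw [form_smul_left, form_smul_right, norm_smul, norm_smul, norm_mul, norm_mul,
    RCLike.norm_conj, norm_inv, norm_inv, Complex.norm_real, Complex.norm_real, norm_norm,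
    norm_norm, inv_mul_cancel₀ h1.ne', inv_mul_cancel₀ h2.ne', ← mul_assoc, ← mul_inv,
    inv_mul_le_iff₀ (by positivity)] at h
  linarith

theorem exists_inner_eq_measure (B : Set ℝ) :
    ∃ T : H →L[ℂ] H, ∀ ξ, ⟪T ξ, ξ⟫_ℂ = (hU.measure ξ).real B := by
  let f : H →ₗ⋆[ℂ] H →ₗ[ℂ] ℂ := LinearMap.mk₂'ₛₗ (starRingEnd ℂ) (RingHom.id ℂ) (hU.form B)
    (hU.form_add_left B) (hU.form_smul_left B) (hU.form_add_right B) (hU.form_smul_right B)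
  refine ⟨InnerProductSpace.continuousLinearMapOfBilin (f.mkContinuous₂ 2 (hU.norm_form_le B)),
    fun ξ => ?_⟩
  rw [InnerProductSpace.continuousLinearMapOfBilin_apply]
  exact hU.form_self B ξ

/-- The spectral projection attached to `B`. -/
noncomputable def spectralProj (B : Set ℝ) : H →L[ℂ] H := (hU.exists_inner_eq_measure B).choose

theorem inner_spectralProj_self (B : Set ℝ) (ξ : H) :
    ⟪hU.spectralProj B ξ, ξ⟫_ℂ = (hU.measure ξ).real B :=
  (hU.exists_inner_eq_measure B).choose_spec ξ

theorem inner_spectralProj (B : Set ℝ) (ξ η : H) :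
    ⟪hU.spectralProj B ξ, η⟫_ℂ = hU.form B ξ η := by
  rw [← ContinuousLinearMap.coe_coe, inner_map_polarization']
  simp only [ContinuousLinearMap.coe_coe, inner_spectralProj_self]
  rfl

theorem spectralProj_ext {T : H →L[ℂ] H} {B : Set ℝ}
    (h : ∀ ξ, ⟪T ξ, ξ⟫_ℂ = (hU.measure ξ).real B) : T = hU.spectralProj B := by
  have h2 := (ext_inner_map (T : H →ₗ[ℂ] H) (hU.spectralProj B)).1 fun ξ => by
    rw [ContinuousLinearMap.coe_coe, ContinuousLinearMap.coe_coe, h, inner_spectralProj_self]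
  exact ContinuousLinearMap.coe_injective h2

theorem inner_spectralProj_comm (B : Set ℝ) (ξ η : H) :
    ⟪hU.spectralProj B ξ, η⟫_ℂ = ⟪ξ, hU.spectralProj B η⟫_ℂ := by
  have h : ((hU.spectralProj B : H →L[ℂ] H) : H →ₗ[ℂ] H).IsSymmetric := by
    rw [LinearMap.isSymmetric_iff_inner_map_self_real]
    intro ξ
    rw [ContinuousLinearMap.coe_coe, inner_spectralProj_self, Complex.conj_ofReal]
  exact h ξ η

/-- Formally the vector is `1 + c e^{isx}` applied to `ξ`. As no functional calculus is available
yet, the characteristic functions of both sides are expanded and compared. -/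
theorem measure_add_smul (s : ℝ) (c : ℂ) (ξ : H) :
    hU.measure (ξ + c • U (-s) ξ) =
      (hU.measure ξ).withDensity fun x => ‖1 + c * Complex.exp (s * x * Complex.I)‖ₑ ^ 2 := by
  have hm : Measurable fun x : ℝ => ‖1 + c * Complex.exp (s * x * Complex.I)‖ₑ ^ 2 := by
    fun_prop
  have hexp : ∀ r x : ℝ, ‖Complex.exp (r * x * Complex.I)‖ = 1 := fun r x => by
    rw [← Complex.ofReal_mul, Complex.norm_exp_ofReal_mul_I]
  have hfin : IsFiniteMeasure ((hU.measure ξ).withDensity fun x : ℝ =>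
      ‖1 + c * Complex.exp (s * x * Complex.I)‖ₑ ^ 2) := by
    refine isFiniteMeasure_withDensity (lt_of_le_of_lt (lintegral_mono (g := fun _ =>
      ENNReal.ofReal (1 + ‖c‖) ^ 2) fun x => pow_le_pow_left' ?_ 2) ?_).ne
    · rw [← ofReal_norm]
      refine ENNReal.ofReal_le_ofReal ((norm_add_le _ _).trans ?_)
      rw [norm_mul, hexp, norm_one, mul_one]
    · rw [lintegral_const]
      exact ENNReal.mul_lt_top (ENNReal.pow_lt_top ENNReal.ofReal_lt_top) (measure_lt_top _ _)
  refine Measure.ext_of_charFun ?_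
  ext t
  have hint : ∀ r : ℝ, Integrable (fun x : ℝ => Complex.exp (r * x * Complex.I))
      (hU.measure ξ) := fun r =>
    Integrable.of_bound (by fun_prop) 1 (Eventually.of_forall fun x => (hexp r x).le)
  have hφ : ∀ r : ℝ, ∫ x, Complex.exp (r * x * Complex.I) ∂hU.measure ξ = ⟪ξ, U (-r) ξ⟫_ℂ :=
    fun r => by rw [← charFun_apply_real, charFun_measure]
  rw [charFun_measure, charFun_apply_real, integral_withDensity_eq_integral_toReal_smul hm
    (Eventually.of_forall fun x => ENNReal.pow_lt_top enorm_lt_top)]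
  have h1 : ∀ x : ℝ, (‖1 + c * Complex.exp (s * x * Complex.I)‖ₑ ^ 2).toReal •
      Complex.exp (t * x * Complex.I) =
      (1 + c * (starRingEnd ℂ) c) * Complex.exp (t * x * Complex.I) +
      c * Complex.exp ((t + s : ℝ) * x * Complex.I) +
      (starRingEnd ℂ) c * Complex.exp ((t - s : ℝ) * x * Complex.I) := by
    intro x
    have e1 : (starRingEnd ℂ) (Complex.exp (s * x * Complex.I)) =
        Complex.exp (-(s * x * Complex.I)) := by
      rw [← Complex.exp_conj]; simp
    have e2 : Complex.exp (s * x * Complex.I) * Complex.exp (-(s * x * Complex.I)) = 1 := by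
      rw [← Complex.exp_add, add_neg_cancel, Complex.exp_zero]
    have e3 : Complex.exp ((t + s : ℝ) * x * Complex.I) =
        Complex.exp (t * x * Complex.I) * Complex.exp (s * x * Complex.I) := by
      rw [← Complex.exp_add]; congr 1; push_cast; ring
    have e4 : Complex.exp ((t - s : ℝ) * x * Complex.I) =
        Complex.exp (t * x * Complex.I) * Complex.exp (-(s * x * Complex.I)) := by
      rw [← Complex.exp_add]; congr 1; push_cast; ring
    rw [ENNReal.toReal_pow, toReal_enorm, Complex.real_smul, Complex.ofReal_pow,
      ← Complex.mul_conj', _root_.map_add, map_mul, map_one, e1, e3, e4]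
    linear_combination (c * (starRingEnd ℂ) c * Complex.exp (t * x * Complex.I)) * e2
  simp_rw [h1]
  rw [integral_add (((hint _).const_mul _).fun_add ((hint _).const_mul _)) ((hint _).const_mul _),
    integral_add ((hint _).const_mul _) ((hint _).const_mul _), integral_const_mul,
    integral_const_mul, integral_const_mul, hφ, hφ, hφ]
  have g1 : ⟪U (-s) ξ, U (-t) ξ⟫_ℂ = ⟪ξ, U (-(t - s)) ξ⟫_ℂ := by
    rw [hU.inner_left, ← hU.map_add]; congr 3; ring
  have g2 : U (-t) (U (-s) ξ) = U (-(t + s)) ξ := by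
    rw [← hU.map_add]; congr 2; ring
  have g3 : ⟪U (-s) ξ, U (-(t + s)) ξ⟫_ℂ = ⟪ξ, U (-t) ξ⟫_ℂ := by
    rw [hU.inner_left, ← hU.map_add]; congr 3; ring
  rw [_root_.map_add, map_smul, g2]
  simp only [inner_add_left, inner_add_right, inner_smul_left, inner_smul_right, g1, g3]
  ring

/-- Polarization of the densities in `measure_add_smul`: the combination over `c = 1, -1, I, -I`
that defines the form, divided by `4`, leaves exactly `e^{isx}`, integrated over `B`. -/
theorem inner_spectralProj_apply {B : Set ℝ} (hB : MeasurableSet B) (ξ : H) (s : ℝ) :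
    ⟪hU.spectralProj B ξ, U (-s) ξ⟫_ℂ = charFun ((hU.measure ξ).restrict B) s := by
  have hexp : ∀ x : ℝ, ‖Complex.exp (s * x * Complex.I)‖ = 1 := fun x => by
    rw [← Complex.ofReal_mul, Complex.norm_exp_ofReal_mul_I]
  have hreal : ∀ c : ℂ, ((hU.measure (ξ + c • U (-s) ξ)).real B : ℂ) =
      ∫ x in B, ((‖1 + c * Complex.exp (s * x * Complex.I)‖ ^ 2 : ℝ) : ℂ) ∂hU.measure ξ := by
    intro c
    rw [integral_complex_ofReal, measure_add_smul, measureReal_def, withDensity_apply _ hB,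
      integral_eq_lintegral_of_nonneg_ae (Eventually.of_forall fun x => by positivity)
        (by fun_prop)]
    congr 2
    refine lintegral_congr fun x => ?_
    rw [ENNReal.ofReal_pow (norm_nonneg _), ofReal_norm]
  have hint : ∀ c : ℂ, Integrable
      (fun x : ℝ => ((‖1 + c * Complex.exp (s * x * Complex.I)‖ ^ 2 : ℝ) : ℂ))
      ((hU.measure ξ).restrict B) := fun c => by
    refine Integrable.of_bound (by fun_prop) ((1 + ‖c‖) ^ 2) (Eventually.of_forall fun x => ?_)
    rw [Complex.norm_real, Real.norm_of_nonneg (by positivity)]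
    refine pow_le_pow_left₀ (norm_nonneg _) ((norm_add_le _ _).trans ?_) 2
    rw [norm_mul, hexp, norm_one, mul_one]
  have r1 := hreal 1
  have r2 := hreal (-1)
  have r3 := hreal Complex.I
  have r4 := hreal (-Complex.I)
  rw [one_smul] at r1
  rw [neg_one_smul, ← sub_eq_add_neg] at r2
  rw [neg_smul, ← sub_eq_add_neg] at r4
  let N : ℂ → ℝ → ℂ := fun c x => ((‖1 + c * Complex.exp (s * x * Complex.I)‖ ^ 2 : ℝ) : ℂ)
  have h1 : Integrable (fun x => N 1 x - N (-1) x) ((hU.measure ξ).restrict B) :=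
    (hint 1).sub (hint (-1))
  have h2 : Integrable (fun x => N 1 x - N (-1) x - Complex.I * N Complex.I x)
      ((hU.measure ξ).restrict B) := h1.sub ((hint Complex.I).const_mul _)
  rw [inner_spectralProj, form, r1, r2, r3, r4, charFun_apply_real, ← integral_const_mul,
    ← integral_const_mul, ← integral_sub (hint _) (hint _),
    ← integral_sub h1 ((hint _).const_mul _), ← integral_add h2 ((hint _).const_mul _),
    ← integral_div]
  refine integral_congr_ae (Eventually.of_forall fun x => ?_)
  simp only [N, Complex.ofReal_pow, ← Complex.mul_conj', _root_.map_add, map_mul, map_neg, map_one,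
    Complex.conj_I]
  ring_nf
  simp only [Complex.I_sq]
  ring

/-- The matrix elements between the projection of `ξ` to `B` and `ξ` are the characteristic function
of the restriction of the measure to `B`. The form at `C` of these two vectors is therefore the mass
of `B ∩ C`. -/
theorem spectralProj_mul {B C : Set ℝ} (hB : MeasurableSet B) (hC : MeasurableSet C) :
    hU.spectralProj C * hU.spectralProj B = hU.spectralProj (B ∩ C) := by
  refine hU.spectralProj_ext fun ξ => ?_
  rw [mul_apply_eq_comp, inner_spectralProj]
  refine hU.form_eq_of_mem ?_
  have h := charFun_mem_charFunSpan ((hU.measure ξ).restrict B) C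
  rw [measureReal_restrict_apply hC, inter_comm] at h
  convert h using 2
  ext s
  rw [hU.inner_spectralProj_apply hB]

theorem norm_sq_spectralProj {B : Set ℝ} (hB : MeasurableSet B) (ξ : H) :
    ‖hU.spectralProj B ξ‖ ^ 2 = (hU.measure ξ).real B := by
  have h : ⟪hU.spectralProj B ξ, hU.spectralProj B ξ⟫_ℂ = (hU.measure ξ).real B := by
    rw [← inner_spectralProj_comm, ← mul_apply_eq_comp, hU.spectralProj_mul hB hB, inter_self,
      inner_spectralProj_self]
  rw [inner_self_eq_norm_sq_to_K] at h
  exact Complex.ofReal_injective (by rw [← h]; simp)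

/-- The spectral measure of a strongly continuous one-parameter unitary group. -/
noncomputable def spectralMeasure : SpectralMeasure H where
  proj := hU.spectralProj
  isStarProjection B hB := by
    refine ⟨?_, ?_⟩
    · rw [IsIdempotentElem, hU.spectralProj_mul hB hB, inter_self]
    · rw [ContinuousLinearMap.isSelfAdjoint_iff_isSymmetric]
      exact hU.inner_spectralProj_comm B
  proj_univ := by
    refine (hU.spectralProj_ext fun ξ => ?_).symm
    rw [measure_univ, one_apply_eq_self, inner_self_eq_norm_sq_to_K]
    simp
  proj_inter B C hB hC := by rw [hU.spectralProj_mul hC hB, inter_comm]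
  hasSum_iUnion B hB hd ξ := by
    have hm := MeasurableSet.iUnion hB
    -- The remainder of a partial sum is again a spectral projection, so its squared norm on `ξ` is
    -- the tail of a convergent series of masses.
    have hs : ∀ s : Finset ℕ, hU.spectralProj (⋃ n, B n) - ∑ n ∈ s, hU.spectralProj (B n) =
        hU.spectralProj ((⋃ n, B n) \ ⋃ n ∈ s, B n) := by
      intro s
      refine hU.spectralProj_ext fun ζ => ?_
      rw [measureReal_sdiff (iUnion₂_subset fun n _ => subset_iUnion B n)
        (s.measurableSet_biUnion fun n _ => hB n),
        measureReal_biUnion_finset (hd.set_pairwise _) (fun n _ => hB n)]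
      simp [inner_spectralProj_self]
    have hsum : HasSum (fun n => (hU.measure ξ).real (B n)) ((hU.measure ξ).real (⋃ n, B n)) := by
      have h1 := measure_iUnion (μ := hU.measure ξ) hd hB
      have h2 : ∑' n, hU.measure ξ (B n) ≠ ∞ := by rw [← h1]; exact measure_ne_top _ _
      have h3 := ENNReal.hasSum_toReal h2
      rw [← ENNReal.tsum_toReal_eq (fun n => measure_ne_top _ _), ← h1] at h3
      exact h3
    rw [HasSum, tendsto_iff_norm_sub_tendsto_zero]
    have hn : ∀ s : Finset ℕ, ‖∑ n ∈ s, hU.spectralProj (B n) ξ -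
        hU.spectralProj (⋃ n, B n) ξ‖ ^ 2 =
        (hU.measure ξ).real (⋃ n, B n) - ∑ n ∈ s, (hU.measure ξ).real (B n) := by
      intro s
      have h1 := congrArg (fun T : H →L[ℂ] H => T ξ) (hs s)
      simp only [sub_apply, sum_apply] at h1
      rw [norm_sub_rev, h1, hU.norm_sq_spectralProj (hm.diff (s.measurableSet_biUnion
        fun n _ => hB n)), measureReal_sdiff (iUnion₂_subset fun n _ => subset_iUnion B n)
        (s.measurableSet_biUnion fun n _ => hB n),
        measureReal_biUnion_finset (hd.set_pairwise _) (fun n _ => hB n)]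
    have hlim : Tendsto (fun s : Finset ℕ => ‖∑ n ∈ s, hU.spectralProj (B n) ξ -
        hU.spectralProj (⋃ n, B n) ξ‖ ^ 2) (SummationFilter.unconditional ℕ).filter (𝓝 0) := by
      simp_rw [hn]
      have := hsum.const_sub ((hU.measure ξ).real (⋃ n, B n))
      simpa using this
    have := hlim.sqrt
    simpa using this

theorem scalarMeasure_spectralMeasure (ξ : H) :
    hU.spectralMeasure.scalarMeasure ξ = hU.measure ξ := by
  ext B hB
  rw [SpectralMeasure.scalarMeasure_apply _ _ hB]
  change ENNReal.ofReal (‖hU.spectralProj B ξ‖ ^ 2) = _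
  rw [hU.norm_sq_spectralProj hB, ofReal_measureReal]

theorem unitaryGroup_spectralMeasure : hU.spectralMeasure.unitaryGroup = U := by
  funext t
  refine ContinuousLinearMap.coe_injective ((ext_inner_map _ _).1 fun ξ => ?_)
  have key : ⟪ξ, hU.spectralMeasure.unitaryGroup t ξ⟫_ℂ = ⟪ξ, U t ξ⟫_ℂ := by
    rw [SpectralMeasure.inner_unitaryGroup, scalarMeasure_spectralMeasure, charFun_measure,
      neg_neg]
  exact (inner_conj_symm _ _).symm.trans
    ((congrArg (starRingEnd ℂ) key).trans (inner_conj_symm _ _))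

end IsUnitaryGroup

/-- **Stone's theorem**: the functional calculus of the generator of a strongly continuous
one-parameter unitary group `U` is that of a spectral measure `E` with `U(t) = ∫ e^{-itx} dE`. -/
theorem exists_functionOf_generator_eq {U : ℝ → H →L[ℂ] H} (hU : IsUnitaryGroup U) :
    ∃ E : SpectralMeasure H, E.unitaryGroup = U ∧
      ∀ (f : ℝ → ℝ) (hf : Measurable f), functionOf (generator U) hf = E.integral hf := by
  have h : ∃ E : SpectralMeasure H, generator U = E.integral measurable_id :=
    ⟨hU.spectralMeasure, by
      rw [← SpectralMeasure.generator_unitaryGroup, hU.unitaryGroup_spectralMeasure]⟩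
  -- `functionOf` uses a resolution picked by choice, not necessarily the one constructed. Its
  -- unitary group is still `U`, because the generator determines the group.
  refine ⟨h.choose, h.choose.unitaryGroup_eq_of_generator hU h.choose_spec, fun f hf => ?_⟩
  rw [functionOf, dif_pos h]

end Stone

/-! ### Holomorphic extensions to a strip and Laplace transforms. -/

section Strip

theorem isOpen_strip (β : ℝ) : IsOpen {z : ℂ | 0 < z.im ∧ z.im < β} :=
  (isOpen_lt continuous_const Complex.continuous_im).inter
    (isOpen_lt Complex.continuous_im continuous_const)

theorem closedStrip_subset_closure {β : ℝ} (hβ : 0 < β) :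
    {z : ℂ | 0 ≤ z.im ∧ z.im ≤ β} ⊆ closure {z : ℂ | 0 < z.im ∧ z.im < β} := by
  have h : {z : ℂ | 0 < z.im ∧ z.im < β} = univ ×ℂ Ioo 0 β := by
    ext z; simp [Complex.mem_reProdIm]
  rw [h, Complex.closure_reProdIm, closure_Ioo hβ.ne, closure_univ]
  intro z hz
  exact ⟨mem_univ _, hz⟩

/-- A function on a strip that vanishes on the lower boundary line vanishes near that line. -/
theorem eq_zero_of_two_mul_im_le {β : ℝ} {g : ℂ → ℂ}
    (hc : ContinuousOn g {z | 0 ≤ z.im ∧ z.im ≤ β})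
    (hd : DifferentiableOn ℂ g {z | 0 < z.im ∧ z.im < β}) (h0 : ∀ t : ℝ, g t = 0) {z : ℂ}
    (hz : 0 < z.im) (hzβ : 2 * z.im ≤ β) : g z = 0 := by
  set a := z.im with ha
  let U : Set ℂ := Ioo (-a) a ×ℂ Ioo (-a) a
  have hne : (-a) ≠ a := by linarith
  have hUc : closure U = Icc (-a) a ×ℂ Icc (-a) a := by
    rw [Complex.closure_reProdIm, closure_Ioo hne]
  -- In each of the four rotations of the square about `z`, a different side falls on the real line.
  -- The product of the four rotated copies of `g` hence vanishes on the whole boundary, and the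
  -- maximum principle gives `g z ^ 4 = 0` at the centre. The hypothesis `2 * z.im ≤ β` keeps the
  -- square in the strip.
  let u : Fin 4 → ℂ := ![1, -1, Complex.I, -Complex.I]
  have him : ∀ k w, (z + u k * w).im = a + ![w.im, -w.im, w.re, -w.re] k := by
    intro k w
    fin_cases k <;> simp [u, ha]
  have hcl : ∀ k, MapsTo (fun w => z + u k * w) (closure U) {z | 0 ≤ z.im ∧ z.im ≤ β} := by
    intro k w hw
    rw [hUc] at hw
    obtain ⟨⟨h1, h2⟩, h3, h4⟩ := hw
    rw [mem_ofPred_eq, him]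
    fin_cases k <;> simp <;> constructor <;> linarith
  have hop : ∀ k, MapsTo (fun w => z + u k * w) U {z | 0 < z.im ∧ z.im < β} := by
    intro k w hw
    obtain ⟨⟨h1, h2⟩, h3, h4⟩ := hw
    rw [mem_ofPred_eq, him]
    fin_cases k <;> simp <;> constructor <;> linarith
  have hreal : ∀ w : ℂ, w.im = 0 → g w = 0 := fun w hw => by
    have : w = (w.re : ℂ) := Complex.ext rfl (by simpa using hw)
    rw [this, h0]
  let P : ℂ → ℂ := fun w => ∏ k, g (z + u k * w)
  have hP : DiffContOnCl ℂ P U := by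
    constructor
    · refine DifferentiableOn.fun_finsetProd fun k _ => ?_
      exact hd.comp (by fun_prop) (hop k)
    · refine continuousOn_finsetProd _ fun k _ => ?_
      exact hc.comp (by fun_prop) (hcl k)
  have hfr : ∀ w ∈ frontier U, ‖P w‖ ≤ 0 := by
    intro w hw
    rw [Complex.frontier_reProdIm, frontier_Ioo (by linarith)] at hw
    rw [norm_le_zero_iff]
    suffices h : ∃ k, (z + u k * w).im = 0 by
      obtain ⟨k, hk⟩ := h
      exact Finset.prod_eq_zero (Finset.mem_univ k) (hreal _ hk)
    rcases hw with ⟨-, h | h⟩ | ⟨h | h, -⟩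
    · exact ⟨0, by rw [him]; simpa using by linarith⟩
    · refine ⟨1, ?_⟩
      rw [him]
      simp only [mem_singleton_iff] at h
      simp [h]
    · exact ⟨2, by rw [him]; simpa using by linarith⟩
    · refine ⟨3, ?_⟩
      rw [him]
      simp only [mem_singleton_iff] at h
      simp [h]
  have hbd : Bornology.IsBounded U := by
    refine (Bornology.IsBounded.reProdIm ?_ ?_) <;> exact Metric.isBounded_Ioo _ _
  have hU0 : (0 : ℂ) ∈ closure U := by
    refine subset_closure ⟨?_, ?_⟩ <;> simp [hz]
  have h4 := Complex.norm_le_of_forall_mem_frontier_norm_le hbd hP hfr hU0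
  rw [norm_le_zero_iff] at h4
  obtain ⟨k, -, hk⟩ := Finset.prod_eq_zero_iff.1 h4
  simpa using hk

/-- Holomorphy is not assumed on the real line, so the identity theorem is started from the open
lower half of the strip, where the previous lemma gives zero, and continuity reaches the edges. -/
theorem eqOn_zero_of_strip {β : ℝ} (hβ : 0 < β) {g : ℂ → ℂ}
    (hc : ContinuousOn g {z | 0 ≤ z.im ∧ z.im ≤ β})
    (hd : DifferentiableOn ℂ g {z | 0 < z.im ∧ z.im < β}) (h0 : ∀ t : ℝ, g t = 0) :
    EqOn g 0 {z | 0 ≤ z.im ∧ z.im ≤ β} := by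
  have hopen := isOpen_strip β
  have hconv : Convex ℝ {z : ℂ | 0 < z.im ∧ z.im < β} :=
    (convex_halfSpace_im_gt 0).inter (convex_halfSpace_im_lt β)
  have hmem : (β / 4 : ℝ) * Complex.I ∈ {z : ℂ | 0 < z.im ∧ z.im < β} := by
    rw [mem_ofPred_eq]
    simp only [Complex.mul_im, Complex.ofReal_re, Complex.ofReal_im, Complex.I_re, Complex.I_im]
    constructor <;> linarith
  have hev : g =ᶠ[𝓝 ((β / 4 : ℝ) * Complex.I)] 0 := by
    have hop : IsOpen {z : ℂ | 0 < z.im ∧ z.im < β / 2} := isOpen_strip (β / 2)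
    have hm : (β / 4 : ℝ) * Complex.I ∈ {z : ℂ | 0 < z.im ∧ z.im < β / 2} := by
      rw [mem_ofPred_eq]
      simp only [Complex.mul_im, Complex.ofReal_re, Complex.ofReal_im, Complex.I_re,
        Complex.I_im]
      constructor <;> linarith
    filter_upwards [hop.mem_nhds hm] with z hz
    exact eq_zero_of_two_mul_im_le hc hd h0 hz.1 (by linarith [hz.2])
  have h := (hd.analyticOnNhd hopen).eqOn_zero_of_preconnected_of_eventuallyEq_zero
    hconv.isPreconnected hmem hev
  exact h.of_subset_closure hc continuousOn_const
    (fun z hz => ⟨hz.1.le, hz.2.le⟩) (closedStrip_subset_closure hβ)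

/-- The holomorphic extension of a function on the real line to a strip is unique. -/
theorem IsStripExtension.eqOn {β : ℝ} (hβ : 0 < β) {F : ℝ → ℂ} {G G' : ℂ → ℂ}
    (h : IsStripExtension β F G) (h' : IsStripExtension β F G') :
    EqOn G G' {z | 0 ≤ z.im ∧ z.im ≤ β} := by
  intro z hz
  exact sub_eq_zero.1 (eqOn_zero_of_strip hβ (h.continuousOn.sub h'.continuousOn)
    (h.differentiableOn.sub h'.differentiableOn)
    (fun t => by rw [Pi.sub_apply, h.boundary, h'.boundary, sub_self]) hz)

theorem IsStripExtension.mono {β γ : ℝ} (hγ : γ ≤ β) {F : ℝ → ℂ} {G : ℂ → ℂ}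
    (h : IsStripExtension β F G) : IsStripExtension γ F G :=
  ⟨h.continuousOn.mono fun _ hz => ⟨hz.1, hz.2.trans hγ⟩,
    h.differentiableOn.mono fun _ hz => ⟨hz.1, hz.2.trans_le hγ⟩, h.boundary⟩

theorem IsStripExtension.add {β : ℝ} {F F' : ℝ → ℂ} {G G' : ℂ → ℂ}
    (h : IsStripExtension β F G) (h' : IsStripExtension β F' G') :
    IsStripExtension β (F + F') (G + G') :=
  ⟨h.continuousOn.add h'.continuousOn, h.differentiableOn.add h'.differentiableOn,
    fun t => by rw [Pi.add_apply, Pi.add_apply, h.boundary, h'.boundary]⟩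

theorem IsStripExtension.const_smul {β : ℝ} {F : ℝ → ℂ} {G : ℂ → ℂ} (c : ℂ)
    (h : IsStripExtension β F G) : IsStripExtension β (c • F) (c • G) :=
  ⟨h.continuousOn.const_smul c, h.differentiableOn.const_smul c,
    fun t => by rw [Pi.smul_apply, Pi.smul_apply, h.boundary]⟩

open ProbabilityTheory

theorem norm_cexp_mul_ofReal (z : ℂ) (x : ℝ) :
    ‖Complex.exp (z * x)‖ = Real.exp (z.re * x) := by
  rw [Complex.norm_exp]; simp

/-- `complexMGF` is continuous wherever the integrand is dominated. -/
theorem continuousOn_complexMGF_of_le {μ : Measure ℝ} {S : Set ℂ} {b : ℝ → ℝ}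
    (hb : Integrable b μ) (h : ∀ z ∈ S, ∀ᵐ x ∂μ, Real.exp (z.re * x) ≤ b x) :
    ContinuousOn (complexMGF id μ) S := by
  refine continuousOn_of_dominated (bound := b) (fun z _ => by fun_prop) ?_ hb ?_
  · intro z hz
    filter_upwards [h z hz] with x hx
    rw [id, norm_cexp_mul_ofReal]
    exact hx
  · exact Eventually.of_forall fun x => by fun_prop

theorem exp_mul_le_one_add {β s : ℝ} (hs : 0 ≤ s) (hsβ : s ≤ β) (x : ℝ) :
    Real.exp (-s * x) ≤ 1 + Real.exp (-β * x) := by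
  rcases le_total 0 x with hx | hx
  · have : Real.exp (-s * x) ≤ 1 := Real.exp_le_one_iff.2 (by nlinarith)
    linarith [Real.exp_nonneg (-β * x)]
  · have : Real.exp (-s * x) ≤ Real.exp (-β * x) := Real.exp_le_exp.2 (by nlinarith)
    linarith

/-- The extension is the integral of `e^{izx}`, dominated on the whole closed strip by `1 +
e^{-βx}`. -/
theorem isStripExtension_complexMGF {μ : Measure ℝ} [IsFiniteMeasure μ] {β : ℝ}
    (h : Integrable (fun x => Real.exp (-β * x)) μ) :
    IsStripExtension β (charFun μ) (fun z => complexMGF id μ (z * Complex.I)) := by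
  have hint : ∀ s, 0 ≤ s → s ≤ β → Integrable (fun x => Real.exp (-s * x)) μ := fun s h1 h2 => by
    refine ((integrable_const (1 : ℝ)).add h).mono' (by fun_prop)
      (Eventually.of_forall fun x => ?_)
    rw [Real.norm_of_nonneg (Real.exp_nonneg _)]
    exact exp_mul_le_one_add h1 h2 x
  refine ⟨?_, ?_, fun t => complexMGF_id_mul_I t⟩
  · have h1 : ContinuousOn (complexMGF id μ) {w | -β ≤ w.re ∧ w.re ≤ 0} := by
      refine continuousOn_complexMGF_of_le ((integrable_const (1 : ℝ)).add h) ?_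
      intro z hz
      refine Eventually.of_forall fun x => ?_
      have := exp_mul_le_one_add (β := β) (s := -z.re) (by linarith [hz.2]) (by linarith [hz.1]) x
      rwa [neg_neg] at this
    refine h1.comp (by fun_prop) fun z hz => ?_
    rw [mem_ofPred_eq, Complex.mul_I_re]
    exact ⟨neg_le_neg hz.2, by linarith [hz.1]⟩
  · refine differentiableOn_complexMGF.comp (by fun_prop) fun z hz => ?_
    rw [mem_ofPred_eq, Complex.mul_I_re]
    refine interior_mono (s := Ioo (-β) 0) ?_ ?_
    · intro s hs
      have := hint (-s) (by linarith [hs.2]) (by linarith [hs.1])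
      rwa [neg_neg] at this
    · rw [interior_Ioo]
      exact ⟨neg_lt_neg hz.2, by linarith [hz.1]⟩

/-- **Painlevé's theorem** for a vertical line: a continuous function that is holomorphic off the
imaginary axis is holomorphic. -/
theorem differentiableOn_of_differentiableOn_re_ne {f : ℂ → ℂ} {U : Set ℂ} (hU : IsOpen U)
    (hc : ContinuousOn f U) (hd : DifferentiableOn ℂ f (U ∩ {z | z.re ≠ 0})) :
    DifferentiableOn ℂ f U := by
  refine (Complex.isConservativeOn_and_continuousOn_iff_isDifferentiableOn hU).1 ⟨?_, hc⟩
  intro z w hzw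
  rw [← add_eq_zero_iff_eq_neg, Complex.wedgeIntegral_add_wedgeIntegral_eq]
  have hrect : ∀ a b : ℝ, uIcc a b ⊆ uIcc z.re w.re →
      uIcc a b ×ℂ uIcc z.im w.im ⊆ U := fun a b hab p hp => hzw ⟨hab hp.1, hp.2⟩
  have key : ∀ a b : ℝ, uIcc a b ⊆ uIcc z.re w.re → (0 : ℝ) ∉ Ioo (min a b) (max a b) →
      (∫ x : ℝ in a..b, f (x + z.im * Complex.I)) - (∫ x : ℝ in a..b, f (x + w.im * Complex.I)) +
      Complex.I • (∫ y : ℝ in z.im..w.im, f (b + y * Complex.I)) -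
      Complex.I • (∫ y : ℝ in z.im..w.im, f (a + y * Complex.I)) = 0 := by
    intro a b hab h0
    have := Complex.integral_boundary_rect_eq_zero_of_continuousOn_of_differentiableOn f
      (a + z.im * Complex.I) (b + w.im * Complex.I) ?_ ?_
    · simpa using this
    · refine hc.mono ?_
      simpa using hrect a b hab
    · refine hd.mono fun p hp => ⟨?_, ?_⟩
      · have hp' : p ∈ Ioo (min a b) (max a b) ×ℂ Ioo (min z.im w.im) (max z.im w.im) := by
          simpa using hp
        exact hrect a b hab ⟨Ioo_subset_Icc_self hp'.1, Ioo_subset_Icc_self hp'.2⟩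
      · have hp' : p ∈ Ioo (min a b) (max a b) ×ℂ Ioo (min z.im w.im) (max z.im w.im) := by
          simpa using hp
        intro hre
        exact h0 (hre ▸ hp'.1)
  have hint : ∀ a b : ℝ, uIcc a b ⊆ uIcc z.re w.re → ∀ c ∈ uIcc z.im w.im,
      IntervalIntegrable (fun x : ℝ => f (x + c * Complex.I)) volume a b := by
    intro a b hab c hcm
    refine ContinuousOn.intervalIntegrable ?_
    refine hc.comp (by fun_prop) fun x hx => hrect a b hab ⟨?_, ?_⟩
    · simpa using hx
    · simpa using hcm
  -- A rectangle that meets the imaginary axis is cut along it. Each half has holomorphic interior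
  -- and continuous boundary values, and the integrals along the cut cancel.
  by_cases h0 : (0 : ℝ) ∈ uIcc z.re w.re
  · have h1 : uIcc z.re 0 ⊆ uIcc z.re w.re := uIcc_subset_uIcc left_mem_uIcc h0
    have h2 : uIcc 0 w.re ⊆ uIcc z.re w.re := uIcc_subset_uIcc h0 right_mem_uIcc
    have k1 := key z.re 0 h1 (by
      rintro ⟨h3, h4⟩
      rcases le_total z.re 0 with h | h
      · rw [max_eq_right h] at h4; exact lt_irrefl _ h4
      · rw [min_eq_right h] at h3; exact lt_irrefl _ h3)
    have k2 := key 0 w.re h2 (by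
      rintro ⟨h3, h4⟩
      rcases le_total w.re 0 with h | h
      · rw [max_eq_left h] at h4; exact lt_irrefl _ h4
      · rw [min_eq_left h] at h3; exact lt_irrefl _ h3)
    rw [← intervalIntegral.integral_add_adjacent_intervals (hint _ _ h1 _ left_mem_uIcc)
      (hint _ _ h2 _ left_mem_uIcc), ← intervalIntegral.integral_add_adjacent_intervals
      (hint _ _ h1 _ right_mem_uIcc) (hint _ _ h2 _ right_mem_uIcc)]
    linear_combination k1 + k2
  · exact key z.re w.re subset_rfl fun h => h0 (Ioo_subset_Icc_self h)

/-- **Landau's theorem**: if the moment generating function of a measure on `(-∞, 0]` continues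
holomorphically to a disc `B(1, r)`, then `e^{(1 - s)x}` is integrable for `s < r`. -/
theorem lintegral_exp_lt_top_of_differentiableOn {μ : Measure ℝ} [IsFiniteMeasure μ]
    (hμ : ∀ᵐ x ∂μ, x ≤ 0) {h : ℂ → ℂ} {r : ℝ} (hd : DifferentiableOn ℂ h (Metric.ball 1 r))
    (heq : h =ᶠ[𝓝 1] complexMGF id μ) {s : ℝ} (hs : 0 ≤ s) (hsr : s < r) :
    ∫⁻ x, ENNReal.ofReal (Real.exp ((1 - s) * x)) ∂μ < ∞ := by
  have hint1 : ∀ t : ℝ, 0 ≤ t → Integrable (fun x => Real.exp (t * x)) μ := fun t ht => by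
    refine (integrable_const (1 : ℝ)).mono' (by fun_prop) ?_
    filter_upwards [hμ] with x hx
    rw [Real.norm_of_nonneg (Real.exp_nonneg _)]
    exact Real.exp_le_one_iff.2 (by nlinarith)
  have hmem : (1 : ℂ).re ∈ interior (integrableExpSet id μ) := by
    refine interior_mono (s := Ioi 0) (fun t ht => hint1 t (le_of_lt ht)) ?_
    rw [interior_Ioi]
    simp
  have hz : ((1 - s : ℝ) : ℂ) ∈ Metric.ball (1 : ℂ) r := by
    rw [Metric.mem_ball, dist_eq_norm]
    have : ((1 - s : ℝ) : ℂ) - 1 = ((-s : ℝ) : ℂ) := by push_cast; ring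
    rw [this, Complex.norm_real, norm_neg, Real.norm_of_nonneg hs]
    exact hsr
  have hsum := Complex.hasSum_taylorSeries_on_ball hd hz
  have hpow : ∀ n : ℕ, Integrable (fun x => (-s * x) ^ n / (n.factorial : ℝ) * Real.exp x) μ := by
    intro n
    have h1 := integrable_pow_mul_exp_of_mem_interior_integrableExpSet (X := id) (μ := μ)
      (v := 1) (by simpa using hmem) n
    refine (h1.const_mul ((-s) ^ n / (n.factorial : ℝ))).congr (Eventually.of_forall fun x => ?_)
    simp only [id, one_mul]
    ring
  -- The `n`-th derivative at `1` is the integral of `x^n e^x`, so these are the Taylor terms at `1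
  -- - s`.
  have hterm : ∀ n : ℕ, ((n.factorial : ℂ))⁻¹ • (((1 - s : ℝ) : ℂ) - 1) ^ n •
      iteratedDeriv n h 1 =
      ((∫ x, (-s * x) ^ n / (n.factorial : ℝ) * Real.exp x ∂μ : ℝ) : ℂ) := by
    intro n
    rw [heq.iteratedDeriv_eq, iteratedDeriv_complexMGF hmem, ← integral_complex_ofReal,
      smul_smul, smul_eq_mul, ← integral_const_mul]
    refine integral_congr_ae (Eventually.of_forall fun x => ?_)
    simp only [id]
    push_cast
    ring_nf
  simp_rw [hterm] at hsum
  have hsum' : Summable fun n : ℕ => ∫ x, (-s * x) ^ n / (n.factorial : ℝ) * Real.exp x ∂μ :=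
    Complex.summable_ofReal.1 hsum.summable
  -- Both `-s` and `x` are nonpositive, so every term is nonnegative and sum and integral may be
  -- exchanged without prior integrability.
  have hnn : ∀ n : ℕ, ∀ᵐ x ∂μ, 0 ≤ (-s * x) ^ n / (n.factorial : ℝ) * Real.exp x := by
    intro n
    filter_upwards [hμ] with x hx
    have : 0 ≤ -s * x := by nlinarith
    positivity
  have hlin : ∀ n : ℕ, ∫⁻ x, ENNReal.ofReal ((-s * x) ^ n / (n.factorial : ℝ) * Real.exp x) ∂μ =
      ENNReal.ofReal (∫ x, (-s * x) ^ n / (n.factorial : ℝ) * Real.exp x ∂μ) := fun n =>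
    (ofReal_integral_eq_lintegral_ofReal (hpow n) (hnn n)).symm
  have hexp : ∀ᵐ x ∂μ, ENNReal.ofReal (Real.exp ((1 - s) * x)) =
      ∑' n : ℕ, ENNReal.ofReal ((-s * x) ^ n / (n.factorial : ℝ) * Real.exp x) := by
    filter_upwards [ae_all_iff.2 hnn] with x hx
    have h1 : HasSum (fun n : ℕ => (-s * x) ^ n / (n.factorial : ℝ) * Real.exp x)
        (Real.exp (-s * x) * Real.exp x) := by
      refine HasSum.mul_right _ ?_
      rw [Real.exp_eq_exp_ℝ]
      exact NormedSpace.expSeries_div_hasSum_exp (-s * x)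
    rw [← ENNReal.ofReal_tsum_of_nonneg hx h1.summable, h1.tsum_eq, ← Real.exp_add]
    congr 2
    ring
  rw [lintegral_congr_ae hexp, lintegral_tsum (fun n => by fun_prop)]
  simp_rw [hlin]
  exact hsum'.tsum_ofReal_lt_top

/-- Only the mass on the negative half-line can cause divergence. Subtracting from `G` the transform
of the other half, which is holomorphic for negative real part, continues the transform of the
negative half to real part above `-β`, and Landau's theorem applies. -/
theorem lintegral_exp_lt_top_of_isStripExtension {μ : Measure ℝ} [IsFiniteMeasure μ] {β : ℝ}
    {G : ℂ → ℂ} (hG : IsStripExtension β (charFun μ) G) {s : ℝ} (hs : 0 ≤ s)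
    (hsβ : s < β) : ∫⁻ x, ENNReal.ofReal (Real.exp (-s * x)) ∂μ < ∞ := by
  set ν := μ.restrict (Iio 0) with hν
  set κ := μ.restrict (Ici 0) with hκ
  have hsplit : μ = ν + κ := by
    rw [hν, hκ, ← compl_Iio, Measure.restrict_add_restrict_compl measurableSet_Iio]
  have hν0 : ∀ᵐ x ∂ν, x ≤ 0 := by
    filter_upwards [ae_restrict_mem measurableSet_Iio] with x hx using le_of_lt hx
  have hκ0 : ∀ᵐ x ∂κ, 0 ≤ x := ae_restrict_mem measurableSet_Ici
  have hνle : ∀ z : ℂ, 0 ≤ z.re → ∀ᵐ x ∂ν, Real.exp (z.re * x) ≤ 1 := fun z hz => by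
    filter_upwards [hν0] with x hx using Real.exp_le_one_iff.2 (by nlinarith)
  have hκle : ∀ z : ℂ, z.re ≤ 0 → ∀ᵐ x ∂κ, Real.exp (z.re * x) ≤ 1 := fun z hz => by
    filter_upwards [hκ0] with x hx using Real.exp_le_one_iff.2 (by nlinarith)
  have hνc : ContinuousOn (complexMGF id ν) {z | 0 ≤ z.re} :=
    continuousOn_complexMGF_of_le (integrable_const (1 : ℝ)) hνle
  have hκc : ContinuousOn (complexMGF id κ) {z | z.re ≤ 0} :=
    continuousOn_complexMGF_of_le (integrable_const (1 : ℝ)) hκle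
  have hνd : DifferentiableOn ℂ (complexMGF id ν) {z | 0 < z.re} := by
    refine differentiableOn_complexMGF.mono fun z hz => ?_
    refine interior_mono (s := Ioi 0) (fun t ht => ?_) (by rwa [interior_Ioi])
    refine (integrable_const (1 : ℝ)).mono' (by fun_prop) ?_
    filter_upwards [hν0] with x hx
    rw [Real.norm_of_nonneg (Real.exp_nonneg _)]
    exact Real.exp_le_one_iff.2 (mul_nonpos_of_nonneg_of_nonpos (le_of_lt ht) hx)
  have hκd : DifferentiableOn ℂ (complexMGF id κ) {z | z.re < 0} := by
    refine differentiableOn_complexMGF.mono fun z hz => ?_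
    refine interior_mono (s := Iio 0) (fun t ht => ?_) (by rwa [interior_Iio])
    refine (integrable_const (1 : ℝ)).mono' (by fun_prop) ?_
    filter_upwards [hκ0] with x hx
    rw [Real.norm_of_nonneg (Real.exp_nonneg _)]
    exact Real.exp_le_one_iff.2 (mul_nonpos_of_nonpos_of_nonneg (le_of_lt ht) hx)
  let L : ℂ → ℂ := fun w => G (w * -Complex.I) - complexMGF id κ w
  have him : ∀ w : ℂ, (w * -Complex.I).im = -w.re := fun w => by simp
  have hLc : ContinuousOn L {w | -β ≤ w.re ∧ w.re ≤ 0} := by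
    refine (hG.continuousOn.comp (by fun_prop) fun w hw => ?_).sub
      (hκc.mono fun w hw => hw.2)
    rw [mem_ofPred_eq, him]
    exact ⟨by linarith [hw.2], by linarith [hw.1]⟩
  have hLd : DifferentiableOn ℂ L {w | -β < w.re ∧ w.re < 0} := by
    refine (hG.differentiableOn.comp (by fun_prop) fun w hw => ?_).sub
      (hκd.mono fun w hw => hw.2)
    rw [mem_ofPred_eq, him]
    exact ⟨by linarith [hw.2], by linarith [hw.1]⟩
  have hL0 : ∀ w : ℂ, w.re = 0 → complexMGF id ν w = L w := by
    intro w hw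
    have h1 : w = (w.im : ℂ) * Complex.I := by apply Complex.ext <;> simp [hw]
    have h2 : charFun μ w.im = charFun ν w.im + charFun κ w.im := by
      simp only [charFun_apply_real]
      have hi : ∀ m : Measure ℝ, IsFiniteMeasure m →
          Integrable (fun x : ℝ => Complex.exp (w.im * x * Complex.I)) m := fun m _ =>
        Integrable.of_bound (by fun_prop) 1 (Eventually.of_forall fun x => by
          rw [← Complex.ofReal_mul, Complex.norm_exp_ofReal_mul_I])
      conv_lhs => rw [hsplit]
      rw [integral_add_measure (hi ν inferInstance) (hi κ inferInstance)]
    have h3 : w * -Complex.I = (w.im : ℂ) := by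
      rw [h1]
      simp [mul_assoc]
    simp only [L]
    rw [h3, hG.boundary, h2, h1, complexMGF_id_mul_I, complexMGF_id_mul_I]
    simp
  classical
  -- The two branches agree on the imaginary axis by `hL0`, so Painlevé's theorem makes the glued
  -- function holomorphic.
  let h : ℂ → ℂ := fun w => if 0 ≤ w.re then complexMGF id ν w else L w
  have hU : IsOpen {w : ℂ | -β < w.re} := isOpen_lt continuous_const Complex.continuous_re
  have hhc : ContinuousOn h {w | -β < w.re} := by
    refine ContinuousOn.if ?_ ?_ ?_
    · rintro w ⟨-, hw⟩
      refine hL0 w ?_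
      have := frontier_le_subset_eq (continuous_const (y := (0 : ℝ))) Complex.continuous_re hw
      exact this.symm
    · refine hνc.mono ?_
      rintro w ⟨-, hw⟩
      exact (isClosed_le continuous_const Complex.continuous_re).closure_subset hw
    · refine hLc.mono ?_
      rintro w ⟨hw1, hw⟩
      refine ⟨le_of_lt hw1, ?_⟩
      refine (isClosed_le Complex.continuous_re continuous_const).closure_subset_iff.2 ?_ hw
      intro v hv
      exact le_of_not_ge hv
  have hhd : DifferentiableOn ℂ h {w | -β < w.re} := by
    refine differentiableOn_of_differentiableOn_re_ne hU hhc ?_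
    rintro w ⟨hw1, hw2⟩
    rcases lt_or_gt_of_ne hw2 with hw | hw
    · have hop : IsOpen {w : ℂ | -β < w.re ∧ w.re < 0} :=
        hU.inter (isOpen_lt Complex.continuous_re continuous_const)
      have hd := hLd.differentiableAt (hop.mem_nhds ⟨hw1, hw⟩)
      refine (hd.congr_of_eventuallyEq ?_).differentiableWithinAt
      filter_upwards [hop.mem_nhds ⟨hw1, hw⟩] with v hv
      exact if_neg (not_le.2 hv.2)
    · have hop : IsOpen {w : ℂ | 0 < w.re} := isOpen_lt continuous_const Complex.continuous_re
      have hd := hνd.differentiableAt (hop.mem_nhds hw)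
      refine (hd.congr_of_eventuallyEq ?_).differentiableWithinAt
      filter_upwards [hop.mem_nhds hw] with v hv
      exact if_pos (le_of_lt hv)
  have heq : h =ᶠ[𝓝 1] complexMGF id ν := by
    have hop : IsOpen {w : ℂ | 0 < w.re} := isOpen_lt continuous_const Complex.continuous_re
    filter_upwards [hop.mem_nhds (x := (1 : ℂ)) (by simp)] with v hv
    exact if_pos (le_of_lt hv)
  have hball : Metric.ball (1 : ℂ) (1 + β) ⊆ {w | -β < w.re} := by
    intro w hw
    rw [Metric.mem_ball, dist_eq_norm] at hw
    have h1 := (abs_le.1 ((Complex.abs_re_le_norm (w - 1)).trans hw.le)).1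
    have h2 := (abs_lt.1 ((Complex.abs_re_le_norm (w - 1)).trans_lt hw)).1
    rw [Complex.sub_re, Complex.one_re] at h2
    rw [mem_ofPred_eq]
    linarith
  -- The disc is centred at `1`, with radius `1 + β`, so reaching `-s` means moving left by `1 + s`.
  have hfin := lintegral_exp_lt_top_of_differentiableOn hν0 (hhd.mono hball) heq
    (s := 1 + s) (by linarith) (by linarith)
  have hfin' : ∫⁻ x, ENNReal.ofReal (Real.exp (-s * x)) ∂κ < ∞ := by
    refine lt_of_le_of_lt (lintegral_mono_ae (g := fun _ => 1) ?_) ?_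
    · filter_upwards [hκ0] with x hx
      rw [← ENNReal.ofReal_one]
      exact ENNReal.ofReal_le_ofReal (Real.exp_le_one_iff.2 (by nlinarith))
    · simp
  rw [hsplit, lintegral_add_measure]
  refine ENNReal.add_lt_top.2 ⟨?_, hfin'⟩
  have e : 1 - (1 + s) = -s := by ring
  rwa [e] at hfin

/-- If the characteristic function of `μ` extends to `G` on the strip, then
`∫ e^{-βx} dμ ≤ |G(iβ)|`. -/
theorem IsStripExtension.lintegral_exp_le {μ : Measure ℝ} [IsFiniteMeasure μ] {β : ℝ}
    (hβ : 0 < β) {G : ℂ → ℂ} (hG : IsStripExtension β (charFun μ) G) :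
    ∫⁻ x, ENNReal.ofReal (Real.exp (-β * x)) ∂μ ≤ ‖G (Complex.I * β)‖ₑ := by
  have hval : ∀ s, 0 < s → s < β →
      ∫⁻ x, ENNReal.ofReal (Real.exp (-s * x)) ∂μ = ‖G (Complex.I * s)‖ₑ := by
    intro s hs hsβ
    have hint : Integrable (fun x => Real.exp (-s * x)) μ := by
      refine ⟨by fun_prop, ?_⟩
      rw [hasFiniteIntegral_iff_ofReal (Eventually.of_forall fun x => Real.exp_nonneg _)]
      exact lintegral_exp_lt_top_of_isStripExtension hG hs.le hsβ
    have h1 := (hG.mono hsβ.le).eqOn hs (isStripExtension_complexMGF hint)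
      (x := Complex.I * s) (by simp [hs.le])
    have h2 : Complex.I * s * Complex.I = ((-s : ℝ) : ℂ) := by
      push_cast
      linear_combination (s : ℂ) * Complex.I_mul_I
    rw [h1, h2, complexMGF_ofReal, mgf, ← ofReal_norm, Complex.norm_real, Real.norm_of_nonneg
      (integral_nonneg fun x => Real.exp_nonneg _)]
    exact (ofReal_integral_eq_lintegral_ofReal hint
      (Eventually.of_forall fun x => Real.exp_nonneg _)).symm
  -- Integrability at `β` itself is not yet known: let `u n` increase to `β`, with Fatou's lemma on
  -- the integrals and continuity of `G` at the upper edge.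
  obtain ⟨u, -, hu, hlim⟩ := exists_seq_strictMono_tendsto' hβ
  have h1 : Tendsto (fun n => ‖G (Complex.I * u n)‖ₑ) atTop (𝓝 ‖G (Complex.I * β)‖ₑ) := by
    have h2 : Tendsto (fun n => Complex.I * (u n : ℂ)) atTop
        (𝓝[{z | 0 ≤ z.im ∧ z.im ≤ β}] (Complex.I * β)) := by
      refine tendsto_nhdsWithin_iff.2 ⟨(hlim.ofReal).const_mul _, Eventually.of_forall fun n => ?_⟩
      simpa using ⟨(hu n).1.le, (hu n).2.le⟩
    exact ((hG.continuousOn (Complex.I * β) (by simp [hβ.le])).tendsto.comp h2).enorm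
  have h3 : ∀ x : ℝ, liminf (fun n => ENNReal.ofReal (Real.exp (-u n * x))) atTop =
      ENNReal.ofReal (Real.exp (-β * x)) := by
    intro x
    refine Tendsto.liminf_eq ?_
    exact ENNReal.tendsto_ofReal ((Real.continuous_exp.tendsto _).comp (hlim.neg.mul_const x))
  simp_rw [← h3]
  refine (lintegral_liminf_le fun n => by fun_prop).trans ?_
  simp_rw [fun n => hval (u n) (hu n).1 (hu n).2]
  rw [h1.liminf_eq]

end Strip

/-! ### The GNS representation and its implementing unitary group. -/

section GNS

variable {A : Type*} [CStarAlgebra A] [PartialOrder A] [StarOrderedRing A] (ω : A →ₚ[ℂ] ℂ)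

theorem gnsOrbit_eq_coe (X : A) : gnsOrbit ω X = (ω.toPreGNS X : ω.PreGNS) := by
  simp [gnsOrbit, gnsVector]

theorem inner_gnsOrbit (X Y : A) : ⟪gnsOrbit ω X, gnsOrbit ω Y⟫_ℂ = ω (star X * Y) := by
  rw [gnsOrbit_eq_coe, gnsOrbit_eq_coe, UniformSpace.Completion.inner_coe, ω.preGNS_inner_def]
  rfl

theorem denseRange_gnsOrbit : DenseRange (gnsOrbit ω) := by
  have h : (gnsOrbit ω : A → ω.GNS) = fun X => ((ω.toPreGNS X : ω.PreGNS) : ω.GNS) :=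
    funext (gnsOrbit_eq_coe ω)
  rw [h]
  exact UniformSpace.Completion.denseRange_coe.comp ω.toPreGNS.surjective.denseRange
    (UniformSpace.Completion.continuous_coe _)

theorem norm_gnsOrbit_eq_of_eq {X Y : A} (h : ω (star X * X) = ω (star Y * Y)) :
    ‖gnsOrbit ω X‖ = ‖gnsOrbit ω Y‖ := by
  rw [← inner_gnsOrbit, ← inner_gnsOrbit, inner_self_eq_norm_sq_to_K,
    inner_self_eq_norm_sq_to_K] at h
  exact (sq_eq_sq₀ (norm_nonneg _) (norm_nonneg _)).1 (by exact_mod_cast h)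

variable {ω} {α : ℝ → A ≃⋆ₐ[ℂ] A}

theorem gnsUnitary_gnsOrbit (hinv : ∀ t X, ω (α t X) = ω X) (t : ℝ) (X : A) :
    gnsUnitary α ω t (gnsOrbit ω X) = gnsOrbit ω (α t X) := by
  refine LinearMap.extendOfNorm_eq (denseRange_gnsOrbit ω) ⟨1, fun Y => ?_⟩ X
  rw [one_mul]
  refine le_of_eq (norm_gnsOrbit_eq_of_eq ω ?_)
  change ω (star (α t Y) * α t Y) = _
  rw [← map_star, ← map_mul, hinv]

theorem isUnitaryGroup_gnsUnitary (hα : ∀ s t X, α (s + t) X = α s (α t X))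
    (hinv : ∀ t X, ω (α t X) = ω X) (hcont : ∀ X Y, Continuous fun t => ω (α t X * Y)) :
    IsUnitaryGroup (gnsUnitary α ω) := by
  have h0 : ∀ X, α 0 X = X := fun X => EquivLike.injective (α 0) (by rw [← hα, add_zero])
  have hnorm : ∀ t ξ, ‖gnsUnitary α ω t ξ‖ = ‖ξ‖ := by
    intro t ξ
    refine (denseRange_gnsOrbit ω).induction_on ξ (isClosed_eq (by fun_prop) (by fun_prop)) ?_
    intro X
    rw [gnsUnitary_gnsOrbit hinv]
    refine norm_gnsOrbit_eq_of_eq ω ?_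
    rw [← map_star, ← map_mul, hinv]
  refine ⟨?_, ?_, hnorm, ?_⟩
  · ext ξ
    refine (denseRange_gnsOrbit ω).induction_on ξ (isClosed_eq (by fun_prop) (by fun_prop)) ?_
    intro X
    rw [gnsUnitary_gnsOrbit hinv, h0]
    rfl
  · intro s t ξ
    refine (denseRange_gnsOrbit ω).induction_on ξ (isClosed_eq (by fun_prop) (by fun_prop)) ?_
    intro X
    rw [gnsUnitary_gnsOrbit hinv, gnsUnitary_gnsOrbit hinv, gnsUnitary_gnsOrbit hinv, hα]
  · intro ξ
    refine continuous_of_uniform_approx_of_continuous fun u hu => ?_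
    obtain ⟨ε, hε, hu⟩ := Metric.mem_uniformity_dist.1 hu
    obtain ⟨X, hX⟩ := (denseRange_gnsOrbit ω).exists_dist_lt ξ hε
    refine ⟨fun t => gnsUnitary α ω t (gnsOrbit ω X), ?_, fun t => hu ?_⟩
    · simp_rw [gnsUnitary_gnsOrbit hinv]
      refine continuous_iff_continuousAt.2 fun s => tendsto_iff_norm_sub_tendsto_zero.2 ?_
      -- Weak continuity gives strong continuity because norms are preserved: the squared distance
      -- depends on `t` only through one correlation function.
      have hsq : ∀ t, ‖gnsOrbit ω (α t X) - gnsOrbit ω (α s X)‖ ^ 2 =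
          2 * ‖gnsOrbit ω X‖ ^ 2 - 2 * (ω (α t (star X) * α s X)).re := by
        intro t
        have h1 : ∀ r, ‖gnsOrbit ω (α r X)‖ = ‖gnsOrbit ω X‖ := fun r => by
          rw [← gnsUnitary_gnsOrbit hinv, hnorm]
        rw [@norm_sub_sq ℂ, h1, h1, inner_gnsOrbit, map_star]
        simp only [RCLike.re_to_complex]
        ring
      have h2 : Tendsto (fun t => ‖gnsOrbit ω (α t X) - gnsOrbit ω (α s X)‖ ^ 2) (𝓝 s) (𝓝 0) := by
        have hc : Continuous fun t => ‖gnsOrbit ω (α t X) - gnsOrbit ω (α s X)‖ ^ 2 := by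
          simp_rw [hsq]
          exact continuous_const.sub
            (continuous_const.mul (Complex.continuous_re.comp (hcont (star X) (α s X))))
        simpa using hc.tendsto s
      simpa [Real.sqrt_sq (norm_nonneg _)] using h2.sqrt
    · rw [dist_eq_norm, ← map_sub, hnorm, ← dist_eq_norm]
      exact hX

/-- Invariance moves `α t` off `X`, giving `ω (X * α (-t) Y)`. -/
theorem correlation_eq_inner (hα : ∀ s t X, α (s + t) X = α s (α t X))
    (hinv : ∀ t X, ω (α t X) = ω X) (X Y : A) (t : ℝ) :
    correlation α ω X Y t = ⟪gnsOrbit ω (star X), gnsUnitary α ω (-t) (gnsOrbit ω Y)⟫_ℂ := by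
  have h0 : ∀ X, α 0 X = X := fun X => EquivLike.injective (α 0) (by rw [← hα, add_zero])
  rw [gnsUnitary_gnsOrbit hinv, inner_gnsOrbit, star_star, ← hinv t (X * _), map_mul, ← hα,
    add_neg_cancel, h0]
  rfl

end GNS

/-! ### Norm-controlled preimages under a `*`-homomorphism. -/

/-- This is `(1 + g) a (1 + g)` multiplied out so that no unit appears, as the nonunital calculus
requires. -/
theorem cfcₙ_add_mul_add_mul {A : Type*} [CStarAlgebra A] {g : ℝ → ℝ} (hg : Continuous g)
    (hg0 : g 0 = 0) {a : A} (ha : IsSelfAdjoint a) :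
    cfcₙ (fun s => s + s * g s + (g s * s + g s * s * g s)) a =
      a + a * cfcₙ g a + (cfcₙ g a * a + cfcₙ g a * a * cfcₙ g a) := by
  have hi : ContinuousOn (fun s : ℝ => s) (quasispectrum ℝ a) := continuousOn_id
  have hc : ContinuousOn g (quasispectrum ℝ a) := hg.continuousOn
  rw [cfcₙ_add (fun s => s + s * g s) (fun s => g s * s + g s * s * g s) a (hi.add (hi.mul hc))
      (by simp) ((hc.mul hi).add ((hc.mul hi).mul hc)) (by simp),
    cfcₙ_add (fun s => s) (fun s => s * g s) a hi rfl (hi.mul hc) (by simp),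
    cfcₙ_add (fun s => g s * s) (fun s => g s * s * g s) a (hc.mul hi) (by simp)
      ((hc.mul hi).mul hc) (by simp),
    cfcₙ_mul (fun s => s) g a hi rfl hc hg0,
    cfcₙ_mul (fun s => g s * s) g a (hc.mul hi) (by simp) hc hg0,
    cfcₙ_mul g (fun s => s) a hc hg0 hi rfl, cfcₙ_id' ℝ a ha]

/-- An element of the image of a closed `*`-subalgebra under a `*`-homomorphism has a preimage in
the subalgebra of norm at most its own. -/
theorem exists_mem_norm_le_norm_map {A M : Type*} [CStarAlgebra A] [PartialOrder A]
    [StarOrderedRing A] [CStarAlgebra M] (φ : A →⋆ₐ[ℂ] M) (S : NonUnitalStarSubalgebra ℂ A)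
    [hS : IsClosed (S : Set A)] {X : A} (hX : X ∈ S) : ∃ Y ∈ S, φ Y = φ X ∧ ‖Y‖ ≤ ‖φ X‖ := by
  rcases (norm_nonneg (φ X)).eq_or_lt with h0 | h0
  · exact ⟨0, zero_mem S, by rw [map_zero, norm_eq_zero.1 h0.symm], by simp⟩
  set m := ‖φ X‖
  have hmax : ∀ s : ℝ, 0 < max m √s := fun s => lt_max_of_lt_left h0
  -- With this `g`, the element `X (1 + g (X* X))` has the singular values of `X` truncated at `m`.
  -- Since `g 0 = 0`, it stays in the nonunital subalgebra; since `g` vanishes on the spectrum of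
  -- the image of `X* X`, its image is unchanged.
  let g : ℝ → ℝ := fun s => m / max m √s - 1
  have hg : Continuous g :=
    (continuous_const.div (by fun_prop) fun s => (hmax s).ne').sub continuous_const
  have hg0 : g 0 = 0 := by simp [g, max_eq_left h0.le, div_self h0.ne']
  have ha : IsSelfAdjoint (star X * X) := .star_mul_self X
  have hφc : Continuous φ := AddMonoidHomClass.continuous_of_bound φ 1 fun x => by
    simpa using NonUnitalStarAlgHom.norm_apply_le φ x
  have hφ : φ (X * cfcₙ g (star X * X)) = 0 := by
    have h1 : φ (cfcₙ g (star X * X)) = cfcₙ g (φ (star X * X)) :=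
      NonUnitalStarAlgHomClass.map_cfcₙ (S := ℂ) φ g _ hg.continuousOn hg0
        hφc ha (ha.map φ)
    have h2 : cfcₙ g (φ (star X * X)) = 0 := by
      rw [← norm_le_zero_iff]
      refine norm_cfcₙ_le fun s hs => ?_
      have h3 : s ≤ m ^ 2 := by
        have := norm_apply_le_norm_cfcₙ (id : ℝ → ℝ) _ hs continuousOn_id rfl (ha.map φ)
        rw [cfcₙ_id ℝ _ (ha.map φ), map_mul, map_star, CStarRing.norm_star_mul_self] at this
        exact (le_abs_self s).trans (by simpa [sq] using this)
      have h4 : √s ≤ m := Real.sqrt_le_iff.2 ⟨h0.le, h3⟩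
      simp [g, max_eq_left h4, div_self h0.ne']
    rw [map_mul, h1, h2, mul_zero]
  have hc : star (cfcₙ g (star X * X)) = cfcₙ g (star X * X) :=
    (cfcₙ_predicate (p := IsSelfAdjoint) g (star X * X)).star_eq
  refine ⟨X + X * cfcₙ g (star X * X), add_mem hX (mul_mem hX
    (cfcₙ_mem (𝕜' := ℂ) g (mul_mem (star_mem hX) hX))), by rw [map_add, hφ, add_zero], ?_⟩
  have hY : star (X + X * cfcₙ g (star X * X)) * (X + X * cfcₙ g (star X * X)) =
      cfcₙ (fun s => s + s * g s + (g s * s + g s * s * g s)) (star X * X) := by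
    rw [cfcₙ_add_mul_add_mul hg hg0 ha, star_add, star_mul, hc]
    noncomm_ring
  refine (sq_le_sq₀ (norm_nonneg _) h0.le).1 ?_
  rw [sq, ← CStarRing.norm_star_mul_self, hY]
  refine norm_cfcₙ_le fun s hs => ?_
  have hs0 : 0 ≤ s := quasispectrum_nonneg_of_nonneg _ (star_mul_self_nonneg X) s hs
  have h1 : s + s * g s + (g s * s + g s * s * g s) = s * (m / max m √s) ^ 2 := by
    simp only [g]; ring
  rw [h1, Real.norm_of_nonneg (by positivity), div_pow, mul_div_assoc', div_le_iff₀
    (by have := hmax s; positivity), mul_comm]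
  refine mul_le_mul_of_nonneg_left ?_ (sq_nonneg m)
  calc s = √s ^ 2 := (Real.sq_sqrt hs0).symm
    _ ≤ _ := pow_le_pow_left₀ (Real.sqrt_nonneg s) (le_max_right _ _) 2

/-! ### The energy form and matrix elements on the strip. -/

namespace SpectralMeasure

variable {H : Type*} [NormedAddCommGroup H] [InnerProductSpace ℂ H] [CompleteSpace H]
variable (E : SpectralMeasure H)

theorem scalarMeasure_add_add_scalarMeasure_sub (ξ η : H) :
    E.scalarMeasure (ξ + η) + E.scalarMeasure (ξ - η) =
      (2 : ℝ≥0∞) • (E.scalarMeasure ξ + E.scalarMeasure η) := by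
  ext B hB
  simp only [Measure.smul_apply, Measure.add_apply, E.scalarMeasure_apply _ hB, smul_eq_mul]
  rw [← ENNReal.ofReal_add (by positivity) (by positivity), ← ENNReal.ofReal_add (by positivity)
    (by positivity), ← ENNReal.ofReal_ofNat 2, ← ENNReal.ofReal_mul (by norm_num), map_add, map_sub]
  congr 1
  linarith [parallelogram_law_with_norm ℂ (E.proj B ξ) (E.proj B η)]

theorem scalarMeasure_smul (c : ℂ) (ξ : H) :
    E.scalarMeasure (c • ξ) = ‖c‖ₑ ^ 2 • E.scalarMeasure ξ := by
  ext B hB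
  rw [Measure.smul_apply, E.scalarMeasure_apply _ hB, E.scalarMeasure_apply _ hB, map_smul,
    norm_smul, mul_pow, ENNReal.ofReal_mul (by positivity), smul_eq_mul,
    ENNReal.ofReal_pow (norm_nonneg c), ofReal_norm]

/-- The integral is a supremum, over simple functions, of finite combinations of the continuous
functions `‖E.proj B ξ‖²`. For the energy this plays the role of closedness of `e^{-βK/2}`. -/
theorem lowerSemicontinuous_lintegral (f : ℝ → ℝ≥0∞) :
    LowerSemicontinuous fun ξ => ∫⁻ x, f x ∂E.scalarMeasure ξ := by
  simp_rw [lintegral_eq_nnreal]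
  refine lowerSemicontinuous_iSup fun φ => lowerSemicontinuous_iSup fun _ => ?_
  refine Continuous.lowerSemicontinuous ?_
  simp_rw [SimpleFunc.map_lintegral]
  refine continuous_finsetSum _ fun c _ => ?_
  refine (ENNReal.continuous_const_mul ENNReal.coe_ne_top).comp ?_
  simp_rw [E.scalarMeasure_apply _ (φ.measurableSet_fiber c)]
  exact ENNReal.continuous_ofReal.comp (by fun_prop)

/-- The energy `‖e^{-βK/2}ξ‖² = ∫ e^{-βx} dμ_ξ`, which is infinite off the domain. -/
noncomputable def expEnergy (β : ℝ) (ξ : H) : ℝ≥0∞ :=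
  ∫⁻ x, ENNReal.ofReal (Real.exp (-β * x)) ∂E.scalarMeasure ξ

variable (β : ℝ)

theorem expEnergy_add_add_expEnergy_sub (ξ η : H) :
    E.expEnergy β (ξ + η) + E.expEnergy β (ξ - η) = 2 * (E.expEnergy β ξ + E.expEnergy β η) := by
  simp only [expEnergy]
  rw [← lintegral_add_measure, scalarMeasure_add_add_scalarMeasure_sub, lintegral_smul_measure,
    lintegral_add_measure, smul_eq_mul]

theorem expEnergy_smul (c : ℂ) (ξ : H) : E.expEnergy β (c • ξ) = ‖c‖ₑ ^ 2 * E.expEnergy β ξ := by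
  rw [expEnergy, scalarMeasure_smul, lintegral_smul_measure, smul_eq_mul, expEnergy]

theorem enorm_exp_half_sq (x : ℝ) :
    ‖Real.exp (-(β / 2) * x)‖ₑ ^ 2 = ENNReal.ofReal (Real.exp (-β * x)) := by
  rw [← ofReal_norm, ← ENNReal.ofReal_pow (norm_nonneg _), Real.norm_of_nonneg (Real.exp_nonneg _),
    ← Real.exp_nat_mul]
  congr 2
  push_cast
  ring

theorem mem_domain_integral_exp_iff
    (hf : Measurable fun x : ℝ => Real.exp (-(β / 2) * x)) {ξ : H} :
    ξ ∈ (E.integral hf).domain ↔ E.expEnergy β ξ < ∞ := by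
  change ∫⁻ x, ‖Real.exp (-(β / 2) * x)‖ₑ ^ 2 ∂E.scalarMeasure ξ < ∞ ↔ _
  simp_rw [enorm_exp_half_sq]
  rfl

theorem enorm_integral_exp_sq (hf : Measurable fun x : ℝ => Real.exp (-(β / 2) * x))
    (ξ : (E.integral hf).domain) : ‖E.integral hf ξ‖ₑ ^ 2 = E.expEnergy β ξ := by
  rw [(E.hasIntegral_integral hf ξ).enorm_eq, eLpNorm_two_sq, expEnergy]
  refine lintegral_congr fun x => ?_
  rw [← enorm_exp_half_sq, ← ofReal_norm, ← ofReal_norm, Complex.norm_real]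

theorem norm_integral_exp_le_iff (hf : Measurable fun x : ℝ => Real.exp (-(β / 2) * x))
    (ξ : (E.integral hf).domain) {C : ℝ} (hC : 0 ≤ C) :
    ‖E.integral hf ξ‖ ≤ C ↔ E.expEnergy β ξ ≤ ENNReal.ofReal (C ^ 2) := by
  rw [← enorm_integral_exp_sq E β hf, ← ofReal_norm, ← ENNReal.ofReal_pow (norm_nonneg _),
    ENNReal.ofReal_le_ofReal_iff (sq_nonneg C), sq_le_sq₀ (norm_nonneg _) hC]

/-- A bounded operator whose range consists of vectors of finite energy is bounded for the
energy norm. -/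
theorem exists_expEnergy_le {V : Type*} [NormedAddCommGroup V] [NormedSpace ℂ V]
    [CompleteSpace V] (T : V →L[ℂ] H) (h : ∀ v, E.expEnergy β (T v) < ∞) :
    ∃ C : ℝ, 0 ≤ C ∧ ∀ v, E.expEnergy β (T v) ≤ ENNReal.ofReal ((C * ‖v‖) ^ 2) := by
  have hf : Measurable fun x : ℝ => Real.exp (-(β / 2) * x) := by fun_prop
  have hdom : ∀ v, T v ∈ (E.integral hf).domain := fun v =>
    (E.mem_domain_integral_exp_iff β hf).2 (h v)
  let L : V →ₗ[ℂ] H := (E.integral hf).toFun ∘ₗ (T : V →ₗ[ℂ] H).codRestrict _ hdom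
  let p : Seminorm ℂ V := (normSeminorm ℂ H).comp L
  have hp : ∀ v {C : ℝ}, 0 ≤ C → (p v ≤ C ↔ E.expEnergy β (T v) ≤ ENNReal.ofReal (C ^ 2)) :=
    fun v C hC => E.norm_integral_exp_le_iff β hf ⟨T v, hdom v⟩ hC
  -- A lower semicontinuous seminorm on a Banach space is continuous; this replaces the closed graph
  -- theorem.
  have hlsc : LowerSemicontinuous p := by
    rw [lowerSemicontinuous_iff_isClosed_preimage]
    intro y
    rcases lt_or_ge y 0 with hy | hy
    · convert isClosed_empty
      ext v
      simpa using hy.trans_le (apply_nonneg p v)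
    · have : p ⁻¹' Iic y = T ⁻¹' (E.expEnergy β ⁻¹' Iic (ENNReal.ofReal (y ^ 2))) := by
        ext v
        exact hp v hy
      rw [this]
      exact ((E.lowerSemicontinuous_lintegral _).isClosed_preimage _).preimage T.continuous
  obtain ⟨C, hC, h⟩ := p.bound_of_continuous_normedSpace
    (p.continuous_of_lowerSemicontinuous hlsc)
  exact ⟨C, hC.le, fun v => (hp v (by positivity)).1 (h v)⟩

variable {β}

/-- Matrix elements of the unitary group between vectors of finite energy extend to the strip. -/
theorem exists_isStripExtension_inner {ξ η : H} (hξ : E.expEnergy β ξ < ∞)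
    (hη : E.expEnergy β η < ∞) :
    ∃ G, IsStripExtension β (fun t => ⟪ξ, E.unitaryGroup (-t) η⟫_ℂ) G ∧
      ∀ t : ℝ, ‖G (t + Complex.I * β)‖ₑ ≤ E.expEnergy β ξ + E.expEnergy β η := by
  have hfin : ∀ ζ : H, E.expEnergy β ζ < ∞ →
      Integrable (fun x => Real.exp (-β * x)) (E.scalarMeasure ζ) := fun ζ hζ =>
    ⟨by fun_prop, (hasFiniteIntegral_iff_ofReal (Eventually.of_forall fun x =>
      Real.exp_nonneg _)).2 hζ⟩
  let g : H → ℂ → ℂ := fun ζ z => ProbabilityTheory.complexMGF id (E.scalarMeasure ζ)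
    (z * Complex.I)
  have hg : ∀ ζ, E.expEnergy β ζ < ∞ → IsStripExtension β (charFun (E.scalarMeasure ζ)) (g ζ) :=
    fun ζ hζ => isStripExtension_complexMGF (hfin ζ hζ)
  have hgb : ∀ ζ, E.expEnergy β ζ < ∞ → ∀ t : ℝ, ‖g ζ (t + Complex.I * β)‖ₑ ≤ E.expEnergy β ζ := by
    intro ζ hζ t
    rw [← ofReal_norm]
    refine (ENNReal.ofReal_le_ofReal ProbabilityTheory.norm_complexMGF_le_mgf).trans ?_
    rw [ProbabilityTheory.mgf, ofReal_integral_eq_lintegral_ofReal]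
    · refine le_of_eq (lintegral_congr fun x => ?_)
      simp
    · convert hfin ζ hζ using 3
      simp
    · exact Eventually.of_forall fun x => Real.exp_nonneg _
  have h2 : ∀ ζ : H, E.expEnergy β ζ < ∞ → E.expEnergy β (ξ + ζ) < ∞ ∧ E.expEnergy β (ξ - ζ) < ∞ :=
    fun ζ hζ => ENNReal.add_lt_top.1 (by
      rw [E.expEnergy_add_add_expEnergy_sub]
      exact ENNReal.mul_lt_top (by simp) (ENNReal.add_lt_top.2 ⟨hξ, hζ⟩))
  have hI : E.expEnergy β (Complex.I • η) = E.expEnergy β η := by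
    rw [expEnergy_smul, ← ofReal_norm, Complex.norm_I]
    simp
  obtain ⟨a1, a2⟩ := h2 η hη
  obtain ⟨a3, a4⟩ := h2 (Complex.I • η) (hI ▸ hη)
  refine ⟨(4⁻¹ : ℂ) • (g (ξ + η) + (-1 : ℂ) • g (ξ - η) + (-Complex.I) • g (ξ + Complex.I • η) +
    Complex.I • g (ξ - Complex.I • η)), ?_, fun t => ?_⟩
  · convert ((((hg _ a1).add ((hg _ a2).const_smul (-1))).add
      ((hg _ a3).const_smul (-Complex.I))).add ((hg _ a4).const_smul Complex.I)).const_smul 4⁻¹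
      using 1
    funext t
    have hch : ∀ ζ, charFun (E.scalarMeasure ζ) t = ⟪ζ, E.unitaryGroup (-t) ζ⟫_ℂ := fun ζ => by
      rw [inner_unitaryGroup, neg_neg]
    simp only [Pi.smul_apply, Pi.add_apply, hch, map_add, map_sub, map_smul, inner_add_left,
      inner_add_right, inner_sub_left, inner_sub_right, inner_smul_left, inner_smul_right,
      smul_eq_mul, Complex.conj_I]
    linear_combination (1 / 2 * ⟪ξ, E.unitaryGroup (-t) η⟫_ℂ -
      1 / 2 * ⟪η, E.unitaryGroup (-t) ξ⟫_ℂ) * (Complex.I_mul_I)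
  · have h4 : ‖(4⁻¹ : ℂ)‖ₑ * 2 * 2 = 1 := by
      rw [← ofReal_norm, ← ENNReal.ofReal_ofNat 2, ← ENNReal.ofReal_mul (norm_nonneg _),
        ← ENNReal.ofReal_mul (by positivity)]
      norm_num
    -- By the parallelogram law the four energies in the polarization add up to four times the sum
    -- for `ξ` and `η`, so the factor `1/4` leaves exactly that sum.
    have hsum : E.expEnergy β ξ + E.expEnergy β η = ‖(4⁻¹ : ℂ)‖ₑ *
        (E.expEnergy β (ξ + η) + E.expEnergy β (ξ - η) + E.expEnergy β (ξ + Complex.I • η) +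
          E.expEnergy β (ξ - Complex.I • η)) := by
      rw [add_assoc, E.expEnergy_add_add_expEnergy_sub, E.expEnergy_add_add_expEnergy_sub, hI,
        ← two_mul, ← mul_assoc, ← mul_assoc, h4, one_mul]
    have hIe : ‖Complex.I‖ₑ = 1 := by rw [← ofReal_norm, Complex.norm_I, ENNReal.ofReal_one]
    rw [hsum, Pi.smul_apply, enorm_smul]
    gcongr
    refine (enorm_add_le _ _).trans (add_le_add ((enorm_add_le _ _).trans (add_le_add
      ((enorm_add_le _ _).trans (add_le_add (hgb _ a1 t) ?_)) ?_)) ?_)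
    all_goals
      rw [Pi.smul_apply, enorm_smul]
      simp only [enorm_neg, enorm_one, hIe, one_mul]
      exact hgb _ (by assumption) t

/-- **Cauchy-Schwarz inequality** on the upper edge of the strip. -/
theorem norm_le_of_isStripExtension_inner (hβ : 0 < β) {ξ η : H} {x y : ℝ} (hx : 0 ≤ x)
    (hy : 0 ≤ y) (hξ : E.expEnergy β ξ ≤ ENNReal.ofReal (x ^ 2))
    (hη : E.expEnergy β η ≤ ENNReal.ofReal (y ^ 2)) {G : ℂ → ℂ}
    (hG : IsStripExtension β (fun t => ⟪ξ, E.unitaryGroup (-t) η⟫_ℂ) G) (t : ℝ) :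
    ‖G (t + Complex.I * β)‖ ≤ 2 * x * y := by
  -- Scaling `ξ` by `r` and `η` by `r⁻¹` leaves the matrix element, hence its extension, unchanged
  -- but alters the sum of energies.
  have key : ∀ r : ℝ, 0 < r → ‖G (t + Complex.I * β)‖ ≤ (r * x) ^ 2 + (r⁻¹ * y) ^ 2 := by
    intro r hr
    have hs : ∀ (s z : ℝ) (ζ : H), E.expEnergy β ζ ≤ ENNReal.ofReal (z ^ 2) →
        E.expEnergy β ((s : ℂ) • ζ) ≤ ENNReal.ofReal ((s * z) ^ 2) := by
      intro s z ζ h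
      rw [expEnergy_smul, mul_pow, ENNReal.ofReal_mul (sq_nonneg s), ← ofReal_norm,
        Complex.norm_real, ← ENNReal.ofReal_pow (norm_nonneg s), Real.norm_eq_abs, sq_abs]
      gcongr
    have h1 := hs r x ξ hξ
    have h2 := hs r⁻¹ y η hη
    obtain ⟨G', hG', hb⟩ := E.exists_isStripExtension_inner (h1.trans_lt ENNReal.ofReal_lt_top)
      (h2.trans_lt ENNReal.ofReal_lt_top)
    have e : (fun t => ⟪(r : ℂ) • ξ, E.unitaryGroup (-t) (((r⁻¹ : ℝ) : ℂ) • η)⟫_ℂ) =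
        fun t => ⟪ξ, E.unitaryGroup (-t) η⟫_ℂ := by
      funext t
      have : (r : ℂ) ≠ 0 := by exact_mod_cast hr.ne'
      rw [map_smul, inner_smul_left, inner_smul_right, Complex.conj_ofReal]
      push_cast
      field_simp
    rw [e] at hG'
    have h3 := hG.eqOn hβ hG' (x := t + Complex.I * β) (by simp [hβ.le])
    have h4 := (hb t).trans (add_le_add h1 h2)
    rwa [← h3, ← ENNReal.ofReal_add (sq_nonneg _) (sq_nonneg _), ← ofReal_norm,
      ENNReal.ofReal_le_ofReal_iff (by positivity)] at h4
  have key2 : ∀ ε : ℝ, 0 < ε → ‖G (t + Complex.I * β)‖ ≤ 2 * (x + ε) * (y + ε) := by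
    intro ε hε
    have hx' : 0 < x + ε := by linarith
    have hy' : 0 < y + ε := by linarith
    -- The optimal `r²` is `y / x`; `ε` keeps it defined and positive when `x` or `y` is zero.
    refine (key √((y + ε) / (x + ε)) (by positivity)).trans ?_
    rw [mul_pow, mul_pow, inv_pow, Real.sq_sqrt (by positivity), inv_div]
    have h1 : (y + ε) / (x + ε) * x ^ 2 ≤ (y + ε) / (x + ε) * (x + ε) ^ 2 := by
      gcongr
      linarith
    have h2 : (x + ε) / (y + ε) * y ^ 2 ≤ (x + ε) / (y + ε) * (y + ε) ^ 2 := by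
      gcongr
      linarith
    have h3 : (y + ε) / (x + ε) * (x + ε) ^ 2 = (y + ε) * (x + ε) := by field_simp
    have h4 : (x + ε) / (y + ε) * (y + ε) ^ 2 = (x + ε) * (y + ε) := by field_simp
    linarith
  have hlim : Tendsto (fun ε : ℝ => 2 * (x + ε) * (y + ε)) (𝓝[>] 0) (𝓝 (2 * x * y)) := by
    have : Continuous fun ε : ℝ => 2 * (x + ε) * (y + ε) := by fun_prop
    simpa using (this.tendsto 0).mono_left nhdsWithin_le_nhds
  exact ge_of_tendsto hlim (eventually_mem_nhdsWithin.mono key2)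

end SpectralMeasure

/-! ### Boundedness and holomorphy compared. -/

section Main

/-- `β/2`-boundedness in terms of the spectral measure of the unitary group. -/
theorem isBetaBounded_iff_expEnergy {H : Type*} [NormedAddCommGroup H] [InnerProductSpace ℂ H]
    [CompleteSpace H] {K : H →ₗ.[ℂ] H} {E : SpectralMeasure H}
    (hE : ∀ (f : ℝ → ℝ) (hf : Measurable f), functionOf K hf = E.integral hf)
    (β : ℝ) (Ω : H) (S : Submodule ℂ (H →L[ℂ] H)) :
    IsBetaBounded (β / 2) K Ω S ↔
      ∃ C : ℝ, 0 ≤ C ∧ ∀ T ∈ S, E.expEnergy β (T Ω) ≤ ENNReal.ofReal ((C * ‖T‖) ^ 2) := by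
  have hf : Measurable fun x : ℝ => Real.exp (-(β / 2) * x) := by fun_prop
  unfold IsBetaBounded
  rw [show expNeg K (β / 2) = E.integral hf from hE _ hf]
  constructor
  · rintro ⟨hdom, C, hC⟩
    refine ⟨max C 0, le_max_right _ _, fun T hT => ?_⟩
    refine (E.norm_integral_exp_le_iff β hf ⟨T Ω, hdom T hT⟩ (by positivity)).1 ?_
    exact (hC T hT).trans (by gcongr; exact le_max_left _ _)
  · rintro ⟨C, hC0, hC⟩
    have hdom : ∀ T ∈ S, T Ω ∈ (E.integral hf).domain := fun T hT =>
      (E.mem_domain_integral_exp_iff β hf).2 ((hC T hT).trans_lt ENNReal.ofReal_lt_top)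
    exact ⟨hdom, C, fun T hT =>
      (E.norm_integral_exp_le_iff β hf ⟨T Ω, hdom T hT⟩ (by positivity)).2 (hC T hT)⟩

variable {A : Type*} [CStarAlgebra A] [PartialOrder A] [StarOrderedRing A] {ω : A →ₚ[ℂ] ℂ}

variable (ω) in
/-- `X ↦ π(X)Ω` as a bounded operator. -/
noncomputable def gnsOrbitL : A →L[ℂ] ω.GNS :=
  (gnsOrbit ω).mkContinuous ‖gnsVector ω‖ fun X => by
    rw [mul_comm]
    refine ((ω.gnsStarAlgHom X).le_opNorm (gnsVector ω)).trans ?_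
    gcongr
    exact NonUnitalStarAlgHom.norm_apply_le ω.gnsStarAlgHom X

/-- A bound for the energy of `π(X)Ω` by the norm of `X` on a `*`-subalgebra improves to a bound
by the norm of `π(X)`. -/
theorem expEnergy_gnsOrbit_le_norm_gnsStarAlgHom {E : SpectralMeasure ω.GNS} {β C : ℝ}
    (hC : 0 ≤ C) {B : NonUnitalStarSubalgebra ℂ A}
    (h : ∀ X ∈ B, E.expEnergy β (gnsOrbit ω X) ≤ ENNReal.ofReal ((C * ‖X‖) ^ 2)) {X : A}
    (hX : X ∈ B) :
    E.expEnergy β (gnsOrbit ω X) ≤ ENNReal.ofReal ((C * ‖ω.gnsStarAlgHom X‖) ^ 2) := by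
  have hcl : ∀ Y ∈ B.topologicalClosure, ∀ r, ‖Y‖ ≤ r →
      E.expEnergy β (gnsOrbit ω Y) ≤ ENNReal.ofReal ((C * r) ^ 2) := by
    intro Y hY r hr
    -- Approximants from `B` may have norm slightly above `r`, so a larger `s` is allowed first and
    -- then decreased to `r`.
    have key : ∀ s, r < s → E.expEnergy β (gnsOrbit ω Y) ≤ ENNReal.ofReal ((C * s) ^ 2) := by
      intro s hs
      have hclosed : IsClosed {Z : A | E.expEnergy β (gnsOrbit ω Z) ≤
          ENNReal.ofReal ((C * s) ^ 2)} :=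
        ((E.lowerSemicontinuous_lintegral _).isClosed_preimage _).preimage (gnsOrbitL ω).continuous
      have hmem : Y ∈ closure ((B : Set A) ∩ Metric.ball 0 s) := by
        rw [mem_closure_iff_nhds]
        intro t ht
        have hb : t ∩ Metric.ball (0 : A) s ∈ 𝓝 Y :=
          inter_mem ht (Metric.isOpen_ball.mem_nhds (by simpa using hr.trans_lt hs))
        obtain ⟨Z, hZ, hZB⟩ := mem_closure_iff_nhds.1 hY _ hb
        exact ⟨Z, hZ.1, hZB, hZ.2⟩
      refine closure_minimal ?_ hclosed hmem
      rintro Z ⟨hZB, hZ⟩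
      refine (h Z hZB).trans (ENNReal.ofReal_le_ofReal ?_)
      have : ‖Z‖ ≤ s := by simpa using (mem_ball_zero_iff.1 hZ).le
      gcongr
    have hlim : Tendsto (fun s => ENNReal.ofReal ((C * s) ^ 2)) (𝓝[>] r)
        (𝓝 (ENNReal.ofReal ((C * r) ^ 2))) := by
      have : Continuous fun s => ENNReal.ofReal ((C * s) ^ 2) :=
        ENNReal.continuous_ofReal.comp (by fun_prop)
      exact (this.tendsto r).mono_left nhdsWithin_le_nhds
    exact ge_of_tendsto hlim (eventually_mem_nhdsWithin.mono key)
  have : IsClosed (B.topologicalClosure : Set A) := B.isClosed_topologicalClosure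
  -- The truncated preimage is only known to lie in the closure of `B`, whence the extension of the
  -- bound in `hcl`.
  obtain ⟨Y, hY, hYX, hn⟩ := exists_mem_norm_le_norm_map ω.gnsStarAlgHom B.topologicalClosure
    (B.le_topologicalClosure hX)
  have : gnsOrbit ω Y = gnsOrbit ω X := congrArg (fun T => T (gnsVector ω)) hYX
  exact this ▸ hcl Y hY _ hn

/-- Replaces `‖π(X)‖` by `‖X‖` with the same constant: one direction is contractivity of `π`, the
other is the lifting of `π(X)` to a preimage of controlled norm. -/
theorem isBetaBounded_gnsImage_iff {K : ω.GNS →ₗ.[ℂ] ω.GNS} {E : SpectralMeasure ω.GNS}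
    (hE : ∀ (f : ℝ → ℝ) (hf : Measurable f), functionOf K hf = E.integral hf)
    (β : ℝ) (B : NonUnitalStarSubalgebra ℂ A) :
    IsBetaBounded (β / 2) K (gnsVector ω) (gnsImage ω B) ↔
      ∃ C : ℝ, 0 ≤ C ∧ ∀ X ∈ B, E.expEnergy β (gnsOrbit ω X) ≤ ENNReal.ofReal ((C * ‖X‖) ^ 2) := by
  rw [isBetaBounded_iff_expEnergy hE]
  refine exists_congr fun C => and_congr_right fun hC => ⟨fun h X hX => ?_, ?_⟩
  · refine (h _ ⟨X, hX, rfl⟩).trans (ENNReal.ofReal_le_ofReal ?_)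
    have : ‖ω.gnsStarAlgHom X‖ ≤ ‖X‖ := NonUnitalStarAlgHom.norm_apply_le ω.gnsStarAlgHom X
    change (C * ‖ω.gnsStarAlgHom X‖) ^ 2 ≤ _
    gcongr
  · rintro h _ ⟨X, hX, rfl⟩
    exact expEnergy_gnsOrbit_le_norm_gnsStarAlgHom hC h hX

variable {α : ℝ → A ≃⋆ₐ[ℂ] A} {β : ℝ} {E : SpectralMeasure ω.GNS}

theorem correlation_eq (hα : ∀ s t X, α (s + t) X = α s (α t X))
    (hinv : ∀ t X, ω (α t X) = ω X) (hE : E.unitaryGroup = gnsUnitary α ω) (X Y : A) :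
    correlation α ω X Y =
      fun t => ⟪gnsOrbit ω (star X), E.unitaryGroup (-t) (gnsOrbit ω Y)⟫_ℂ := by
  funext t
  rw [correlation_eq_inner hα hinv, hE]

/-- On the diagonal the correlation comes from a positive measure, which is what Landau's theorem
needs. -/
theorem correlation_star_self (hα : ∀ s t X, α (s + t) X = α s (α t X))
    (hinv : ∀ t X, ω (α t X) = ω X) (hE : E.unitaryGroup = gnsUnitary α ω) (X : A) :
    correlation α ω (star X) X = charFun (E.scalarMeasure (gnsOrbit ω X)) := by
  rw [correlation_eq hα hinv hE, star_star]
  funext t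
  rw [E.inner_unitaryGroup, neg_neg]

end Main

theorem mainTheorem4 {A : Type*} [CStarAlgebra A] [PartialOrder A] [StarOrderedRing A]
    (α : ℝ → A ≃⋆ₐ[ℂ] A) (hα : ∀ s t X, α (s + t) X = α s (α t X))
    (ω : A →ₚ[ℂ] ℂ) (hω : ω 1 = 1) (hinv : ∀ t X, ω (α t X) = ω X)
    (hcont : ∀ X Y, Continuous fun t => ω (α t X * Y))
    (B : NonUnitalStarSubalgebra ℂ A) (β : ℝ) (hβ : 0 < β) :
    (IsBetaBounded (β / 2) (generator (gnsUnitary α ω)) (gnsVector ω) (gnsImage ω B) ↔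
      IsBetaHolomorphic β α ω B ∧
        ∃ C : ℝ, 0 < C ∧ ∀ X ∈ B, ∀ Y ∈ B, ∀ G : ℂ → ℂ,
          IsStripExtension β (correlation α ω X Y) G →
            ∀ t : ℝ, ‖G (t + Complex.I * β)‖ ≤ C * ‖X‖ * ‖Y‖) ∧
    (IsClosed (B : Set A) →
      (IsBetaBounded (β / 2) (generator (gnsUnitary α ω)) (gnsVector ω) (gnsImage ω B) ↔
        IsBetaHolomorphic β α ω B)) := by
  obtain ⟨E, hU, hE⟩ :=
    exists_functionOf_generator_eq (isUnitaryGroup_gnsUnitary hα hinv hcont)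
  rw [isBetaBounded_gnsImage_iff hE]
  have hfwd : (∃ C : ℝ, 0 ≤ C ∧ ∀ X ∈ B,
      E.expEnergy β (gnsOrbit ω X) ≤ ENNReal.ofReal ((C * ‖X‖) ^ 2)) →
      IsBetaHolomorphic β α ω B := by
    rintro ⟨C, -, hC⟩
    refine ⟨hinv, fun X hX Y hY => ?_⟩
    rw [correlation_eq hα hinv hU]
    obtain ⟨G, hG, -⟩ := E.exists_isStripExtension_inner
      ((hC _ (star_mem hX)).trans_lt ENNReal.ofReal_lt_top)
      ((hC Y hY).trans_lt ENNReal.ofReal_lt_top)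
    exact ⟨G, hG⟩
  have hle : ∀ (X : A) (G : ℂ → ℂ), IsStripExtension β (correlation α ω (star X) X) G →
      E.expEnergy β (gnsOrbit ω X) ≤ ‖G (Complex.I * β)‖ₑ := by
    intro X G hG
    rw [correlation_star_self hα hinv hU] at hG
    exact hG.lintegral_exp_le hβ
  refine ⟨⟨fun h => ⟨hfwd h, ?_⟩, ?_⟩, fun hB => ⟨hfwd, ?_⟩⟩
  · obtain ⟨C, hC0, hC⟩ := h
    -- The edge estimate gives `2 * C ^ 2`; the extra `1` makes the constant positive when `C = 0`.
    refine ⟨2 * C ^ 2 + 1, by positivity, fun X hX Y hY G hG t => ?_⟩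
    rw [correlation_eq hα hinv hU] at hG
    have h1 := E.norm_le_of_isStripExtension_inner hβ (by positivity) (by positivity)
      (hC _ (star_mem hX)) (hC Y hY) hG t
    rw [norm_star] at h1
    have h2 : 0 ≤ ‖X‖ * ‖Y‖ := by positivity
    linarith
  · rintro ⟨⟨-, hG⟩, C, hC0, hC⟩
    -- The energy is a squared norm, and it is bounded by `|G(iβ)| ≤ C ‖X‖²`.
    refine ⟨√C, Real.sqrt_nonneg C, fun X hX => ?_⟩
    obtain ⟨G, hG⟩ := hG _ (star_mem hX) X hX
    have h1 := hC _ (star_mem hX) X hX G hG 0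
    rw [Complex.ofReal_zero, zero_add, norm_star] at h1
    refine (hle X G hG).trans ?_
    rw [← ofReal_norm, mul_pow, Real.sq_sqrt hC0.le]
    exact ENNReal.ofReal_le_ofReal (by linarith)
  · rintro ⟨-, hG⟩
    -- Closedness enters only here: it makes `B` a Banach space, so that pointwise finite energy
    -- gives a uniform bound.
    have : CompleteSpace B.toSubmodule := hB.completeSpace_coe
    obtain ⟨C, hC0, hC⟩ := E.exists_expEnergy_le β ((gnsOrbitL ω).comp B.toSubmodule.subtypeL)
      fun X => by
        obtain ⟨G, hG⟩ := hG _ (star_mem X.2) X.1 X.2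
        exact (hle X.1 G hG).trans_lt enorm_lt_top
    exact ⟨C, hC0, fun X hX => hC ⟨X, hX⟩⟩
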